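/- **Setting.** Let $d\ge 1$, $n\ge 1$, and let $W$ be a Brownian sheet on $[0,1]^d$ (mean-zero Gaussian process with continuous paths and covariance $\prod_i\min\{s_i,t_i\}$). For $f:[0,1]^d\to\mathbb R$ one observes $Y(t)=\sqrt n\int_{[0,t]}f(s)\,ds+W(t)$, $t\in[0,1]^d$. Let $\mathcal F_1$ be the class of coordinate-wise nondecreasing functions and $\mathcal F_2$ the class of convex functions on $[0,1]^d$. A kernel is a measurable $\psi\in L^2(\mathbb R^d)$ of bounded Hardy–Krause variation that vanishes outside $[-1,1]^d$ and has $\langle 1,\psi\rangle:=\int\psi>0$; $\|\psi\|$ is its $L^2$ norm. For $h\in I:=(0,1/2]^d$ and $t\in A_h:=\prod_i[h_i,1-h_i]$ put $\psi_{t,h}(x)=\psi\big(\frac{x_1-t_1}{h_1},\dots,\frac{x_d-t_d}{h_d}\big)$ and $$\hat f_h(t)=\frac{1}{\sqrt n\,(\prod_i h_i)\langle 1,\psi\rangle}\int_{[0,1]^d}\psi_{t,h}\,dY .$$ Let $\Gamma(r)=(2\log(e/r))^{1/2}$ and $$T(\pm\psi)=\sup_{h\in I}\sup_{t\in A_h}\Big(\pm\frac{\int_{[0,1]^d}\psi_{t,h}\,dW}{(\prod_i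 h_i)^{1/2}\|\psi\|}-\Gamma\big(2^d\textstyle\prod_i h_i\big)\Big).$$ Given kernels $\psi^\ell,\psi^u$ with estimators $\hat f^\ell_h,\hat f^u_h$ and $\alpha\in(0,1)$, let $\kappa_\alpha$ be the $(1-\alpha)$-quantile of $\max\{T(\psi^\ell),T(-\psi^u)\}$ and $$\hat\ell(t)=\sup_{h\in I:\,t\in A_h}\Big\{\hat f^\ell_h(t)-\frac{\|\psi^\ell\|(\kappa_\alpha+\Gamma(2^d\prod_i h_i))}{\langle 1,\psi^\ell\rangle(n\prod_i h_i)^{1/2}}\Big\},\qquad \hat u(t)=\inf_{h\in I:\,t\in A_h}\Big\{\hat f^u_h(t)+\frac{\|\psi^u\|(\kappa_\alpha+\Gamma(2^d\prod_i h_i))}{\langle 1,\psi^u\rangle(n\prod_i h_i)^{1/2}}\Big\}.$$ The kernels satisfy the two-sided bias condition for $\mathcal F$ if $\mathbb E\,\hat f^\ell_h(t)\le f(t)\le\mathbb E\,\hat f^u_h(t)$ for all $f\in\mathcal F$, $h\in I$, $t\in A_h$. For $0<\beta\le 2$, with $m$ the largest integer strictly less than $\beta$, $f$ is Hölder smooth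 on a box $B$ with parameters $\beta$ and $L$ if all its partial derivatives of order $m$ exist on $B$, the suprema over $B$ of the absolute values of its partial derivatives of orders $\le m$ add up to at most $L$, and $\sum_{|k|=m}|\partial^kf(y)-\partial^kf(z)|\le L\|y-z\|^{\beta-m}$ for all $y,z\in B$. **Theorem.** Let $j\in\{1,2\}$, $j-1<\beta\le j$, $L>0$, and let the kernels $\psi^\ell,\psi^u$ satisfy the two-sided bias condition for $\mathcal F_j$. Let $t_0\in(0,1)^d$ and $\varepsilon\in(0,1/2)$ be such that $B_\infty(t_0,\varepsilon)=\{x:|x_i-t_{0,i}|\le\varepsilon\ \forall i\}\subset[0,1]^d$, and let $f\in\mathcal F_j$ be Hölder smooth on $B_\infty(t_0,\varepsilon)$ with parameters $\beta$ and $L$. Put $\rho_n=(\log(en)/n)^{\beta/(2\beta+d)}$. (a) There is a constant $K>0$, depending only on $\beta,L,\psi^\ell,\psi^u,\varepsilon$, such that for all $n\ge 1$, almost surely, $$\hat u(t_0)-\hat\ell(t_0)\le K\rho_n\Big(1+\frac{|\kappa_\alpha|+|T(-\psi^\ell)|+|T(\psi^u)|}{(\log(en))^{1/2}}\Big).$$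 (b) For every $\delta\in(0,1)$, in particular for $\delta=\alpha$, there is a constant $\Delta>0$, depending only on $\beta,L,\psi^\ell,\psi^u,\alpha,\delta,\varepsilon$, such that for all $n\ge 1$ $$\mathbb P_f\big(\hat u(t_0)-\hat\ell(t_0)\le\Delta\rho_n\big)\ge 1-\delta .$$ Hence the width of the band at $t_0$ is $O_P(\rho_n)$. (c) There are constants $K_0$ and $\Delta_0$ that do not depend on $\varepsilon$ ($K_0$ depends only on $\beta,L,\psi^\ell,\psi^u$ and $\Delta_0$ only on $\beta,L,\psi^\ell,\psi^u,\alpha,\delta$) with which the inequalities of (a) and (b) hold for all $n\ge1$ such that $(\log(en)/n)^{1/(2\beta+d)}\le\varepsilon$. -/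

import Mathlib

open MeasureTheory ProbabilityTheory Filter Set
open scoped ENNReal NNReal

noncomputable section

/-! ### Shape classes and local Hölder smoothness

Functions on `[0,1]^d` are represented by functions on `ℝ^d = (Fin d → ℝ)` of which only the values
on the cube `Icc 0 1` are ever used. -/

/-- The class `F_1` of coordinate-wise nondecreasing functions (`j = 1`) and the class `F_2` of
convex functions (`j = 2`) on the cube `[0,1]^d`. -/
def ShapeClass (d j : ℕ) : Set ((Fin d → ℝ) → ℝ) :=
  {f | (j = 1 ∧ MonotoneOn f (Icc 0 1)) ∨ (j = 2 ∧ ConvexOn ℝ (Icc 0 1) f)}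

/-- The closed box `B_∞(t, ε)`. -/
def supBox {d : ℕ} (t : Fin d → ℝ) (ε : ℝ) : Set (Fin d → ℝ) :=
  {x | ∀ i, |t i - x i| ≤ ε}

/-- The part inside `B` of the line through `x` parallel to the `i`-th axis. -/
def axisSlice {d : ℕ} (B : Set (Fin d → ℝ)) (i : Fin d) (x : Fin d → ℝ) : Set ℝ :=
  {s | Function.update x i s ∈ B}

/-- The `i`-th partial derivative at `x` of `f` as a function on `B` (one-sided at the faces of a
closed box). -/
def partialWithin {d : ℕ} (B : Set (Fin d → ℝ)) (i : Fin d) (f : (Fin d → ℝ) → ℝ)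
    (x : Fin d → ℝ) : ℝ :=
  derivWithin (fun s => f (Function.update x i s)) (axisSlice B i x) (x i)

/-- Existence of the `i`-th partial derivative at `x` of `f` as a function on `B`. -/
def HasPartialWithin {d : ℕ} (B : Set (Fin d → ℝ)) (i : Fin d) (f : (Fin d → ℝ) → ℝ)
    (x : Fin d → ℝ) : Prop :=
  DifferentiableWithinAt ℝ (fun s => f (Function.update x i s)) (axisSlice B i x) (x i)

/-- The Euclidean norm on `ℝ^d`. -/
def euclNorm {d : ℕ} (x : Fin d → ℝ) : ℝ := √(∑ i, x i ^ 2)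

/-- The Hölder class with exponent `β ∈ (0, 2]` and constant `L` on a box `B`. With `m` the largest
integer strictly less than `β`, all partial derivatives of order `m` exist on `B`, the suprema over
`B` of the absolute partial derivatives of all orders `≤ m` sum up to at most `L`, and the sum of the
absolute increments of the partial derivatives of order `m` between `y` and `z` is at most
`L ‖y - z‖ ^ (β - m)`. Here `m = 0` if `β ≤ 1`, and `m = 1` if `1 < β ≤ 2`. -/
def IsHolderOn {d : ℕ} (β L : ℝ) (B : Set (Fin d → ℝ)) (f : (Fin d → ℝ) → ℝ) : Prop :=
  if β ≤ 1 then
    (⨆ x ∈ B, ‖f x‖ₑ) ≤ ENNReal.ofReal L ∧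
    ∀ y ∈ B, ∀ z ∈ B, |f y - f z| ≤ L * euclNorm (y - z) ^ β
  else
    (∀ i, ∀ x ∈ B, HasPartialWithin B i f x) ∧
    (⨆ x ∈ B, ‖f x‖ₑ) + ∑ i, (⨆ x ∈ B, ‖partialWithin B i f x‖ₑ) ≤ ENNReal.ofReal L ∧
    ∀ y ∈ B, ∀ z ∈ B,
      ∑ i, |partialWithin B i f y - partialWithin B i f z| ≤ L * euclNorm (y - z) ^ (β - 1)

/-! ### Hardy-Krause variation -/

/-- The mixed difference of `g` over the box with corners `x` and `y` in the coordinates in `u`, the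
other coordinates being kept equal to those of `c`. -/
def mixedDiff {d : ℕ} (u : Finset (Fin d)) (g : (Fin d → ℝ) → ℝ) (c x y : Fin d → ℝ) : ℝ :=
  ∑ v ∈ u.powerset,
    (-1) ^ (u \ v).card * g (fun i => if i ∈ v then y i else if i ∈ u then x i else c i)

/-- The Vitali variation over `[a, b]` of `g` as a function of the coordinates in `u`, the other
coordinates being kept equal to those of `c`: the supremum over all product grids in `[a, b]` of the
sum over the cells of the absolute mixed differences. -/
def vitaliVariation {d : ℕ} (u : Finset (Fin d)) (g : (Fin d → ℝ) → ℝ) (c a b : Fin d → ℝ) : ℝ≥0∞ :=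
  ⨆ (N : ℕ) (p : Fin d → ℕ → ℝ) (_ : ∀ i, Monotone (p i)) (_ : ∀ i k, p i k ∈ Icc (a i) (b i)),
    ∑ k ∈ Fintype.piFinset (fun i => if i ∈ u then Finset.range N else {0}),
      ‖mixedDiff u g c (fun i => p i (k i)) (fun i => p i (k i + 1))‖ₑ

/-- The Hardy-Krause variation of `g` on `[a, b]`: the sum of the Vitali variations of `g` on all the
faces of positive dimension of `[a, b]` that contain the corner `b`. -/
def hkVariation {d : ℕ} (g : (Fin d → ℝ) → ℝ) (a b : Fin d → ℝ) : ℝ≥0∞ :=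
  ∑ u : Finset (Fin d) with u.Nonempty, vitaliVariation u g b a b

/-- Bounded Hardy-Krause variation on `ℝ^d`. -/
def HasBoundedHKVariation {d : ℕ} (g : (Fin d → ℝ) → ℝ) : Prop :=
  ∃ C : ℝ≥0, ∀ a b : Fin d → ℝ, a ≤ b → hkVariation g a b ≤ C

/-! ### Kernels -/

/-- `ψ` is a kernel. -/
structure IsKernel {d : ℕ} (ψ : (Fin d → ℝ) → ℝ) : Prop where
  measurable : Measurable ψ
  boundedVariation : HasBoundedHKVariation ψ
  support : ∀ x, x ∉ Icc (-1 : Fin d → ℝ) 1 → ψ x = 0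
  memLp : MemLp ψ 2 volume
  integral_pos : 0 < ∫ x, ψ x

/-- The norm `‖ψ‖` of `L²(ℝ^d)`. -/
def l2Norm {d : ℕ} (ψ : (Fin d → ℝ) → ℝ) : ℝ := √(∫ x, ψ x ^ 2)

/-- The set `I = (0, 1/2]^d` of bandwidths. -/
def bandwidths (d : ℕ) : Set (Fin d → ℝ) := {h | ∀ i, 0 < h i ∧ h i ≤ 1 / 2}

/-- The set `A_h = ∏ [h_i, 1 - h_i]` of centers. -/
def centers {d : ℕ} (h : Fin d → ℝ) : Set (Fin d → ℝ) := {t | ∀ i, h i ≤ t i ∧ t i ≤ 1 - h i}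

/-- The rescaled kernel `ψ_{t,h}`. -/
def scaledKernel {d : ℕ} (ψ : (Fin d → ℝ) → ℝ) (t h x : Fin d → ℝ) : ℝ :=
  ψ (fun i => (x i - t i) / h i)

/-- `Γ(r) = (2 log (e / r))^{1/2}`. -/
def penalty (r : ℝ) : ℝ := √(2 * Real.log (Real.exp 1 / r))

/-! ### White noise -/

/-- `W` is a `d`-dimensional Brownian sheet on `[0,1]^d`: a mean-zero Gaussian process with covariance
`∏ min (s_i, t_i)` and almost surely continuous paths. -/
structure IsBrownianSheet {d : ℕ} {Ω : Type*} [MeasurableSpace Ω] (W : (Fin d → ℝ) → Ω → ℝ)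
    (P : Measure Ω) : Prop where
  gaussian : IsGaussianProcess (fun t : Icc (0 : Fin d → ℝ) 1 => W t) P
  mean : ∀ t ∈ Icc (0 : Fin d → ℝ) 1, ∫ ω, W t ω ∂P = 0
  cov : ∀ s ∈ Icc (0 : Fin d → ℝ) 1, ∀ t ∈ Icc (0 : Fin d → ℝ) 1,
    cov[W s, W t; P] = ∏ i, min (s i) (t i)
  continuous : ∀ᵐ ω ∂P, ContinuousOn (fun t => W t ω) (Icc 0 1)

/-- The path `t ↦ Y(t)`, `t ∈ [0,1]^d`, of the observed process when the regression function is `f`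
and the scale parameter is `n`. -/
def observed {d : ℕ} {Ω : Type*} (n : ℝ) (f : (Fin d → ℝ) → ℝ) (W : (Fin d → ℝ) → Ω → ℝ) (ω : Ω)
    (t : Fin d → ℝ) : ℝ :=
  √n * (∫ s in Icc 0 t, f s) + W t ω

/-- The integral `∫_{[0,1]^d} g dw` of a function `g` with respect to a path `w`: the limit of the
Riemann-Stieltjes sums of `g` against the rectangular increments of `w` over the dyadic cells of
`[0,1]^d`. If `g` has bounded Hardy-Krause variation, the limit exists for every continuous `w`
(integration by parts); if `w` is the path of a Brownian sheet it equals the Wiener integral almost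
surely. -/
def pathIntegral {d : ℕ} (g w : (Fin d → ℝ) → ℝ) : ℝ :=
  limUnder atTop (fun m : ℕ => ∑ k : Fin d → Fin (2 ^ m),
    g (fun i => (k i : ℝ) / 2 ^ m) *
      mixedDiff Finset.univ w 0 (fun i => (k i : ℝ) / 2 ^ m) (fun i => ((k i : ℝ) + 1) / 2 ^ m))

/-- The kernel estimator of `f(t)` with kernel `ψ` and bandwidth `h`, computed from the data `y`. -/
def kernelEstimator {d : ℕ} (ψ : (Fin d → ℝ) → ℝ) (n : ℝ) (y : (Fin d → ℝ) → ℝ)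
    (h t : Fin d → ℝ) : ℝ :=
  1 / (√n * (∏ i, h i) * ∫ x, ψ x) * pathIntegral (scaledKernel ψ t h) y

/-- The two-sided bias condition for the class `F`: the kernel estimators with the kernels `ψl` and
`ψu` under-, respectively overestimate in the mean every member of `F`, at every center and for every
bandwidth. -/
def TwoSidedBias {d : ℕ} {Ω : Type*} [MeasurableSpace Ω] (P : Measure Ω) (W : (Fin d → ℝ) → Ω → ℝ)
    (n : ℝ) (F : Set ((Fin d → ℝ) → ℝ)) (ψl ψu : (Fin d → ℝ) → ℝ) : Prop :=
  ∀ g ∈ F, ∀ h ∈ bandwidths d, ∀ t ∈ centers h,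
    (∫ ω, kernelEstimator ψl n (observed n g W ω) h t ∂P) ≤ g t ∧
      g t ≤ ∫ ω, kernelEstimator ψu n (observed n g W ω) h t ∂P

/-! ### The multiscale statistic and the confidence band -/

/-- The multiscale statistic `T(ψ)` of the noise path `w`, with values in `[-∞, ∞]`. -/
def multiscaleStat {d : ℕ} (ψ w : (Fin d → ℝ) → ℝ) : EReal :=
  ⨆ h ∈ bandwidths d, ⨆ t ∈ centers h,
    ((pathIntegral (scaledKernel ψ t h) w / (√(∏ i, h i) * l2Norm ψ)
      - penalty (2 ^ d * ∏ i, h i) : ℝ) : EReal)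

/-- `κ_α`: the `(1 - α)`-th quantile of `T* = max (T(ψl), T(-ψu))`. -/
def critValue {d : ℕ} {Ω : Type*} [MeasurableSpace Ω] (P : Measure Ω) (W : (Fin d → ℝ) → Ω → ℝ)
    (ψl ψu : (Fin d → ℝ) → ℝ) (α : ℝ) : ℝ :=
  sInf {x : ℝ | ENNReal.ofReal (1 - α) ≤
    P {ω | max (multiscaleStat ψl (fun t => W t ω)) (multiscaleStat (-ψu) (fun t => W t ω))
      ≤ (x : EReal)}}

/-- Half-width of the interval around the kernel estimator with kernel `ψ` and bandwidth `h` when the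
critical value is `κ`. -/
def margin {d : ℕ} (ψ : (Fin d → ℝ) → ℝ) (n κ : ℝ) (h : Fin d → ℝ) : ℝ :=
  l2Norm ψ * (κ + penalty (2 ^ d * ∏ i, h i)) / ((∫ x, ψ x) * √(n * ∏ i, h i))

/-- The lower confidence limit at `t`, computed from the data `y`. -/
def lowerBand {d : ℕ} (ψl : (Fin d → ℝ) → ℝ) (n κ : ℝ) (y : (Fin d → ℝ) → ℝ)
    (t : Fin d → ℝ) : EReal :=
  ⨆ h ∈ {h | h ∈ bandwidths d ∧ t ∈ centers h},
    ((kernelEstimator ψl n y h t - margin ψl n κ h : ℝ) : EReal)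

/-- The upper confidence limit at `t`, computed from the data `y`. -/
def upperBand {d : ℕ} (ψu : (Fin d → ℝ) → ℝ) (n κ : ℝ) (y : (Fin d → ℝ) → ℝ)
    (t : Fin d → ℝ) : EReal :=
  ⨅ h ∈ {h | h ∈ bandwidths d ∧ t ∈ centers h},
    ((kernelEstimator ψu n y h t + margin ψu n κ h : ℝ) : EReal)

/-- The width at `t` of the level `1 - α` confidence band when the regression function is `f`. -/
def bandWidth {d : ℕ} {Ω : Type*} [MeasurableSpace Ω] (P : Measure Ω) (W : (Fin d → ℝ) → Ω → ℝ)
    (ψl ψu : (Fin d → ℝ) → ℝ) (α n : ℝ) (f : (Fin d → ℝ) → ℝ) (t : Fin d → ℝ) (ω : Ω) : EReal :=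
  upperBand ψu n (critValue P W ψl ψu α) (observed n f W ω) t -
    lowerBand ψl n (critValue P W ψl ψu α) (observed n f W ω) t

/-- The factor `1 + (|κ_α| + |T(-ψl)| + |T(ψu)|) / (log (e n))^{1/2}`. -/
def noiseFactor {d : ℕ} {Ω : Type*} [MeasurableSpace Ω] (P : Measure Ω) (W : (Fin d → ℝ) → Ω → ℝ)
    (ψl ψu : (Fin d → ℝ) → ℝ) (α n : ℝ) (ω : Ω) : EReal :=
  1 + (((|critValue P W ψl ψu α| : ℝ) : EReal)
      + ((multiscaleStat (-ψl) (fun t => W t ω)).abs : EReal)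
      + ((multiscaleStat ψu (fun t => W t ω)).abs : EReal))
    / ((√(Real.log (Real.exp 1 * n)) : ℝ) : EReal)

/-- The rate `ρ_n = (log (e n) / n)^{β / (2 β + d)}`. -/
def rate (d : ℕ) (β n : ℝ) : ℝ := (Real.log (Real.exp 1 * n) / n) ^ (β / (2 * β + d))

end

/-! The upper limit is an infimum and the lower limit a supremum over bandwidths, so any single
bandwidth bounds the width. For a cube of half-side `r` the estimator is a kernel average of `f`
plus a noise integral. Along almost every path the noise is bounded, by the very definition of the
multiscale statistics of `ψu` and `-ψl`, by the statistic plus the penalty, divided by the square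
root of `n * r ^ d`; the margin has the same form with the critical value. Hence the width is at
most a bias of order `r ^ β` plus a noise term, as in `upperBand_sub_lowerBand_le`.

The bias has order `r ^ β` because `f` is that close to a constant if `β ≤ 1`, and to an affine
function if `1 < β`. In the second case the class is that of convex functions, which contains both
`x i` and `-x i`; the bias condition therefore forces the kernels to reproduce coordinates exactly
(`TwoSidedBias.integral_scaledKernel_coordinate`), and the linear part drops out. The choice `r ^ (2
* β + d) = log (e n) / n` balances bias and noise. If this `r` exceeds `ε`, the bandwidth `ε` is
used instead, at the price of a constant depending on `ε`.

For the probability bound, the statistics and the critical value must be bounded in probability,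
uniformly over all Brownian sheets. This is the main work, and it is done by chaining. A box with
sides between `2 ^ (-j i - 1)` and `2 ^ (-j i)` is enclosed in grid boxes whose mesh is `16 ^ (-p)`
relative to its sides. With `s = ∑ j i`, the coarsest grid has about `2 ^ s` boxes, up to powers of
`s`; the penalty contributes a factor `2 ^ (-s)` to each Gaussian tail and the cross term with `x`
beats the powers of `s`. The link from level `p` to `p + 1` has variance of order `16 ^ (-p) * 2 ^
(-s)` and is allowed to be `x * 2 ^ (-p) * 2 ^ (-s / 2)`, so its tail is `exp (-c * x ^ 2 * 4 ^ p)`,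
which beats the number of pairs of boxes. The deterministic half is
`IsControlled.multiscaleStat_le`, the probabilistic half `exists_measure_not_isControlled_le`.

Since the integrals are pathwise limits, three analytic facts carry the chaining. Summation by parts
(`IsTame.abs_rsSum_le`) gives existence and continuity of the integral for continuous paths. Bounded
variation gives Lipschitz continuity in mean under displacement of coordinates
(`IsTame.lintegral_comp_sub_le`). Fatou's lemma carries the exponential moments of the Gaussian
Riemann sums over to the limit (`IsBrownianSheet.hasSubgaussianMGF`). -/

/-! ### Mixed differences and Riemann-Stieltjes sums. -/

/-- The mixed difference of a product of one-variable functions is the product of the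
differences. -/
theorem mixedDiff_prod {d : ℕ} (b : Fin d → ℝ → ℝ) (c x y : Fin d → ℝ) :
    mixedDiff Finset.univ (fun t => ∏ i, b i (t i)) c x y = ∏ i, (b i (y i) - b i (x i)) := by
  simp_rw [sub_eq_add_neg, Finset.prod_add, mixedDiff]
  refine Finset.sum_congr rfl fun v _ => ?_
  have h1 : (∏ i, b i (if i ∈ v then y i else if i ∈ Finset.univ then x i else c i))
      = (∏ i ∈ v, b i (y i)) * ∏ i ∈ Finset.univ \ v, b i (x i) := by
    rw [← Finset.prod_sdiff (Finset.subset_univ v), mul_comm]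
    congr 1
    · exact Finset.prod_congr rfl fun i hi => by simp [hi]
    · exact Finset.prod_congr rfl fun i hi => by
        have : i ∉ v := (Finset.mem_sdiff.1 hi).2
        simp [this]
  rw [h1, Finset.prod_neg]
  ring

theorem mixedDiff_univ {d : ℕ} (g : (Fin d → ℝ) → ℝ) (c x y : Fin d → ℝ) :
    mixedDiff Finset.univ g c x y = ∑ v : Finset (Fin d),
      (-1) ^ (Finset.univ \ v).card * g (fun i => if i ∈ v then y i else x i) := by
  simp [mixedDiff]

/-- Mixed differences over the cells of a grid add up to the mixed difference over the whole box. -/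
theorem sum_mixedDiff {d : ℕ} (w : (Fin d → ℝ) → ℝ) (c : Fin d → ℝ) (p : Fin d → ℕ → ℝ)
    {a b : Fin d → ℕ} (hab : a ≤ b) :
    ∑ k ∈ Fintype.piFinset (fun i => Finset.Ico (a i) (b i)),
      mixedDiff Finset.univ w c (fun i => p i (k i)) (fun i => p i (k i + 1))
      = mixedDiff Finset.univ w c (fun i => p i (a i)) (fun i => p i (b i)) := by
  set B := Fintype.piFinset (fun i : Fin d => Finset.range (b i + 1)) with hB
  -- On the grid `w` is a combination of indicators of nodes. The mixed difference thus becomes a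
  -- combination of products of one-variable differences, which telescope in each coordinate
  -- separately.
  have key : ∀ k l : Fin d → ℕ, k ≤ b → l ≤ b →
      mixedDiff Finset.univ w c (fun i => p i (k i)) (fun i => p i (l i))
        = ∑ n ∈ B, w (fun i => p i (n i)) *
            ∏ i, ((if l i = n i then (1 : ℝ) else 0) - if k i = n i then 1 else 0) := by
    intro k l hk hl
    have h1 : ∀ v : Finset (Fin d), w (fun i => if i ∈ v then p i (l i) else p i (k i))
        = ∑ n ∈ B, w (fun i => p i (n i)) *
          ∏ i, (if (if i ∈ v then (l i : ℝ) else k i) = n i then (1 : ℝ) else 0) := by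
      intro v
      set q : Fin d → ℕ := fun i => if i ∈ v then l i else k i with hq
      have hqB : q ∈ B := by
        simp only [hB, Fintype.mem_piFinset, Finset.mem_range, Nat.lt_succ_iff]
        intro i
        simp only [hq]
        split_ifs
        exacts [hl i, hk i]
      have hc : ∀ i, (if i ∈ v then (l i : ℝ) else k i) = (q i : ℝ) := fun i => by
        simp only [hq]; split_ifs <;> rfl
      have hc' : (fun i => if i ∈ v then p i (l i) else p i (k i)) = fun i => p i (q i) := by
        funext i; simp only [hq]; split_ifs <;> rfl
      rw [hc', Finset.sum_eq_single_of_mem q hqB]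
      · simp [hc]
      · intro n _ hn
        obtain ⟨i, hi⟩ := Function.ne_iff.1 hn
        rw [Finset.prod_eq_zero (Finset.mem_univ i), mul_zero]
        rw [hc, if_neg]
        exact fun h => hi (by exact_mod_cast h.symm)
    have h2 : ∀ n : Fin d → ℕ,
        ∏ i, ((if l i = n i then (1 : ℝ) else 0) - if k i = n i then 1 else 0)
        = ∑ v : Finset (Fin d), (-1) ^ (Finset.univ \ v).card *
          ∏ i, (if (if i ∈ v then (l i : ℝ) else k i) = n i then (1 : ℝ) else 0) := by
      intro n
      have := mixedDiff_prod (fun i s => if s = (n i : ℝ) then (1 : ℝ) else 0) c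
        (fun i => (k i : ℝ)) (fun i => (l i : ℝ))
      rw [mixedDiff_univ] at this
      simp only [Nat.cast_inj] at this
      rw [← this]
    rw [mixedDiff_univ]
    simp_rw [h1, h2, Finset.mul_sum]
    rw [Finset.sum_comm]
    exact Finset.sum_congr rfl fun _ _ => Finset.sum_congr rfl fun _ _ => by ring
  rw [key a b hab le_rfl]
  have h3 := Finset.sum_congr rfl (fun k hk =>
    have hk' := Fintype.mem_piFinset.1 hk
    key k (fun i => k i + 1) (fun i => (Finset.mem_Ico.1 (hk' i)).2.le)
      (fun i => (Finset.mem_Ico.1 (hk' i)).2) :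
    ∀ k ∈ Fintype.piFinset (fun i => Finset.Ico (a i) (b i)), _ = _)
  rw [h3, Finset.sum_comm]
  refine Finset.sum_congr rfl fun n _ => ?_
  rw [← Finset.mul_sum]
  congr 1
  rw [← Finset.prod_univ_sum (fun i => Finset.Ico (a i) (b i))
    (fun i k => ((if k + 1 = n i then (1 : ℝ) else 0) - if k = n i then 1 else 0))]
  refine Finset.prod_congr rfl fun i _ => ?_
  exact Finset.sum_Ico_sub (fun k => if k = n i then (1 : ℝ) else 0) (hab i)

/-- The dyadic Riemann-Stieltjes sums of `g` against `w`. -/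
noncomputable def rsSum {d : ℕ} (m : ℕ) (g w : (Fin d → ℝ) → ℝ) : ℝ :=
  ∑ k : Fin d → Fin (2 ^ m),
    g (fun i => (k i : ℝ) / 2 ^ m) *
      mixedDiff Finset.univ w 0 (fun i => (k i : ℝ) / 2 ^ m) (fun i => ((k i : ℝ) + 1) / 2 ^ m)

theorem pathIntegral_eq {d : ℕ} (g w : (Fin d → ℝ) → ℝ) :
    pathIntegral g w = limUnder atTop (fun m => rsSum m g w) := rfl

/-- Grid points of level `m`, indexed by a cell and a corner. -/
noncomputable def gridPt {d : ℕ} (m : ℕ) (a : (Fin d → Fin (2 ^ m)) × Finset (Fin d)) (i : Fin d) : ℝ :=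
  if i ∈ a.2 then ((a.1 i : ℝ) + 1) / 2 ^ m else (a.1 i : ℝ) / 2 ^ m

/-- Weights of the Riemann-Stieltjes sums. -/
noncomputable def gridWt {d : ℕ} (m : ℕ) (g : (Fin d → ℝ) → ℝ)
    (a : (Fin d → Fin (2 ^ m)) × Finset (Fin d)) : ℝ :=
  g (fun i => (a.1 i : ℝ) / 2 ^ m) * (-1) ^ (Finset.univ \ a.2).card

theorem rsSum_eq_sum {d : ℕ} (m : ℕ) (g w : (Fin d → ℝ) → ℝ) :
    rsSum m g w = ∑ a, gridWt m g a * w (gridPt m a) := by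
  rw [rsSum, Fintype.sum_prod_type]
  refine Finset.sum_congr rfl fun k _ => ?_
  rw [mixedDiff_univ, Finset.mul_sum]
  refine Finset.sum_congr rfl fun v _ => ?_
  simp only [gridWt, ← mul_assoc]
  rfl

theorem gridPt_mem {d : ℕ} (m : ℕ) (a : (Fin d → Fin (2 ^ m)) × Finset (Fin d)) :
    gridPt m a ∈ Icc (0 : Fin d → ℝ) 1 := by
  have h : ∀ i, ((a.1 i : ℕ) : ℝ) + 1 ≤ 2 ^ m := fun i => by exact_mod_cast (a.1 i).2
  have hp : (0 : ℝ) < 2 ^ m := by positivity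
  constructor <;> intro i <;> simp only [gridPt, Pi.zero_apply, Pi.one_apply]
  · split_ifs <;> positivity
  · split_ifs
    · rw [div_le_one hp]; exact h i
    · rw [div_le_one hp]; linarith [h i]

theorem rsSum_congr {d : ℕ} (m : ℕ) (g : (Fin d → ℝ) → ℝ) {w w' : (Fin d → ℝ) → ℝ}
    (h : EqOn w w' (Icc 0 1)) : rsSum m g w = rsSum m g w' := by
  simp only [rsSum_eq_sum]
  exact Finset.sum_congr rfl fun a _ => by rw [h (gridPt_mem m a)]

theorem rsSum_add {d : ℕ} (m : ℕ) (g w w' : (Fin d → ℝ) → ℝ) :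
    rsSum m g (fun t => w t + w' t) = rsSum m g w + rsSum m g w' := by
  simp only [rsSum_eq_sum, mul_add, Finset.sum_add_distrib]

theorem rsSum_const_mul {d : ℕ} (m : ℕ) (c : ℝ) (g w : (Fin d → ℝ) → ℝ) :
    rsSum m g (fun t => c * w t) = c * rsSum m g w := by
  simp only [rsSum_eq_sum, Finset.mul_sum]
  exact Finset.sum_congr rfl fun a _ => by ring

theorem rsSum_sub {d : ℕ} (m : ℕ) (g w w' : (Fin d → ℝ) → ℝ) :
    rsSum m g (fun t => w t - w' t) = rsSum m g w - rsSum m g w' := by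
  simp only [rsSum_eq_sum, mul_sub, Finset.sum_sub_distrib]

theorem rsSum_sub_left {d : ℕ} (m : ℕ) (g g' w : (Fin d → ℝ) → ℝ) :
    rsSum m (g - g') w = rsSum m g w - rsSum m g' w := by
  simp only [rsSum, Pi.sub_apply, sub_mul, Finset.sum_sub_distrib]

theorem rsSum_neg_left {d : ℕ} (m : ℕ) (g w : (Fin d → ℝ) → ℝ) :
    rsSum m (-g) w = - rsSum m g w := by
  simp only [rsSum, Pi.neg_apply, neg_mul, Finset.sum_neg_distrib]

/-- The left end point of the dyadic interval `(k / 2 ^ m, (k + 1) / 2 ^ m]` that contains `s`. -/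
noncomputable def dyadicLeft (m : ℕ) (s : ℝ) : ℝ := (⌈2 ^ m * s⌉ - 1 : ℝ) / 2 ^ m

theorem abs_dyadicLeft_sub_le (m : ℕ) (s : ℝ) : |dyadicLeft m s - s| ≤ (1 / 2) ^ m := by
  have hp : (0 : ℝ) < 2 ^ m := by positivity
  have h1 := Int.le_ceil (2 ^ m * s : ℝ)
  have h2 := Int.ceil_lt_add_one (2 ^ m * s : ℝ)
  have : dyadicLeft m s - s = (⌈2 ^ m * s⌉ - 1 - 2 ^ m * s : ℝ) / 2 ^ m := by
    rw [dyadicLeft]; field_simp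
  rw [this, abs_div, abs_of_pos hp, one_div, inv_pow, ← one_div, div_le_div_iff_of_pos_right hp,
    abs_le]
  constructor <;> linarith

theorem measurable_dyadicLeft (m : ℕ) : Measurable (dyadicLeft m) := by
  unfold dyadicLeft
  have : Measurable fun s : ℝ => ((⌈2 ^ m * s⌉ : ℤ) : ℝ) :=
    (measurable_from_top (f := fun z : ℤ => (z : ℝ))).comp
      (Int.measurable_ceil.comp (measurable_const.mul measurable_id))
  exact (this.sub measurable_const).div measurable_const

/-- The Riemann-Stieltjes sum against the distribution function of a point mass. -/
theorem rsSum_indicator {d : ℕ} (m : ℕ) (g : (Fin d → ℝ) → ℝ) {x : Fin d → ℝ}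
    (hx : ∀ i, x i ∈ Ioc (0 : ℝ) 1) :
    rsSum m g (fun t => ∏ i, if x i ≤ t i then (1 : ℝ) else 0) = g (fun i => dyadicLeft m (x i)) := by
  have hp : (0 : ℝ) < 2 ^ m := by positivity
  have hc1 : ∀ i, 1 ≤ ⌈2 ^ m * x i⌉ := fun i => Int.one_le_ceil_iff.2 (mul_pos hp (hx i).1)
  have hc2 : ∀ i, ⌈2 ^ m * x i⌉ ≤ 2 ^ m := fun i => Int.ceil_le.2 (by
    push_cast; nlinarith [(hx i).2])
  -- The unique cell, open on the left and closed on the right, that contains `x`; no other cell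
  -- sees the point mass.
  let κ : Fin d → Fin (2 ^ m) := fun i => ⟨(⌈2 ^ m * x i⌉ - 1).toNat, by
    have := hc1 i; have := hc2 i; zify; rw [Int.toNat_of_nonneg (by linarith)]; linarith⟩
  have hκ : ∀ i, ((κ i : ℕ) : ℝ) = ⌈2 ^ m * x i⌉ - 1 := fun i => by
    have h := Int.toNat_of_nonneg (a := ⌈2 ^ m * x i⌉ - 1) (by linarith [hc1 i])
    have h' : (((⌈2 ^ m * x i⌉ - 1).toNat : ℤ) : ℝ) = ((⌈2 ^ m * x i⌉ - 1 : ℤ) : ℝ) := by rw [h]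
    push_cast at h'
    exact h'
  rw [rsSum, Finset.sum_eq_single κ]
  · rw [mixedDiff_prod (fun i s => if x i ≤ s then (1 : ℝ) else 0)]
    have : ∀ i, ((if x i ≤ ((κ i : ℕ) + 1 : ℝ) / 2 ^ m then (1 : ℝ) else 0)
        - if x i ≤ ((κ i : ℕ) : ℝ) / 2 ^ m then 1 else 0) = 1 := by
      intro i
      rw [hκ, if_pos, if_neg, sub_zero]
      · rw [not_le, div_lt_iff₀ hp]
        linarith [Int.ceil_lt_add_one (2 ^ m * x i : ℝ)]
      · rw [le_div_iff₀ hp]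
        linarith [Int.le_ceil (2 ^ m * x i : ℝ)]
    simp only [this, Finset.prod_const_one, mul_one]
    congr 1
    funext i
    rw [dyadicLeft, hκ]
  · intro k _ hk
    obtain ⟨i, hi⟩ := Function.ne_iff.1 hk
    rw [mixedDiff_prod (fun i s => if x i ≤ s then (1 : ℝ) else 0),
      Finset.prod_eq_zero (Finset.mem_univ i), mul_zero]
    by_contra h
    apply hi
    have h1 : x i ≤ ((k i : ℕ) + 1 : ℝ) / 2 ^ m := by
      by_contra h1
      have h2 : ¬ x i ≤ ((k i : ℕ) : ℝ) / 2 ^ m := fun h2 => h1 (h2.trans (by gcongr; linarith))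
      simp [h1, h2] at h
    have h2 : ¬ x i ≤ ((k i : ℕ) : ℝ) / 2 ^ m := fun h2 => by simp [h1, h2] at h
    rw [le_div_iff₀ hp] at h1
    rw [not_le, div_lt_iff₀ hp] at h2
    have h3 : ⌈2 ^ m * x i⌉ = (k i : ℕ) + 1 := by
      rw [Int.ceil_eq_iff]
      push_cast
      constructor <;> linarith
    apply Fin.ext
    have := hκ i
    rw [h3] at this
    push_cast at this
    have h4 : ((κ i : ℕ) : ℝ) = (k i : ℕ) := by linarith
    exact_mod_cast h4.symm
  · simp


/-! ### Functions of bounded variation and summation by parts. -/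

/-- `g` is measurable, its Vitali variation over every box is at most `V`, and it vanishes where a
coordinate exceeds `1`. -/
structure IsTame {d : ℕ} (g : (Fin d → ℝ) → ℝ) (V : ℝ) : Prop where
  measurable : Measurable g
  variation : ∀ (N : ℕ) (p : Fin d → ℕ → ℝ), (∀ i, Monotone (p i)) →
    ∑ k ∈ Fintype.piFinset (fun _ : Fin d => Finset.range N),
      |mixedDiff Finset.univ g 0 (fun i => p i (k i)) (fun i => p i (k i + 1))| ≤ V
  vanish : ∀ x i, 1 < x i → g x = 0

theorem mixedDiff_univ_const {d : ℕ} (g : (Fin d → ℝ) → ℝ) (c c' x y : Fin d → ℝ) :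
    mixedDiff Finset.univ g c x y = mixedDiff Finset.univ g c' x y := by
  simp [mixedDiff_univ]

/-- Only the full-dimensional Vitali term is kept. The support condition makes up for the
lower-dimensional ones, since grids may be extended into the region where the kernel vanishes. -/
theorem IsKernel.exists_isTame {d : ℕ} (hd : 1 ≤ d) {ψ : (Fin d → ℝ) → ℝ} (h : IsKernel ψ) :
    ∃ V, IsTame ψ V := by
  obtain ⟨C, hC⟩ := h.boundedVariation
  refine ⟨C, h.measurable, fun N p hp => ?_, fun x i hx => h.support x fun hx' => ?_⟩
  · have hab : (fun i => p i 0) ≤ fun i => p i N := fun i => hp i (Nat.zero_le N)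
    have h1 : vitaliVariation Finset.univ ψ (fun i => p i N) (fun i => p i 0) (fun i => p i N) ≤ C := by
      refine le_trans ?_ (hC _ _ hab)
      unfold hkVariation
      refine Finset.single_le_sum (f := fun u => vitaliVariation u ψ (fun i => p i N)
        (fun i => p i 0) (fun i => p i N)) (fun _ _ => zero_le) ?_
      simp only [Finset.mem_filter, Finset.mem_univ, true_and]
      exact ⟨⟨0, hd⟩, Finset.mem_univ _⟩
    -- All nodes of an admissible grid must lie in the box, also those with index above `N`; hence
    -- the truncation at `N`.
    have h2 := le_trans (le_iSup₂_of_le N (fun i k => p i (min k N)) <|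
      le_iSup₂_of_le (f := fun _ _ => _) (fun i k l hkl => hp i (min_le_min_right N hkl))
        (fun i k => ⟨hp i (Nat.zero_le _), hp i (min_le_right _ _)⟩) le_rfl) h1
    simp only [Finset.mem_univ, if_true] at h2
    rw [← ENNReal.toReal_le_toReal (by simp [ENNReal.sum_eq_top]) (by simp),
      ENNReal.toReal_sum (by simp)] at h2
    simp only [toReal_enorm, Real.norm_eq_abs, ENNReal.coe_toReal] at h2
    refine le_trans (le_of_eq (Finset.sum_congr rfl fun k hk => ?_)) h2
    have hk' := Fintype.mem_piFinset.1 hk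
    rw [mixedDiff_univ_const ψ 0 (fun i => p i N)]
    have e1 : ∀ i, min (k i) N = k i := fun i => min_eq_left (Finset.mem_range.1 (hk' i)).le
    have e2 : ∀ i, min (k i + 1) N = k i + 1 := fun i => min_eq_left (Finset.mem_range.1 (hk' i))
    simp only [e1, e2]
  · exact absurd (hx'.2 i) (not_le.2 hx)

theorem mixedDiff_neg {d : ℕ} (g : (Fin d → ℝ) → ℝ) (c x y : Fin d → ℝ) :
    mixedDiff Finset.univ (-g) c x y = - mixedDiff Finset.univ g c x y := by
  simp [mixedDiff_univ]

theorem mixedDiff_sub {d : ℕ} (g g' : (Fin d → ℝ) → ℝ) (c x y : Fin d → ℝ) :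
    mixedDiff Finset.univ (g - g') c x y
      = mixedDiff Finset.univ g c x y - mixedDiff Finset.univ g' c x y := by
  simp [mixedDiff_univ, mul_sub]

namespace IsTame

variable {d : ℕ} {g g' : (Fin d → ℝ) → ℝ} {V V' : ℝ}

theorem neg (h : IsTame g V) : IsTame (-g) V where
  measurable := h.measurable.neg
  variation N p hp := by simpa only [mixedDiff_neg, abs_neg] using h.variation N p hp
  vanish x i hx := by simp [h.vanish x i hx]

theorem sub (h : IsTame g V) (h' : IsTame g' V') : IsTame (g - g') (V + V') where
  measurable := h.measurable.sub h'.measurable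
  variation N p hp := by
    refine le_trans ?_ (add_le_add (h.variation N p hp) (h'.variation N p hp))
    rw [← Finset.sum_add_distrib]
    exact Finset.sum_le_sum fun k _ => by rw [mixedDiff_sub]; exact abs_sub _ _
  vanish x i hx := by simp [h.vanish x i hx, h'.vanish x i hx]

theorem scaled (h : IsTame g V) {t s : Fin d → ℝ} (hs : ∀ i, 0 < s i)
    (hts : ∀ i, t i + s i ≤ 1) : IsTame (scaledKernel g t s) V where
  measurable := h.measurable.comp (measurable_pi_lambda _ fun i =>
    ((measurable_pi_apply i).sub_const _).div_const _)
  variation N p hp := by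
    have := h.variation N (fun i k => (p i k - t i) / s i) (fun i k l hkl => by
      have := hp i hkl
      have := hs i
      dsimp only
      gcongr)
    refine le_trans (le_of_eq (Finset.sum_congr rfl fun k _ => ?_)) this
    simp only [mixedDiff_univ, scaledKernel]
    congr 1
    refine Finset.sum_congr rfl fun v _ => ?_
    congr 2
    funext i
    split_ifs <;> rfl
  vanish x i hx := h.vanish _ i (by
    rw [lt_div_iff₀ (hs i)]
    linarith [hts i])

/-- Every corner except the lowest has a coordinate beyond `1` and contributes nothing. Point values
thus become mixed differences, which the variation controls. -/
theorem mixedDiff_of_one_lt (h : IsTame g V) {c x y : Fin d → ℝ} (hy : ∀ i, 1 < y i) :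
    mixedDiff Finset.univ g c x y = (-1) ^ d * g x := by
  rw [mixedDiff_univ, Finset.sum_eq_single ∅]
  · simp
  · intro v _ hv
    obtain ⟨i, hi⟩ := Finset.nonempty_iff_ne_empty.2 hv
    rw [h.vanish _ i (by simpa [hi] using hy i), mul_zero]
  · simp

theorem nonneg (h : IsTame g V) : 0 ≤ V :=
  le_trans (Finset.sum_nonneg fun _ _ => abs_nonneg _) (h.variation 0 0 fun _ => monotone_const)

theorem abs_apply_le (h : IsTame g V) (x : Fin d → ℝ) : |g x| ≤ V := by
  have h1 := h.variation 1 (fun i k => if k = 0 then x i else max (x i) 2) (fun i k l hkl => by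
    dsimp only
    split_ifs with h1 h2 h2
    · rfl
    · exact le_max_left _ _
    · omega
    · rfl)
  have h2 := Finset.single_le_sum (f := fun k : Fin d → ℕ => |mixedDiff Finset.univ g 0
      (fun i => if k i = 0 then x i else max (x i) 2)
      (fun i => if k i + 1 = 0 then x i else max (x i) 2)|) (fun _ _ => abs_nonneg _)
      (show (fun _ => 0 : Fin d → ℕ) ∈ Fintype.piFinset (fun _ : Fin d => Finset.range 1) by
        simp)
  refine le_trans ?_ (h2.trans h1)
  rw [h.mixedDiff_of_one_lt (fun i => by simp)]
  simp [abs_mul]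

/-- Stretching one cell beyond `1` in every coordinate other than `i` collapses the mixed
differences to increments along the `i`-th axis, up to sign. -/
theorem eVariationOn_slice_le (h : IsTame g V) (i : Fin d) (c : Fin d → ℝ) :
    eVariationOn (fun s => g (Function.update c i s)) univ ≤ ENNReal.ofReal V := by
  refine iSup_le fun ⟨N, u, hu, _⟩ => ?_
  dsimp only
  rcases Nat.eq_zero_or_pos N with rfl | hN
  · simp
  let p : Fin d → ℕ → ℝ := fun j k => if j = i then u k else if k = 0 then c j else max (c j) 2
  have hp : ∀ j, Monotone (p j) := by
    intro j k l hkl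
    simp only [p]
    split_ifs with h1 h2 h3 h3
    · exact hu hkl
    · rfl
    · exact le_max_left _ _
    · omega
    · rfl
  let e : ℕ → Fin d → ℕ := fun k j => if j = i then k else 0
  have hcell : ∀ k, |mixedDiff Finset.univ g 0 (fun j => p j (e k j)) (fun j => p j (e k j + 1))|
      = |g (Function.update c i (u (k + 1))) - g (Function.update c i (u k))| := by
    intro k
    have hx : (fun j => p j (e k j)) = Function.update c i (u k) := by
      funext j
      by_cases hj : j = i
      · subst hj; simp [p, e]
      · simp [p, e, hj]
    have hy : ∀ j, p j (e k j + 1) = if j = i then u (k + 1) else max (c j) 2 := by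
      intro j
      by_cases hj : j = i <;> simp [p, e, hj]
    rw [mixedDiff_univ, ← Finset.sum_subset (Finset.subset_univ {∅, {i}})]
    · rw [Finset.sum_pair (by simp)]
      have h1 : (fun j => if j ∈ (∅ : Finset (Fin d)) then p j (e k j + 1) else p j (e k j))
          = Function.update c i (u k) := by rw [← hx]; simp
      have h2 : (fun j => if j ∈ ({i} : Finset (Fin d)) then p j (e k j + 1) else p j (e k j))
          = Function.update c i (u (k + 1)) := by
        funext j
        by_cases hj : j = i
        · subst hj; simp [hy]
        · have := congrFun hx j
          simp only [Finset.mem_singleton, hj, if_false, this]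
          simp [hj]
      rw [h1, h2]
      have hcard : (Finset.univ \ (∅ : Finset (Fin d))).card
          = (Finset.univ \ ({i} : Finset (Fin d))).card + 1 := by
        rw [Finset.card_sdiff_of_subset (Finset.subset_univ _), Finset.card_sdiff_of_subset (Finset.subset_univ _)]
        have : 0 < d := i.pos
        simp only [Finset.card_univ, Fintype.card_fin, Finset.card_empty, Finset.card_singleton]
        omega
      rw [hcard, pow_succ]
      have : ∀ a b e : ℝ, e * -1 * a + e * b = e * (b - a) := fun a b e => by ring
      rw [this, abs_mul]
      simp
    · intro v _ hv
      have : ∃ j ∈ v, j ≠ i := by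
        by_contra hcon
        push Not at hcon
        apply hv
        simp only [Finset.mem_insert, Finset.mem_singleton]
        exact Finset.subset_singleton_iff.1 fun j hj => by simp [hcon j hj]
      obtain ⟨j, hj, hji⟩ := this
      rw [h.vanish _ j (by simp [hj, hy, hji]), mul_zero]
  have h1 := h.variation N p hp
  have he : Set.InjOn e (Finset.range N) := fun k _ l _ hkl => by
    have := congrFun hkl i
    simpa [e] using this
  have h2 : ∑ k ∈ Finset.range N,
      |mixedDiff Finset.univ g 0 (fun j => p j (e k j)) (fun j => p j (e k j + 1))| ≤ V := by
    refine le_trans ?_ h1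
    rw [← Finset.sum_image (f := fun n : Fin d → ℕ => |mixedDiff Finset.univ g 0
      (fun j => p j (n j)) (fun j => p j (n j + 1))|) he]
    refine Finset.sum_le_sum_of_subset_of_nonneg ?_ fun _ _ _ => abs_nonneg _
    intro n hn
    obtain ⟨k, hk, rfl⟩ := Finset.mem_image.1 hn
    simp only [Fintype.mem_piFinset, Finset.mem_range, e]
    intro j
    split_ifs
    exacts [Finset.mem_range.1 hk, hN]
  simp only [hcell] at h2
  simp only [edist_dist, Real.dist_eq]
  rw [← ENNReal.ofReal_sum_of_nonneg fun _ _ => abs_nonneg _]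
  exact ENNReal.ofReal_le_ofReal h2

end IsTame

theorem abs_mixedDiff_le {d : ℕ} {w : (Fin d → ℝ) → ℝ} {C : ℝ}
    (hw : ∀ t ∈ Icc (0 : Fin d → ℝ) 1, |w t| ≤ C) {c x y : Fin d → ℝ}
    (hx : x ∈ Icc (0 : Fin d → ℝ) 1) (hy : y ∈ Icc (0 : Fin d → ℝ) 1) :
    |mixedDiff Finset.univ w c x y| ≤ 2 ^ d * C := by
  rw [mixedDiff_univ]
  refine (Finset.abs_sum_le_sum_abs _ _).trans ?_
  have : ∀ v ∈ (Finset.univ : Finset (Finset (Fin d))),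
      |(-1) ^ (Finset.univ \ v).card * w (fun i => if i ∈ v then y i else x i)| ≤ C := by
    intro v _
    rw [abs_mul, abs_pow, abs_neg, abs_one, one_pow, one_mul]
    refine hw _ ⟨fun i => ?_, fun i => ?_⟩ <;> dsimp only <;> split_ifs
    exacts [hy.1 i, hx.1 i, hy.2 i, hx.2 i]
  refine (Finset.sum_le_card_nsmul _ _ _ this).trans ?_
  simp

theorem sum_fin_eq_sum_piFinset {d N : ℕ} (F : (Fin d → ℕ) → ℝ) :
    ∑ k : Fin d → Fin N, F (fun i => k i)
      = ∑ k ∈ Fintype.piFinset (fun _ : Fin d => Finset.range N), F k := by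
  refine Finset.sum_bij (fun k _ i => (k i : ℕ)) ?_ ?_ ?_ ?_
  · intro k _; simp
  · intro k _ l _ h
    funext i
    exact Fin.ext (congrFun h i)
  · intro k hk
    have hk' := Fintype.mem_piFinset.1 hk
    exact ⟨fun i => ⟨k i, Finset.mem_range.1 (hk' i)⟩, Finset.mem_univ _, rfl⟩
  · intro k _; rfl

/-- Summation by parts: the Riemann-Stieltjes sums are bounded by the variation of `g` and the
size of `w`. -/
theorem IsTame.abs_rsSum_le {d : ℕ} {g : (Fin d → ℝ) → ℝ} {V : ℝ} (h : IsTame g V) (m : ℕ)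
    {w : (Fin d → ℝ) → ℝ} {C : ℝ} (hw : ∀ t ∈ Icc (0 : Fin d → ℝ) 1, |w t| ≤ C) :
    |rsSum m g w| ≤ V * (2 ^ d * C) := by
  set N := 2 ^ m with hN
  have hNpos : (0 : ℝ) < 2 ^ m := by positivity
  have hC : 0 ≤ C := (abs_nonneg _).trans (hw 0 ⟨le_rfl, fun _ => zero_le_one⟩)
  let q : Fin d → ℕ → ℝ := fun _ k => (k : ℝ) / 2 ^ m
  -- Replacing the last node by `2`, where `g` vanishes, makes the value of `g` at a node equal, up
  -- to sign, to the sum of its mixed differences over all cells above that node.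
  let p : Fin d → ℕ → ℝ := fun _ k => if k < N then (k : ℝ) / 2 ^ m else 2
  have hp : ∀ i, Monotone (p i) := by
    intro i k l hkl
    simp only [p]
    split_ifs with h1 h2 h2
    · gcongr
    · have : (k : ℝ) / 2 ^ m ≤ 1 := by
        rw [div_le_one hNpos]; exact_mod_cast h1.le
      linarith
    · omega
    · rfl
  let D : (Fin d → ℕ) → ℝ := fun l =>
    mixedDiff Finset.univ g 0 (fun i => p i (l i)) (fun i => p i (l i + 1))
  let E : (Fin d → ℕ) → ℝ := fun l =>
    mixedDiff Finset.univ w 0 (fun i => q i (l i)) (fun i => q i (l i + 1))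
  set R := Fintype.piFinset (fun _ : Fin d => Finset.range N)
  have hg : ∀ k ∈ R, g (fun i => q i (k i))
      = (-1) ^ d * ∑ l ∈ Fintype.piFinset (fun i => Finset.Ico (k i) N), D l := by
    intro k hk
    have hk' : ∀ i, k i < N := fun i => Finset.mem_range.1 (Fintype.mem_piFinset.1 hk i)
    rw [sum_mixedDiff g 0 p (a := k) (b := fun _ => N) (fun i => (hk' i).le),
      h.mixedDiff_of_one_lt (fun i => by simp [p]), ← mul_assoc, ← mul_pow]
    simp only [mul_neg, mul_one, neg_neg, one_pow, one_mul]
    congr 1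
    funext i
    simp [p, q, hk' i]
  have h1 : rsSum m g w = ∑ k ∈ R, g (fun i => q i (k i)) * E k := by
    rw [← sum_fin_eq_sum_piFinset (fun k => g (fun i => q i (k i)) * E k), rsSum]
    simp [E, q]
    rfl
  -- Abel summation: after the exchange of sums the inner sum telescopes to a single mixed
  -- difference of `w` over a box with lower corner `0`.
  have h2 : rsSum m g w = (-1) ^ d * ∑ l ∈ R, D l *
      ∑ k ∈ Fintype.piFinset (fun i => Finset.Ico 0 (l i + 1)), E k := by
    rw [h1, Finset.sum_congr rfl fun k hk => by rw [hg k hk]]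
    simp_rw [Finset.mul_sum, Finset.sum_mul]
    rw [Finset.sum_comm' (t' := R) (s' := fun l => Fintype.piFinset (fun i => Finset.Ico 0 (l i + 1)))]
    · exact Finset.sum_congr rfl fun _ _ => Finset.sum_congr rfl fun _ _ => by ring
    · intro k l
      simp only [R, Fintype.mem_piFinset, Finset.mem_range, Finset.mem_Ico]
      constructor
      · rintro ⟨a, b⟩
        exact ⟨fun i => ⟨Nat.zero_le _, Nat.lt_succ_of_le (b i).1⟩, fun i => (b i).2⟩
      · rintro ⟨a, b⟩
        exact ⟨fun i => lt_of_le_of_lt (Nat.le_of_lt_succ (a i).2) (b i),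
          fun i => ⟨Nat.le_of_lt_succ (a i).2, b i⟩⟩
  have h3 : ∀ l ∈ R, |∑ k ∈ Fintype.piFinset (fun i => Finset.Ico 0 (l i + 1)), E k| ≤ 2 ^ d * C := by
    intro l hl
    rw [sum_mixedDiff w 0 q (a := fun _ => 0) (b := fun i => l i + 1) (fun i => Nat.zero_le _)]
    refine abs_mixedDiff_le hw ?_ ?_
    · simp only [q, Nat.cast_zero, zero_div]
      exact ⟨fun _ => le_rfl, fun _ => zero_le_one⟩
    · refine ⟨fun i => ?_, fun i => ?_⟩
      · simp only [q, Pi.zero_apply]; positivity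
      · have := Finset.mem_range.1 (Fintype.mem_piFinset.1 hl i)
        simp only [q, Pi.one_apply]
        rw [div_le_one hNpos]
        exact_mod_cast this
  rw [h2, abs_mul, abs_pow, abs_neg, abs_one, one_pow, one_mul]
  calc |∑ l ∈ R, D l * ∑ k ∈ Fintype.piFinset (fun i => Finset.Ico 0 (l i + 1)), E k|
      ≤ ∑ l ∈ R, |D l| * (2 ^ d * C) := by
        refine (Finset.abs_sum_le_sum_abs _ _).trans (Finset.sum_le_sum fun l hl => ?_)
        rw [abs_mul]
        exact mul_le_mul_of_nonneg_left (h3 l hl) (abs_nonneg _)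
    _ = (∑ l ∈ R, |D l|) * (2 ^ d * C) := by rw [Finset.sum_mul]
    _ ≤ V * (2 ^ d * C) := mul_le_mul_of_nonneg_right (h.variation N p hp) (by positivity)


/-! ### Mean continuity under displacement, and convergence of dyadic sums for bounded densities. -/

/-- With `v` the variation of `G` up to `s`, the integrand is at most `v (s + δ) - v (s - δ)`.
Integrating and shifting leaves only integrals of `v` over the two end intervals of length `2 * δ`.
-/
theorem lintegral_enorm_comp_sub_le {G : ℝ → ℝ} {V : ℝ} (hV0 : 0 ≤ V)
    (hV : eVariationOn G univ ≤ ENNReal.ofReal V) {σ : ℝ → ℝ} {δ A B : ℝ} (hδ : 0 ≤ δ)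
    (hAB : A ≤ B) (hσ : ∀ s ∈ Icc A B, |σ s - s| ≤ δ) :
    ∫⁻ s in Icc A B, ‖G (σ s) - G s‖ₑ ≤ ENNReal.ofReal (2 * δ * V) := by
  set v : ℝ → ℝ := fun s => (eVariationOn G (Iic s)).toReal with hv
  have hfin : ∀ s, eVariationOn G (Iic s) ≠ ⊤ := fun s =>
    ne_top_of_le_ne_top ENNReal.ofReal_ne_top ((eVariationOn.mono G (subset_univ _)).trans hV)
  have hmono : Monotone v := fun x y hxy =>
    ENNReal.toReal_mono (hfin y) (eVariationOn.mono G (Iic_subset_Iic.2 hxy))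
  have hv0 : ∀ s, 0 ≤ v s := fun s => ENNReal.toReal_nonneg
  have hvV : ∀ s, v s ≤ V := fun s => by
    rw [← ENNReal.toReal_ofReal hV0]
    exact ENNReal.toReal_mono ENNReal.ofReal_ne_top ((eVariationOn.mono G (subset_univ _)).trans hV)
  have hinc : ∀ x y, x ≤ y → |G y - G x| ≤ v y - v x := by
    intro x y hxy
    have h1 : eVariationOn G (Iic x) + edist (G y) (G x) ≤ eVariationOn G (Iic y) := by
      refine le_trans ?_ ((eVariationOn.add_le_union G (s := Iic x) (t := Icc x y)
        fun a ha b hb => le_trans ha hb.1).trans (eVariationOn.mono G ?_))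
      · gcongr
        exact eVariationOn.edist_le G (right_mem_Icc.2 hxy) (left_mem_Icc.2 hxy)
      · exact union_subset (Iic_subset_Iic.2 hxy) fun b hb => hb.2
    have h2 := ENNReal.toReal_mono (hfin y) h1
    rw [ENNReal.toReal_add (hfin x) (edist_ne_top _ _), edist_dist,
      ENNReal.toReal_ofReal dist_nonneg, Real.dist_eq] at h2
    linarith
  have hpt : ∀ s ∈ Icc A B, |G (σ s) - G s| ≤ v (s + δ) - v (s - δ) := by
    intro s hs
    have h1 := abs_le.1 (hσ s hs)
    rcases le_total s (σ s) with h | h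
    · have := hinc s (σ s) h
      linarith [hmono (show s - δ ≤ s by linarith), hmono (show σ s ≤ s + δ by linarith)]
    · have := hinc (σ s) s h
      rw [abs_sub_comm]
      linarith [hmono (show s - δ ≤ σ s by linarith), hmono (show s ≤ s + δ by linarith)]
  have hint : ∀ a b : ℝ, IntervalIntegrable v volume a b := fun a b =>
    (hmono.monotoneOn _).intervalIntegrable
  have hint1 : IntervalIntegrable (fun s => v (s + δ)) volume A B :=
    ((hmono.comp fun _ _ h => add_le_add_left h δ).monotoneOn _).intervalIntegrable
  have hint2 : IntervalIntegrable (fun s => v (s - δ)) volume A B :=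
    ((hmono.comp fun _ _ h => sub_le_sub_right h δ).monotoneOn _).intervalIntegrable
  calc ∫⁻ s in Icc A B, ‖G (σ s) - G s‖ₑ
      ≤ ∫⁻ s in Icc A B, ENNReal.ofReal (v (s + δ) - v (s - δ)) := by
        refine setLIntegral_mono' measurableSet_Icc fun s hs => ?_
        rw [← ofReal_norm, Real.norm_eq_abs]
        exact ENNReal.ofReal_le_ofReal (hpt s hs)
    _ = ENNReal.ofReal (∫ s in Icc A B, (v (s + δ) - v (s - δ))) := by
        rw [ofReal_integral_eq_lintegral_ofReal]
        · have := hint1.sub hint2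
          rw [intervalIntegrable_iff_integrableOn_Icc_of_le hAB] at this
          exact this
        · refine Eventually.of_forall fun s => ?_
          simpa using hmono (show s - δ ≤ s + δ by linarith)
    _ ≤ ENNReal.ofReal (2 * δ * V) := by
        refine ENNReal.ofReal_le_ofReal ?_
        rw [integral_Icc_eq_integral_Ioc, ← intervalIntegral.integral_of_le hAB,
          intervalIntegral.integral_sub hint1 hint2, intervalIntegral.integral_comp_add_right,
          intervalIntegral.integral_comp_sub_right]
        have h1 := intervalIntegral.integral_add_adjacent_intervals
          (hint (A - δ) (A + δ)) (hint (A + δ) (B + δ))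
        have h2 := intervalIntegral.integral_add_adjacent_intervals
          (hint (A - δ) (B - δ)) (hint (B - δ) (B + δ))
        have h3 : ∫ s in (B - δ)..(B + δ), v s ≤ ∫ s in (B - δ)..(B + δ), V :=
          intervalIntegral.integral_mono_on (by linarith) (hint _ _) (by simp) fun s _ => hvV s
        have h4 : 0 ≤ ∫ s in (A - δ)..(A + δ), v s :=
          intervalIntegral.integral_nonneg (by linarith) fun s _ => hv0 s
        have h5 : ∫ s in (B - δ)..(B + δ), V = 2 * δ * V := by
          rw [intervalIntegral.integral_const, smul_eq_mul]; ring
        linarith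

theorem volume_restrict_Icc_pi {d : ℕ} (A B : ℝ) :
    (volume : Measure (Fin d → ℝ)).restrict (Icc (fun _ => A) (fun _ => B))
      = Measure.pi (fun _ => volume.restrict (Icc A B)) := by
  rw [← Set.pi_univ_Icc, volume_pi, Measure.restrict_pi_pi]

/-- Displacing the coordinates by at most `δ` changes a function of bounded variation by `O(δ)` in
mean. -/
theorem IsTame.lintegral_comp_sub_le {d : ℕ} {g : (Fin d → ℝ) → ℝ} {V : ℝ} (h : IsTame g V)
    {A B : ℝ} (hAB : A < B) {σ : Fin d → ℝ → ℝ} (hσm : ∀ i, Measurable (σ i)) {δ : ℝ} (hδ : 0 ≤ δ)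
    (hσ : ∀ i, ∀ s ∈ Icc A B, |σ i s - s| ≤ δ) :
    ∫⁻ x in Icc (fun _ => A) (fun _ => B), ‖g (fun i => σ i (x i)) - g x‖ₑ
      ≤ ENNReal.ofReal (d * ((B - A) ^ d * (2 * δ * V / (B - A)))) := by
  have hV0 := h.nonneg
  have hBA : 0 < B - A := sub_pos.2 hAB
  rw [volume_restrict_Icc_pi]
  set μ : Fin d → Measure ℝ := fun _ => volume.restrict (Icc A B) with hμ
  set C := (B - A) ^ d * (2 * δ * V / (B - A)) with hC
  let X : Finset (Fin d) → (Fin d → ℝ) → Fin d → ℝ := fun s x i => if i ∈ s then σ i (x i) else x i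
  have hX : ∀ s, Measurable (X s) := fun s => measurable_pi_lambda _ fun i => by
    by_cases hi : i ∈ s
    · simpa [X, hi, Function.comp_def] using (hσm i).comp (measurable_pi_apply i)
    · simpa [X, hi] using measurable_pi_apply i
  -- One coordinate is displaced at a time. Integrating over that coordinate first, with the others
  -- frozen, reduces to the one-variable estimate on a section.
  have hstep : ∀ (s : Finset (Fin d)) (a : Fin d), a ∉ s →
      ∫⁻ x, ‖g (X (insert a s) x) - g (X s x)‖ₑ ∂(Measure.pi μ) ≤ ENNReal.ofReal C := by
    intro s a ha
    have hm : Measurable fun x => ‖g (X (insert a s) x) - g (X s x)‖ₑ :=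
      ((h.measurable.comp (hX _)).sub (h.measurable.comp (hX _))).enorm
    refine le_trans (lintegral_le_of_lmarginal_le (μ := μ) {a} hm
      (g := fun _ => ENNReal.ofReal (2 * δ * V / (B - A))) measurable_const ?_) ?_
    · rw [lmarginal_singleton, lmarginal_singleton]
      intro x
      have h1 := lintegral_enorm_comp_sub_le hV0 (h.eVariationOn_slice_le a (X s x)) hδ hAB.le (hσ a)
      dsimp only
      rw [lintegral_const, Measure.restrict_apply_univ, Real.volume_Icc, ← ENNReal.ofReal_mul
        (by positivity), div_mul_cancel₀ _ hBA.ne']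
      refine le_trans (le_of_eq (lintegral_congr fun y => ?_)) h1
      have e1 : X (insert a s) (Function.update x a y) = Function.update (X s x) a (σ a y) := by
        funext i
        by_cases hi : i = a
        · subst hi; simp [X]
        · simp [X, hi]
      have e2 : X s (Function.update x a y) = Function.update (X s x) a y := by
        funext i
        by_cases hi : i = a
        · subst hi; simp [X, ha]
        · simp [X, hi]
      rw [e1, e2]
    · rw [lintegral_const, Measure.pi_univ]
      simp only [hμ, Measure.restrict_apply_univ, Real.volume_Icc, Finset.prod_const,
        Finset.card_univ, Fintype.card_fin]
      rw [← ENNReal.ofReal_pow hBA.le, ← ENNReal.ofReal_mul (by positivity), hC, mul_comm]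
  have hall : ∀ s : Finset (Fin d),
      ∫⁻ x, ‖g (X s x) - g x‖ₑ ∂(Measure.pi μ) ≤ s.card * ENNReal.ofReal C := by
    intro s
    induction s using Finset.induction_on with
    | empty => simp [X]
    | insert a s ha ih =>
      calc ∫⁻ x, ‖g (X (insert a s) x) - g x‖ₑ ∂(Measure.pi μ)
          ≤ ∫⁻ x, (‖g (X (insert a s) x) - g (X s x)‖ₑ + ‖g (X s x) - g x‖ₑ) ∂(Measure.pi μ) := by
            refine lintegral_mono fun x => ?_
            rw [← sub_add_sub_cancel (g (X (insert a s) x)) (g (X s x)) (g x)]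
            exact enorm_add_le _ _
        _ = _ := lintegral_add_left
            ((h.measurable.comp (hX _)).sub (h.measurable.comp (hX _))).enorm _
        _ ≤ _ := by
            rw [Finset.card_insert_of_notMem ha, Nat.cast_add, Nat.cast_one, add_mul, one_mul,
              add_comm]
            exact add_le_add ih (hstep s a ha)
  have := hall Finset.univ
  simp only [X, Finset.mem_univ, if_true, Finset.card_univ, Fintype.card_fin] at this
  rwa [ENNReal.ofReal_mul (by positivity), ENNReal.ofReal_natCast]

theorem IsTame.lintegral_dyadic_sub_le {d : ℕ} {g : (Fin d → ℝ) → ℝ} {V : ℝ} (h : IsTame g V)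
    (m : ℕ) :
    ∫⁻ x in Icc (0 : Fin d → ℝ) 1, ‖g (fun i => dyadicLeft m (x i)) - g x‖ₑ
      ≤ ENNReal.ofReal (d * (2 * (1 / 2) ^ m * V)) := by
  have := h.lintegral_comp_sub_le (A := 0) (B := 1) one_pos
    (σ := fun _ => dyadicLeft m) (fun _ => measurable_dyadicLeft m) (δ := (1 / 2) ^ m)
    (by positivity) fun _ s _ => abs_dyadicLeft_sub_le m s
  simp only [sub_zero, one_pow, one_mul, div_one] at this
  exact this

theorem measurable_comp_dyadicLeft {d : ℕ} {g : (Fin d → ℝ) → ℝ} (hg : Measurable g) (m : ℕ) :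
    Measurable fun x : Fin d → ℝ => g (fun i => dyadicLeft m (x i)) :=
  hg.comp (measurable_pi_lambda _ fun i => (measurable_dyadicLeft m).comp (measurable_pi_apply i))

theorem volume_unitCube {d : ℕ} : volume (Icc (0 : Fin d → ℝ) 1) = 1 := by
  rw [Real.volume_Icc_pi]; simp

instance isProbabilityMeasure_unitCube {d : ℕ} :
    IsProbabilityMeasure ((volume : Measure (Fin d → ℝ)).restrict (Icc 0 1)) :=
  ⟨by rw [Measure.restrict_apply_univ, volume_unitCube]⟩

/-- Integrals of a bounded function against the dyadic discretizations of `g` converge. -/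
theorem IsTame.tendsto_integral_dyadic {d : ℕ} {g : (Fin d → ℝ) → ℝ} {V : ℝ} (h : IsTame g V)
    {F : ℕ → (Fin d → ℝ) → ℝ} {F' : (Fin d → ℝ) → ℝ} {C : ℝ}
    (hF : ∀ m, AEStronglyMeasurable (F m) (volume.restrict (Icc 0 1)))
    (hF' : Integrable F' (volume.restrict (Icc 0 1)))
    (hb : ∀ m, ∀ x ∈ Icc (0 : Fin d → ℝ) 1,
      |F m x - F' x| ≤ C * |g (fun i => dyadicLeft m (x i)) - g x|) :
    Tendsto (fun m => ∫ x in Icc 0 1, F m x) atTop (nhds (∫ x in Icc 0 1, F' x)) := by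
  have hlim : Tendsto (fun m : ℕ => ENNReal.ofReal C * ENNReal.ofReal (d * (2 * (1 / 2) ^ m * V)))
      atTop (nhds 0) := by
    have h1 : Tendsto (fun m : ℕ => (d : ℝ) * (2 * (1 / 2 : ℝ) ^ m * V)) atTop (nhds 0) := by
      have := (tendsto_pow_atTop_nhds_zero_of_lt_one (r := (1 / 2 : ℝ)) (by norm_num)
        (by norm_num))
      have h2 := ((this.const_mul 2).mul_const V).const_mul (d : ℝ)
      simpa using h2
    have h3 := ENNReal.Tendsto.const_mul (a := ENNReal.ofReal C) (ENNReal.tendsto_ofReal h1)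
      (Or.inr ENNReal.ofReal_ne_top)
    simpa using h3
  have hle : ∀ m, ∫⁻ x in Icc (0 : Fin d → ℝ) 1, ‖F m x - F' x‖ₑ
      ≤ ENNReal.ofReal C * ENNReal.ofReal (d * (2 * (1 / 2) ^ m * V)) := by
    intro m
    calc ∫⁻ x in Icc (0 : Fin d → ℝ) 1, ‖F m x - F' x‖ₑ
        ≤ ∫⁻ x in Icc (0 : Fin d → ℝ) 1,
          ENNReal.ofReal C * ‖g (fun i => dyadicLeft m (x i)) - g x‖ₑ := by
          refine setLIntegral_mono' measurableSet_Icc fun x hx => ?_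
          rw [← ofReal_norm, ← ofReal_norm, ← ENNReal.ofReal_mul' (norm_nonneg _)]
          exact ENNReal.ofReal_le_ofReal (hb m x hx)
      _ = ENNReal.ofReal C *
          ∫⁻ x in Icc (0 : Fin d → ℝ) 1, ‖g (fun i => dyadicLeft m (x i)) - g x‖ₑ :=
          lintegral_const_mul _ ((measurable_comp_dyadicLeft h.measurable m).sub h.measurable).enorm
      _ ≤ _ := by gcongr; exact h.lintegral_dyadic_sub_le m
  refine tendsto_integral_of_L1 F' hF'.1 (Eventually.of_forall fun m => ?_) ?_
  · have : Integrable (fun x => F m x - F' x) (volume.restrict (Icc 0 1)) := by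
      refine ⟨(hF m).sub hF'.aestronglyMeasurable, ?_⟩
      exact lt_of_le_of_lt (hle m) (ENNReal.mul_lt_top ENNReal.ofReal_lt_top ENNReal.ofReal_lt_top)
    exact (this.add hF').congr (Eventually.of_forall fun x => by simp)
  · exact tendsto_of_tendsto_of_tendsto_of_le_of_le tendsto_const_nhds hlim (fun _ => zero_le) hle

/-- The dyadic cells are open on the left, so they miss the lower faces of the cube, a null set. -/
theorem ae_mem_Ioc_unitCube {d : ℕ} :
    ∀ᵐ x ∂((volume : Measure (Fin d → ℝ)).restrict (Icc 0 1)), ∀ i, x i ∈ Ioc (0 : ℝ) 1 := by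
  have h0 : (0 : Fin d → ℝ) = fun _ => 0 := rfl
  have h1 : (1 : Fin d → ℝ) = fun _ => 1 := rfl
  rw [h0, h1, volume_restrict_Icc_pi, ae_all_iff]
  intro i
  have : ∀ᵐ s ∂(volume.restrict (Icc (0 : ℝ) 1)), s ∈ Ioc (0 : ℝ) 1 := by
    rw [← Measure.restrict_congr_set (Ioc_ae_eq_Icc (a := (0 : ℝ)) (b := 1) (μ := volume))]
    exact ae_restrict_mem measurableSet_Ioc
  exact (Measure.tendsto_eval_ae_ae (μ := fun _ : Fin d => volume.restrict (Icc (0 : ℝ) 1))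
    (i := i)).eventually this

/-- Indicator of the orthant below `t`, as a function of `t`. -/
noncomputable def stepFn {d : ℕ} (x t : Fin d → ℝ) : ℝ := ∏ i, if x i ≤ t i then (1 : ℝ) else 0

theorem stepFn_eq {d : ℕ} (x t : Fin d → ℝ) :
    stepFn x t = (Iic t).indicator (fun _ => (1 : ℝ)) x := by
  by_cases hx : x ≤ t
  · rw [indicator_of_mem (show x ∈ Iic t from hx), stepFn, Finset.prod_eq_one]
    exact fun i _ => if_pos (hx i)
  · rw [indicator_of_notMem (show x ∉ Iic t from hx)]
    obtain ⟨i, hi⟩ := not_forall.1 hx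
    exact Finset.prod_eq_zero (Finset.mem_univ i) (if_neg hi)

theorem Icc_eq_inter_Iic {d : ℕ} {t : Fin d → ℝ} (ht : t ∈ Icc (0 : Fin d → ℝ) 1) :
    Icc 0 t = Icc 0 1 ∩ Iic t := by
  ext x
  simp only [mem_Icc, mem_inter_iff, mem_Iic]
  exact ⟨fun h => ⟨⟨h.1, h.2.trans ht.2⟩, h.2⟩, fun h => ⟨h.1.1, h.2⟩⟩

theorem integral_Icc_eq_stepFn {d : ℕ} (f : (Fin d → ℝ) → ℝ) {t : Fin d → ℝ}
    (ht : t ∈ Icc (0 : Fin d → ℝ) 1) :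
    ∫ x in Icc 0 t, f x = ∫ x in Icc 0 1, stepFn x t * f x := by
  rw [Icc_eq_inter_Iic ht, ← setIntegral_indicator measurableSet_Iic]
  congr 1
  funext x
  rw [stepFn_eq]
  by_cases hx : x ∈ Iic t <;> simp [hx]

theorem integrable_stepFn_mul {d : ℕ} {f : (Fin d → ℝ) → ℝ} {μ : Measure (Fin d → ℝ)}
    (hf : Integrable f μ) (t : Fin d → ℝ) : Integrable (fun x => stepFn x t * f x) μ := by
  refine (hf.indicator (measurableSet_Iic (a := t))).congr (Eventually.of_forall fun x => ?_)
  dsimp only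
  rw [stepFn_eq]
  by_cases hx : x ∈ Iic t <;> simp [hx]

/-- The Riemann-Stieltjes sums against an absolutely continuous function. -/
theorem rsSum_integral {d : ℕ} (m : ℕ) (g : (Fin d → ℝ) → ℝ) {f : (Fin d → ℝ) → ℝ}
    (hf : IntegrableOn f (Icc 0 1)) :
    rsSum m g (fun t => ∫ x in Icc 0 t, f x)
      = ∫ x in Icc 0 1, g (fun i => dyadicLeft m (x i)) * f x := by
  rw [rsSum_eq_sum]
  simp_rw [integral_Icc_eq_stepFn f (gridPt_mem m _), ← integral_const_mul]
  rw [← integral_finsetSum _ fun a _ => (integrable_stepFn_mul hf _).const_mul _]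
  refine integral_congr_ae ?_
  filter_upwards [ae_mem_Ioc_unitCube] with x hx
  -- By linearity the sum has moved under the integral, where it is taken against a point mass at
  -- `x`.
  have h1 : rsSum m g (stepFn x) = g (fun i => dyadicLeft m (x i)) := rsSum_indicator m g hx
  rw [← h1, rsSum_eq_sum m g (stepFn x), Finset.sum_mul]
  exact Finset.sum_congr rfl fun a _ => by ring

theorem IsTame.integrableOn_mul {d : ℕ} {g : (Fin d → ℝ) → ℝ} {V : ℝ} (h : IsTame g V)
    {f : (Fin d → ℝ) → ℝ} {s : Set (Fin d → ℝ)} (hf : IntegrableOn f s) :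
    IntegrableOn (fun x => g x * f x) s :=
  hf.bdd_mul (c := V) h.measurable.aestronglyMeasurable
    (Eventually.of_forall fun x => h.abs_apply_le x)

theorem IsTame.tendsto_rsSum_integral {d : ℕ} {g : (Fin d → ℝ) → ℝ} {V : ℝ} (h : IsTame g V)
    {f : (Fin d → ℝ) → ℝ} {C : ℝ} (hf : IntegrableOn f (Icc 0 1))
    (hC : ∀ x ∈ Icc (0 : Fin d → ℝ) 1, |f x| ≤ C) :
    Tendsto (fun m => rsSum m g (fun t => ∫ x in Icc 0 t, f x)) atTop
      (nhds (∫ x in Icc 0 1, g x * f x)) := by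
  simp_rw [rsSum_integral _ g hf]
  refine h.tendsto_integral_dyadic (C := C) (fun m => ?_) (h.integrableOn_mul hf) fun m x hx => ?_
  · exact (measurable_comp_dyadicLeft h.measurable m).aestronglyMeasurable.mul
      hf.aestronglyMeasurable
  · rw [← sub_mul, abs_mul, mul_comm]
    exact mul_le_mul_of_nonneg_right (hC x hx) (abs_nonneg _)


/-! ### Pathwise integrals against continuous paths. -/

/-- The projection of `ℝ^d` onto the unit cube. -/
def cubeClamp {d : ℕ} (t : Fin d → ℝ) : Fin d → ℝ := fun i => max 0 (min 1 (t i))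

theorem cubeClamp_mem {d : ℕ} (t : Fin d → ℝ) : cubeClamp t ∈ Icc (0 : Fin d → ℝ) 1 :=
  ⟨fun _ => le_max_left _ _, fun _ => max_le zero_le_one (min_le_left _ _)⟩

theorem cubeClamp_of_mem {d : ℕ} {t : Fin d → ℝ} (ht : t ∈ Icc (0 : Fin d → ℝ) 1) :
    cubeClamp t = t :=
  funext fun i => by
    have h1 : t i ≤ 1 := ht.2 i
    have h2 : 0 ≤ t i := ht.1 i
    rw [cubeClamp, min_eq_right h1, max_eq_right h2]

theorem continuous_cubeClamp {d : ℕ} : Continuous (cubeClamp : (Fin d → ℝ) → Fin d → ℝ) := by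
  unfold cubeClamp
  fun_prop

theorem monotone_cubeClamp {d : ℕ} : Monotone (cubeClamp : (Fin d → ℝ) → Fin d → ℝ) :=
  fun _ _ h i => max_le_max le_rfl (min_le_min le_rfl (h i))

/-- `w` has the same increments on the unit cube as the distribution function of the bounded
density `f`. -/
structure IsPrimitive {d : ℕ} (w f : (Fin d → ℝ) → ℝ) : Prop where
  integrable : IntegrableOn f (Icc 0 1)
  bounded : ∃ C, ∀ x ∈ Icc (0 : Fin d → ℝ) 1, |f x| ≤ C
  rsSum_eq : ∀ m g, rsSum m g w = rsSum m g (fun t => ∫ x in Icc 0 t, f x)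

theorem IntegrableOn.mono_unitCube {d : ℕ} {f : (Fin d → ℝ) → ℝ} (hf : IntegrableOn f (Icc 0 1))
    {t : Fin d → ℝ} (ht : t ∈ Icc (0 : Fin d → ℝ) 1) : IntegrableOn f (Icc 0 t) :=
  hf.mono_set (Icc_subset_Icc_right ht.2)

theorem IsPrimitive.add {d : ℕ} {w f w' f' : (Fin d → ℝ) → ℝ} (h : IsPrimitive w f)
    (h' : IsPrimitive w' f') : IsPrimitive (fun t => w t + w' t) (fun x => f x + f' x) where
  integrable := h.integrable.add h'.integrable
  bounded := by
    obtain ⟨C, hC⟩ := h.bounded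
    obtain ⟨C', hC'⟩ := h'.bounded
    exact ⟨C + C', fun x hx => (abs_add_le _ _).trans (add_le_add (hC x hx) (hC' x hx))⟩
  rsSum_eq m g := by
    rw [rsSum_add, h.rsSum_eq, h'.rsSum_eq, ← rsSum_add]
    refine rsSum_congr m g fun t ht => ?_
    exact (integral_add (IntegrableOn.mono_unitCube h.integrable ht)
      (IntegrableOn.mono_unitCube h'.integrable ht)).symm

theorem IsPrimitive.const_mul {d : ℕ} {w f : (Fin d → ℝ) → ℝ} (h : IsPrimitive w f) (c : ℝ) :
    IsPrimitive (fun t => c * w t) (fun x => c * f x) where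
  integrable := h.integrable.const_mul c
  bounded := by
    obtain ⟨C, hC⟩ := h.bounded
    exact ⟨|c| * C, fun x hx => by
      rw [abs_mul]; exact mul_le_mul_of_nonneg_left (hC x hx) (abs_nonneg c)⟩
  rsSum_eq m g := by
    rw [rsSum_const_mul, h.rsSum_eq, ← rsSum_const_mul]
    simp only [integral_const_mul]

theorem IsPrimitive.zero {d : ℕ} : IsPrimitive (fun _ : Fin d → ℝ => 0) (fun _ => 0) where
  integrable := integrable_zero _ _ _
  bounded := ⟨0, by simp⟩
  rsSum_eq m g := by simp

theorem setIntegral_Icc_prod {d : ℕ} (f : Fin d → ℝ → ℝ) (t : Fin d → ℝ) :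
    ∫ x in Icc 0 t, ∏ i, f i (x i) = ∏ i, ∫ s in Icc 0 (t i), f i s := by
  rw [← Set.pi_univ_Icc, volume_pi, Measure.restrict_pi_pi]
  exact integral_fintype_prod_eq_prod (𝕜 := ℝ) (μ := fun i => volume.restrict (Icc 0 (t i))) f

theorem isPrimitive_monomial {d : ℕ} (n : Fin d → ℕ) :
    IsPrimitive (fun t : Fin d → ℝ => ∏ i, t i ^ n i)
      (fun x => ∏ i, (n i * x i ^ (n i - 1) : ℝ)) where
  integrable := by
    have : Continuous fun x : Fin d → ℝ => ∏ i, (n i * x i ^ (n i - 1) : ℝ) := by fun_prop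
    exact this.continuousOn.integrableOn_compact isCompact_Icc
  bounded := by
    have : Continuous fun x : Fin d → ℝ => ∏ i, (n i * x i ^ (n i - 1) : ℝ) := by fun_prop
    obtain ⟨C, hC⟩ := (isCompact_Icc (a := (0 : Fin d → ℝ)) (b := 1)).exists_bound_of_continuousOn
      this.continuousOn
    exact ⟨C, hC⟩
  rsSum_eq m g := by
    have h1 : ∀ a : ℝ, 0 ≤ a → ∀ k : ℕ, ∫ s in Icc 0 a, (k * s ^ (k - 1) : ℝ) = a ^ k - 0 ^ k := by
      intro a ha k
      rw [integral_Icc_eq_integral_Ioc, ← intervalIntegral.integral_of_le ha]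
      refine intervalIntegral.integral_eq_sub_of_hasDerivAt (f := fun s => s ^ k)
        (fun s _ => hasDerivAt_pow k s) ?_
      exact Continuous.intervalIntegrable (by fun_prop) _ _
    -- The true primitive of the density has factors `t i ^ n i - 0 ^ n i`, with the same increments
    -- as the monomial. Since `0 ^ 0 = 1`, a factor with `n i = 0` vanishes, in agreement with the
    -- zero density.
    rw [rsSum_congr m g (w := fun t => ∫ x in Icc 0 t, ∏ i, (n i * x i ^ (n i - 1) : ℝ))
      (w' := fun t => ∏ i, (t i ^ n i - 0 ^ n i))]
    · simp only [rsSum]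
      refine Finset.sum_congr rfl fun k _ => ?_
      rw [mixedDiff_prod (fun i s => s ^ n i), mixedDiff_prod (fun i s => s ^ n i - 0 ^ n i)]
      simp
    · intro t ht
      dsimp only
      rw [setIntegral_Icc_prod (fun i s => (n i * s ^ (n i - 1) : ℝ)) t]
      exact Finset.prod_congr rfl fun i _ => h1 _ (ht.1 i) _

/-- Continuous functions on the cube are uniformly approximated by primitives of bounded
densities. -/
theorem exists_isPrimitive_near {d : ℕ} {w : (Fin d → ℝ) → ℝ} (hw : ContinuousOn w (Icc 0 1))
    {ε : ℝ} (hε : 0 < ε) :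
    ∃ w' f, IsPrimitive w' f ∧ ∀ t ∈ Icc (0 : Fin d → ℝ) 1, |w t - w' t| ≤ ε := by
  let proj : Fin d → C(Fin d → ℝ, ℝ) := fun i => ⟨fun t => t i, continuous_apply i⟩
  let A : Subalgebra ℝ C(Fin d → ℝ, ℝ) := Algebra.adjoin ℝ (range proj)
  have hA : A.SeparatesPoints := by
    intro x y hxy
    obtain ⟨i, hi⟩ := Function.ne_iff.1 hxy
    exact ⟨_, ⟨proj i, Algebra.subset_adjoin (mem_range_self i), rfl⟩, hi⟩
  let wc : C(Fin d → ℝ, ℝ) := ⟨fun t => w (cubeClamp t),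
    hw.comp_continuous continuous_cubeClamp cubeClamp_mem⟩
  obtain ⟨p, hpA, hp⟩ :=
    ContinuousMap.exists_mem_subalgebra_near_continuous_of_isCompact_of_separatesPoints hA wc
      (isCompact_Icc (a := (0 : Fin d → ℝ)) (b := 1)) hε
  have hprim : ∃ f, IsPrimitive (fun t => p t) f := by
    have hp' : p ∈ Submodule.span ℝ (Submonoid.closure (range proj) : Set C(Fin d → ℝ, ℝ)) := by
      rw [← Algebra.adjoin_eq_span]; exact hpA
    clear hp hpA
    induction hp' using Submodule.span_induction with
    | mem q hq =>
      have : ∃ n : Fin d → ℕ, ∀ t, q t = ∏ i, t i ^ n i := by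
        induction hq using Submonoid.closure_induction with
        | mem q hq =>
          obtain ⟨i, rfl⟩ := hq
          refine ⟨Pi.single i 1, fun t => ?_⟩
          rw [Finset.prod_eq_single i] <;> simp +contextual [proj]
        | one => exact ⟨0, fun t => by simp⟩
        | mul q r _ _ hq hr =>
          obtain ⟨n, hn⟩ := hq
          obtain ⟨k, hk⟩ := hr
          exact ⟨n + k, fun t => by simp [hn, hk, pow_add, Finset.prod_mul_distrib]⟩
      obtain ⟨n, hn⟩ := this
      have : (fun t => q t) = fun t => ∏ i, t i ^ n i := funext hn
      exact ⟨_, this ▸ isPrimitive_monomial n⟩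
    | zero => exact ⟨_, IsPrimitive.zero⟩
    | add q r _ _ hq hr =>
      obtain ⟨f, hf⟩ := hq
      obtain ⟨f', hf'⟩ := hr
      exact ⟨_, hf.add hf'⟩
    | smul c q _ hq =>
      obtain ⟨f, hf⟩ := hq
      exact ⟨_, hf.const_mul c⟩
  obtain ⟨f, hf⟩ := hprim
  refine ⟨_, f, hf, fun t ht => ?_⟩
  have h1 := (hp t ht).le
  have h2 : wc t = w t := by
    change w (cubeClamp t) = w t
    rw [cubeClamp_of_mem ht]
  rwa [h2, Real.norm_eq_abs, abs_sub_comm] at h1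

theorem IsPrimitive.tendsto_rsSum {d : ℕ} {g w f : (Fin d → ℝ) → ℝ} {V : ℝ} (hg : IsTame g V)
    (h : IsPrimitive w f) :
    Tendsto (fun m => rsSum m g w) atTop (nhds (∫ x in Icc 0 1, g x * f x)) := by
  obtain ⟨C, hC⟩ := h.bounded
  simp_rw [h.rsSum_eq]
  exact hg.tendsto_rsSum_integral h.integrable hC

theorem IsTame.abs_rsSum_sub_le {d : ℕ} {g w w' : (Fin d → ℝ) → ℝ} {V ε : ℝ} (hg : IsTame g V)
    (hww' : ∀ t ∈ Icc (0 : Fin d → ℝ) 1, |w t - w' t| ≤ ε) (m : ℕ) :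
    |rsSum m g w - rsSum m g w'| ≤ V * (2 ^ d * ε) := by
  rw [← rsSum_sub]
  exact hg.abs_rsSum_le m hww'

/-- By summation by parts a uniformly small perturbation of the path is harmless simultaneously at
all levels and for all integrands with the same variation bound. Limits can therefore be taken for
smooth paths first. -/
theorem IsTame.exists_isPrimitive_near {d : ℕ} {w : (Fin d → ℝ) → ℝ}
    (hw : ContinuousOn w (Icc 0 1)) (V : ℝ) {ε : ℝ} (hε : 0 < ε) :
    ∃ w' f, IsPrimitive w' f ∧ ∀ g, IsTame g V → ∀ m, |rsSum m g w - rsSum m g w'| ≤ ε := by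
  have hpos : 0 < 2 ^ d * (|V| + 1) := by positivity
  obtain ⟨w', f, hf, hww'⟩ := _root_.exists_isPrimitive_near hw (div_pos hε hpos)
  refine ⟨w', f, hf, fun g hg m => (hg.abs_rsSum_sub_le hww' m).trans ?_⟩
  calc V * (2 ^ d * (ε / (2 ^ d * (|V| + 1)))) ≤ (|V| + 1) * (2 ^ d * (ε / (2 ^ d * (|V| + 1)))) := by
        gcongr; linarith [le_abs_self V]
    _ = ε := by field_simp

/-- The Riemann-Stieltjes sums converge for every continuous path. -/
theorem IsTame.tendsto_rsSum {d : ℕ} {g w : (Fin d → ℝ) → ℝ} {V : ℝ} (hg : IsTame g V)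
    (hw : ContinuousOn w (Icc 0 1)) :
    Tendsto (fun m => rsSum m g w) atTop (nhds (pathIntegral g w)) := by
  rw [pathIntegral_eq]
  refine CauchySeq.tendsto_limUnder ?_
  rw [Metric.cauchySeq_iff']
  intro ε hε
  obtain ⟨w', f, hf, hn⟩ := IsTame.exists_isPrimitive_near hw V (show 0 < ε / 4 by positivity)
  obtain ⟨N, hN⟩ := Metric.cauchySeq_iff'.1 (hf.tendsto_rsSum hg).cauchySeq (ε / 4) (by positivity)
  refine ⟨N, fun m hm => ?_⟩
  have h1 := abs_le.1 (hn g hg m)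
  have h2 := abs_le.1 (hn g hg N)
  have h3 := abs_lt.1 (Real.dist_eq (rsSum m g w') _ ▸ hN m hm)
  rw [Real.dist_eq, abs_lt]
  constructor <;> linarith

theorem IsTame.pathIntegral_sub_left {d : ℕ} {g g' w : (Fin d → ℝ) → ℝ} {V V' : ℝ}
    (hg : IsTame g V) (hg' : IsTame g' V') (hw : ContinuousOn w (Icc 0 1)) :
    pathIntegral (g - g') w = pathIntegral g w - pathIntegral g' w := by
  refine tendsto_nhds_unique ((hg.sub hg').tendsto_rsSum hw) ?_
  simp_rw [rsSum_sub_left]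
  exact (hg.tendsto_rsSum hw).sub (hg'.tendsto_rsSum hw)

theorem IsTame.pathIntegral_neg_left {d : ℕ} {g w : (Fin d → ℝ) → ℝ} {V : ℝ}
    (hg : IsTame g V) (hw : ContinuousOn w (Icc 0 1)) :
    pathIntegral (-g) w = - pathIntegral g w := by
  refine tendsto_nhds_unique (hg.neg.tendsto_rsSum hw) ?_
  simp_rw [rsSum_neg_left]
  exact (hg.tendsto_rsSum hw).neg

theorem IsTame.tendsto_rsSum_signal {d : ℕ} {g w f : (Fin d → ℝ) → ℝ} {V C : ℝ}
    (hg : IsTame g V) (hw : ContinuousOn w (Icc 0 1)) (hf : IntegrableOn f (Icc 0 1))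
    (hC : ∀ x ∈ Icc (0 : Fin d → ℝ) 1, |f x| ≤ C) (a : ℝ) :
    pathIntegral g (fun t => a * (∫ s in Icc 0 t, f s) + w t)
      = a * (∫ x in Icc 0 1, g x * f x) + pathIntegral g w := by
  rw [pathIntegral_eq]
  refine Tendsto.limUnder_eq ?_
  simp_rw [rsSum_add, rsSum_const_mul]
  exact ((hg.tendsto_rsSum_integral hf hC).const_mul a).add (hg.tendsto_rsSum hw)

/-- The path integral is continuous in the integrand with respect to the mean distance, on sets of
integrands of uniformly bounded variation. -/
theorem IsTame.tendsto_pathIntegral {d : ℕ} {G : ℕ → (Fin d → ℝ) → ℝ} {g w : (Fin d → ℝ) → ℝ}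
    {V : ℝ} (hG : ∀ q, IsTame (G q) V) (hg : IsTame g V) (hw : ContinuousOn w (Icc 0 1))
    (hlim : Tendsto (fun q => ∫⁻ x in Icc (0 : Fin d → ℝ) 1, ‖G q x - g x‖ₑ) atTop (nhds 0)) :
    Tendsto (fun q => pathIntegral (G q) w) atTop (nhds (pathIntegral g w)) := by
  rw [Metric.tendsto_atTop]
  intro ε hε
  obtain ⟨w', f, hf, hn⟩ := IsTame.exists_isPrimitive_near hw V (show 0 < ε / 4 by positivity)
  -- Up to `ε / 4`, uniformly in the integrand, the path integral is an ordinary integral against a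
  -- bounded density, for which convergence in mean suffices.
  have hclose : ∀ g, IsTame g V → |pathIntegral g w - ∫ x in Icc 0 1, g x * f x| ≤ ε / 4 := by
    intro g hg
    refine le_of_tendsto ((hg.tendsto_rsSum hw).sub (hf.tendsto_rsSum hg)).abs ?_
    exact Eventually.of_forall (hn g hg)
  obtain ⟨C, hC⟩ := hf.bounded
  have hint : Tendsto (fun q => ∫ x in Icc 0 1, G q x * f x) atTop
      (nhds (∫ x in Icc 0 1, g x * f x)) := by
    refine tendsto_integral_of_L1 _ (hg.integrableOn_mul hf.integrable).1
      (Eventually.of_forall fun q => (hG q).integrableOn_mul hf.integrable) ?_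
    have h1 := ENNReal.Tendsto.const_mul (a := ENNReal.ofReal C) hlim (Or.inr ENNReal.ofReal_ne_top)
    rw [mul_zero] at h1
    refine tendsto_of_tendsto_of_tendsto_of_le_of_le tendsto_const_nhds h1 (fun _ => zero_le) ?_
    intro q
    dsimp only
    have hm : Measurable fun x => ‖G q x - g x‖ₑ := ((hG q).measurable.sub hg.measurable).enorm
    rw [← lintegral_const_mul _ hm]
    refine setLIntegral_mono' measurableSet_Icc fun x hx => ?_
    rw [← sub_mul, mul_comm, enorm_mul]
    gcongr
    rw [← ofReal_norm]
    exact ENNReal.ofReal_le_ofReal (hC x hx)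
  obtain ⟨N, hN⟩ := Metric.tendsto_atTop.1 hint (ε / 4) (by positivity)
  refine ⟨N, fun q hq => ?_⟩
  have h1 := abs_le.1 (hclose (G q) (hG q))
  have h2 := abs_le.1 (hclose g hg)
  have h3 := abs_lt.1 (Real.dist_eq (∫ x in Icc 0 1, G q x * f x) _ ▸ hN q hq)
  rw [Real.dist_eq, abs_lt]
  constructor <;> linarith


/-! ### Gaussian tails of integrals against a Brownian sheet. -/

section BrownianSheet

variable {d : ℕ} {Ω : Type*} [MeasurableSpace Ω] {P : Measure Ω}
  {W : (Fin d → ℝ) → Ω → ℝ} {g : (Fin d → ℝ) → ℝ} {V : ℝ}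

theorem IsBrownianSheet.hasGaussianLaw_rsSum (hW : IsBrownianSheet W P) (m : ℕ)
    (g : (Fin d → ℝ) → ℝ) : HasGaussianLaw (fun ω => rsSum m g (fun t => W t ω)) P := by
  classical
  let e : ((Fin d → Fin (2 ^ m)) × Finset (Fin d)) → Icc (0 : Fin d → ℝ) 1 := fun a =>
    ⟨gridPt m a, gridPt_mem m a⟩
  let I : Finset (Icc (0 : Fin d → ℝ) 1) := Finset.univ.image e
  let L : (I → ℝ) →L[ℝ] ℝ := ∑ a, gridWt m g a •
    ContinuousLinearMap.proj (R := ℝ) (φ := fun _ : I => ℝ)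
      ⟨e a, Finset.mem_image_of_mem e (Finset.mem_univ a)⟩
  refine ((hW.gaussian.hasGaussianLaw I).map_fun L).congr (Eventually.of_forall fun ω => ?_)
  simp [L, rsSum_eq_sum, e]

theorem IsBrownianSheet.memLp_two (hW : IsBrownianSheet W P) {t : Fin d → ℝ}
    (ht : t ∈ Icc (0 : Fin d → ℝ) 1) : MemLp (W t) 2 P := by
  have h := hW.gaussian.hasGaussianLaw {⟨t, ht⟩}
  exact (h.eval ⟨⟨t, ht⟩, Finset.mem_singleton_self _⟩).memLp_two

/-- The covariance of the sheet is an `L²` inner product of orthant indicators; this is the source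
of the isometry for Riemann sums. -/
theorem integral_stepFn_mul_stepFn {s t : Fin d → ℝ} (hs : s ∈ Icc (0 : Fin d → ℝ) 1)
    (ht : t ∈ Icc (0 : Fin d → ℝ) 1) :
    ∫ x in Icc 0 1, stepFn x s * stepFn x t = ∏ i, min (s i) (t i) := by
  have h1 : ∀ x, stepFn x s * stepFn x t = stepFn x (fun i => min (s i) (t i)) * 1 := by
    intro x
    simp only [stepFn, ← Finset.prod_mul_distrib, mul_one, le_min_iff]
    refine Finset.prod_congr rfl fun i _ => ?_
    by_cases h1 : x i ≤ s i <;> by_cases h2 : x i ≤ t i <;> simp [h1, h2]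
  simp_rw [h1]
  have h0 : ∀ i, 0 ≤ min (s i) (t i) := fun i => le_min (hs.1 i) (ht.1 i)
  rw [← integral_Icc_eq_stepFn (fun _ => 1) ⟨h0, fun i => (min_le_left _ _).trans (hs.2 i)⟩]
  rw [setIntegral_const, smul_eq_mul, mul_one, measureReal_def, Real.volume_Icc_pi,
    ENNReal.toReal_prod]
  exact Finset.prod_congr rfl fun i _ => by
    rw [Pi.zero_apply, sub_zero, ENNReal.toReal_ofReal (h0 i)]

theorem IsBrownianSheet.ae_tendsto_rsSum (hW : IsBrownianSheet W P) (hg : IsTame g V) :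
    ∀ᵐ ω ∂P, Tendsto (fun m => rsSum m g (fun t => W t ω)) atTop
      (nhds (pathIntegral g (fun t => W t ω))) := by
  filter_upwards [hW.continuous] with ω hω
  exact hg.tendsto_rsSum hω

theorem IsBrownianSheet.aemeasurable_pathIntegral (hW : IsBrownianSheet W P) (hg : IsTame g V) :
    AEMeasurable (fun ω => pathIntegral g (fun t => W t ω)) P :=
  aemeasurable_of_tendsto_metrizable_ae atTop
    (fun m => (hW.hasGaussianLaw_rsSum m g).aemeasurable) (hW.ae_tendsto_rsSum hg)

variable [IsProbabilityMeasure P]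

/-- The discrete Wiener isometry: with covariances written as inner products of orthant indicators,
the double sum is the integral of the square of the Riemann sum against a point mass. -/
theorem IsBrownianSheet.variance_rsSum (hW : IsBrownianSheet W P) (m : ℕ) (g : (Fin d → ℝ) → ℝ) :
    Var[fun ω => rsSum m g (fun t => W t ω); P]
      = ∫ x in Icc (0 : Fin d → ℝ) 1, g (fun i => dyadicLeft m (x i)) ^ 2 := by
  have h1 : ∀ a, MemLp (fun ω => gridWt m g a * W (gridPt m a) ω) 2 P := fun a =>
    (hW.memLp_two (gridPt_mem m a)).const_mul _
  have hint : ∀ s t : Fin d → ℝ,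
      Integrable (fun x => stepFn x s * stepFn x t) (volume.restrict (Icc 0 1)) := by
    intro s t
    have := integrable_stepFn_mul (integrable_const (1 : ℝ)
      (μ := (volume : Measure (Fin d → ℝ)).restrict (Icc 0 1))) t
    simpa using integrable_stepFn_mul this s
  rw [← covariance_self (hW.hasGaussianLaw_rsSum m g).aemeasurable]
  simp_rw [rsSum_eq_sum]
  rw [covariance_fun_sum_fun_sum h1 h1]
  simp_rw [covariance_const_mul_left, covariance_const_mul_right, hW.cov _ (gridPt_mem m _) _
    (gridPt_mem m _), ← integral_stepFn_mul_stepFn (gridPt_mem m _) (gridPt_mem m _),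
    ← integral_const_mul]
  rw [Finset.sum_congr rfl fun a _ => (integral_finsetSum _ fun b _ =>
    ((hint (gridPt m a) (gridPt m b)).const_mul _).const_mul _).symm,
    ← integral_finsetSum _ fun a _ => integrable_finsetSum _ fun b _ =>
    ((hint (gridPt m a) (gridPt m b)).const_mul _).const_mul _]
  refine integral_congr_ae ?_
  filter_upwards [ae_mem_Ioc_unitCube] with x hx
  have h1 : rsSum m g (stepFn x) = g (fun i => dyadicLeft m (x i)) := rsSum_indicator m g hx
  rw [← h1, rsSum_eq_sum m g (stepFn x), sq, Finset.sum_mul_sum]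
  exact Finset.sum_congr rfl fun a _ => Finset.sum_congr rfl fun b _ => by ring

theorem IsBrownianSheet.integral_rsSum (hW : IsBrownianSheet W P) (m : ℕ) (g : (Fin d → ℝ) → ℝ) :
    ∫ ω, rsSum m g (fun t => W t ω) ∂P = 0 := by
  simp_rw [rsSum_eq_sum]
  rw [integral_finsetSum _ fun a _ =>
    ((hW.memLp_two (gridPt_mem m a)).integrable (by norm_num)).const_mul _]
  simp_rw [integral_const_mul, hW.mean _ (gridPt_mem m _), mul_zero, Finset.sum_const_zero]

theorem IsBrownianSheet.mgf_rsSum (hW : IsBrownianSheet W P) (m : ℕ) (g : (Fin d → ℝ) → ℝ) (t : ℝ) :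
    mgf (fun ω => rsSum m g (fun t => W t ω)) P t
      = Real.exp ((∫ x in Icc (0 : Fin d → ℝ) 1, g (fun i => dyadicLeft m (x i)) ^ 2) * t ^ 2 / 2) := by
  rw [mgf_gaussianReal (hW.hasGaussianLaw_rsSum m g).map_eq_gaussianReal, hW.variance_rsSum,
    hW.integral_rsSum, Real.coe_toNNReal _ (integral_nonneg fun _ => sq_nonneg _), zero_mul,
    zero_add]

/-- As `g` is bounded by `V`, squares differ by at most `2 * V` times the difference, and
convergence in mean applies. -/
theorem IsTame.tendsto_integral_sq (hg : IsTame g V) :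
    Tendsto (fun m => ∫ x in Icc (0 : Fin d → ℝ) 1, g (fun i => dyadicLeft m (x i)) ^ 2) atTop
      (nhds (∫ x in Icc (0 : Fin d → ℝ) 1, g x ^ 2)) := by
  refine hg.tendsto_integral_dyadic (C := 2 * V)
    (fun m => ((measurable_comp_dyadicLeft hg.measurable m).pow_const 2).aestronglyMeasurable)
    ?_ fun m x _ => ?_
  · refine Integrable.of_bound (hg.measurable.pow_const 2).aestronglyMeasurable (V ^ 2)
      (Eventually.of_forall fun x => ?_)
    rw [Real.norm_eq_abs, abs_pow]
    exact pow_le_pow_left₀ (abs_nonneg _) (hg.abs_apply_le x) 2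
  · rw [sq_sub_sq, abs_mul]
    gcongr
    refine (abs_add_le _ _).trans ?_
    linarith [hg.abs_apply_le x, hg.abs_apply_le (fun i => dyadicLeft m (x i))]

/-- The path integral of a deterministic function against a Brownian sheet is sub-Gaussian, with
the squared `L²` norm of the integrand as variance proxy. -/
theorem IsBrownianSheet.hasSubgaussianMGF (hW : IsBrownianSheet W P) (hg : IsTame g V) {c : ℝ≥0}
    (hc : ∫ x in Icc (0 : Fin d → ℝ) 1, g x ^ 2 ≤ c) :
    HasSubgaussianMGF (fun ω => pathIntegral g (fun t => W t ω)) c P := by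
  have key : ∀ t : ℝ, ∫⁻ ω, ENNReal.ofReal (Real.exp (t * pathIntegral g (fun t => W t ω))) ∂P
      ≤ ENNReal.ofReal (Real.exp (c * t ^ 2 / 2)) := by
    intro t
    have hm := fun m => (hW.hasGaussianLaw_rsSum m g).aemeasurable
    have hmeas : ∀ m, AEMeasurable
        (fun ω => ENNReal.ofReal (Real.exp (t * rsSum m g (fun t => W t ω)))) P := fun m =>
      (Real.measurable_exp.comp_aemeasurable ((hm m).const_mul t)).ennreal_ofReal
    -- Fatou's lemma along the Riemann sums. Only an upper bound is needed, so the limit need not be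
    -- shown to be Gaussian.
    calc ∫⁻ ω, ENNReal.ofReal (Real.exp (t * pathIntegral g (fun t => W t ω))) ∂P
        = ∫⁻ ω, liminf (fun m => ENNReal.ofReal (Real.exp (t * rsSum m g (fun t => W t ω))))
            atTop ∂P := by
          refine lintegral_congr_ae ?_
          filter_upwards [hW.ae_tendsto_rsSum hg] with ω hω
          refine (Tendsto.liminf_eq ?_).symm
          exact ENNReal.tendsto_ofReal ((Real.continuous_exp.tendsto _).comp (hω.const_mul t))
      _ ≤ liminf (fun m => ∫⁻ ω, ENNReal.ofReal (Real.exp (t * rsSum m g (fun t => W t ω))) ∂P)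
            atTop := lintegral_liminf_le' hmeas
      _ = liminf (fun m => ENNReal.ofReal (Real.exp ((∫ x in Icc (0 : Fin d → ℝ) 1,
            g (fun i => dyadicLeft m (x i)) ^ 2) * t ^ 2 / 2))) atTop := by
          congr 1
          funext m
          rw [← hW.mgf_rsSum m g t, mgf, ofReal_integral_eq_lintegral_ofReal]
          -- A non-integrable exponential would have integral zero by convention, whereas the moment
          -- generating function is positive.
          · by_contra hcon
            have h1 := hW.mgf_rsSum m g t
            rw [mgf, integral_undef hcon] at h1
            exact (Real.exp_pos _).ne h1
          · exact Eventually.of_forall fun ω => (Real.exp_pos _).le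
      _ = ENNReal.ofReal (Real.exp ((∫ x in Icc (0 : Fin d → ℝ) 1, g x ^ 2) * t ^ 2 / 2)) := by
          refine Tendsto.liminf_eq (ENNReal.tendsto_ofReal ?_)
          exact (Real.continuous_exp.tendsto _).comp
            ((hg.tendsto_integral_sq.mul_const (t ^ 2)).div_const 2)
      _ ≤ _ := by gcongr
  have hae := hW.aemeasurable_pathIntegral hg
  have hexp : ∀ t : ℝ, AEStronglyMeasurable
      (fun ω => Real.exp (t * pathIntegral g (fun t => W t ω))) P := fun t =>
    (Real.measurable_exp.comp_aemeasurable (hae.const_mul t)).aestronglyMeasurable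
  refine ⟨fun t => ⟨hexp t, ?_⟩, fun t => ?_⟩
  · rw [hasFiniteIntegral_iff_ofReal (Eventually.of_forall fun _ => (Real.exp_pos _).le)]
    exact (key t).trans_lt ENNReal.ofReal_lt_top
  · rw [mgf, integral_eq_lintegral_of_nonneg_ae (Eventually.of_forall fun _ => (Real.exp_pos _).le)
      (hexp t)]
    exact ENNReal.toReal_le_of_le_ofReal (Real.exp_pos _).le (key t)

/-- From `1 + t X ≤ exp (t X)` the mean times `t` is at most `exp (c t² / 2) - 1`, which is of order
`t²`; dividing by `t` and letting `t` decrease to zero gives the sign. Applied to both `X` and `-X`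
it yields a centered integral. -/
theorem ProbabilityTheory.HasSubgaussianMGF.integral_nonpos {X : Ω → ℝ} {c : ℝ≥0}
    (h : HasSubgaussianMGF X c P) : ∫ ω, X ω ∂P ≤ 0 := by
  refine le_of_forall_pos_le_add fun ε hε => ?_
  rw [zero_add]
  set C : ℝ := c / 2 * Real.exp (c / 2) with hC
  have hC0 : 0 ≤ C := by positivity
  have key : ∀ t : ℝ, 0 < t → t ≤ 1 → ∫ ω, X ω ∂P ≤ t * C := by
    intro t ht ht1
    have h1 : ∫ ω, (t * X ω + 1) ∂P ≤ mgf X P t :=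
      integral_mono ((h.integrable.const_mul t).add (integrable_const 1)) (h.integrable_exp_mul t)
        fun ω => Real.add_one_le_exp _
    rw [integral_add (h.integrable.const_mul t) (integrable_const 1), integral_const_mul] at h1
    simp only [integral_const, probReal_univ, smul_eq_mul, mul_one] at h1
    have h2 := h.mgf_le t
    have h3 : Real.exp (c * t ^ 2 / 2) - 1 ≤ c * t ^ 2 / 2 * Real.exp (c * t ^ 2 / 2) := by
      have h4 := Real.add_one_le_exp (-(c * t ^ 2 / 2))
      have h5 : Real.exp (-(c * t ^ 2 / 2)) * Real.exp (c * t ^ 2 / 2) = 1 := by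
        rw [← Real.exp_add]; simp
      nlinarith [Real.exp_pos (c * t ^ 2 / 2)]
    have h4 : Real.exp (c * t ^ 2 / 2) ≤ Real.exp (c / 2) := by
      refine Real.exp_le_exp.2 ?_
      have : t ^ 2 ≤ 1 := by nlinarith
      have hc : (0 : ℝ) ≤ c := c.2
      nlinarith
    have h5 : c * t ^ 2 / 2 * Real.exp (c * t ^ 2 / 2) ≤ c * t ^ 2 / 2 * Real.exp (c / 2) := by
      gcongr
    have h6 : t * ∫ ω, X ω ∂P ≤ t * (t * C) := by
      rw [hC]; nlinarith
    exact le_of_mul_le_mul_left h6 ht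
  have hC1 : 0 < C + 1 := by linarith
  refine (key (min 1 (ε / (C + 1))) (lt_min one_pos (by positivity)) (min_le_left _ _)).trans ?_
  calc min 1 (ε / (C + 1)) * C ≤ ε / (C + 1) * C := by gcongr; exact min_le_right _ _
    _ ≤ ε / (C + 1) * (C + 1) := by gcongr; linarith
    _ = ε := div_mul_cancel₀ _ hC1.ne'

theorem IsBrownianSheet.integrable_pathIntegral (hW : IsBrownianSheet W P) (hg : IsTame g V) :
    Integrable (fun ω => pathIntegral g (fun t => W t ω)) P :=
  (hW.hasSubgaussianMGF hg (c := (∫ x in Icc (0 : Fin d → ℝ) 1, g x ^ 2).toNNReal)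
    (Real.le_coe_toNNReal _)).integrable

theorem IsBrownianSheet.integral_pathIntegral (hW : IsBrownianSheet W P) (hg : IsTame g V) :
    ∫ ω, pathIntegral g (fun t => W t ω) ∂P = 0 := by
  have h := hW.hasSubgaussianMGF hg (c := (∫ x in Icc (0 : Fin d → ℝ) 1, g x ^ 2).toNNReal)
    (Real.le_coe_toNNReal _)
  refine le_antisymm h.integral_nonpos ?_
  have h2 := h.neg.integral_nonpos
  simp only [Pi.neg_apply, integral_neg] at h2
  linarith

/-- Gaussian tail bound for path integrals against a Brownian sheet. -/
theorem IsBrownianSheet.measure_ge_le (hW : IsBrownianSheet W P) (hg : IsTame g V) {c : ℝ}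
    (hc : ∫ x in Icc (0 : Fin d → ℝ) 1, g x ^ 2 ≤ c) {u : ℝ} (hu : 0 ≤ u) :
    P {ω | u ≤ pathIntegral g (fun t => W t ω)} ≤ ENNReal.ofReal (Real.exp (-u ^ 2 / (2 * c))) := by
  have hc0 : 0 ≤ c := (integral_nonneg fun _ => sq_nonneg _).trans hc
  have h := (hW.hasSubgaussianMGF hg (c := c.toNNReal) (hc.trans (Real.le_coe_toNNReal _))).measure_ge_le hu
  rw [Real.coe_toNNReal _ hc0, measureReal_def] at h
  exact (ENNReal.le_ofReal_iff_toReal_le (measure_ne_top _ _) (Real.exp_pos _).le).2 h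

end BrownianSheet


/-! ### Kernels transported to boxes, and their distances. -/

theorem map_standardize_volume {d : ℕ} (t : Fin d → ℝ) {h : Fin d → ℝ} (hh : ∀ i, 0 < h i) :
    Measure.map (fun (x : Fin d → ℝ) i => (x i - t i) / h i) volume
      = ENNReal.ofReal (∏ i, h i) • (volume : Measure (Fin d → ℝ)) := by
  have hD : (Matrix.diagonal fun i => (h i)⁻¹).det ≠ 0 := by
    rw [Matrix.det_diagonal]
    exact Finset.prod_ne_zero_iff.2 fun i _ => inv_ne_zero (hh i).ne'
  have h1 := Real.map_matrix_volume_pi_eq_smul_volume_pi hD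
  have h2 : (fun (x : Fin d → ℝ) i => (x i - t i) / h i)
      = (Matrix.toLin' (Matrix.diagonal fun i => (h i)⁻¹)) ∘ fun x => x - t := by
    funext x i
    simp [Matrix.mulVec_diagonal, div_eq_inv_mul]
  have hcont : Measurable (Matrix.toLin' (Matrix.diagonal fun i => (h i)⁻¹)) :=
    (LinearMap.continuous_on_pi _).measurable
  rw [h2, ← Measure.map_map hcont (show Measurable fun x : Fin d → ℝ => x - t from measurable_id.sub_const t),
    (measurePreserving_sub_right volume t).map_eq, h1, Matrix.det_diagonal]
  congr 2
  rw [Finset.prod_inv_distrib, inv_inv, abs_of_pos (Finset.prod_pos fun i _ => hh i)]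

theorem measurable_standardize {d : ℕ} (t h : Fin d → ℝ) :
    Measurable fun (x : Fin d → ℝ) i => (x i - t i) / h i :=
  measurable_pi_lambda _ fun i => ((measurable_pi_apply i).sub_const _).div_const _

theorem lintegral_standardize {d : ℕ} (t : Fin d → ℝ) {h : Fin d → ℝ} (hh : ∀ i, 0 < h i)
    {F : (Fin d → ℝ) → ℝ≥0∞} (hF : Measurable F) :
    ∫⁻ x : Fin d → ℝ, F (fun i => (x i - t i) / h i) = ENNReal.ofReal (∏ i, h i) * ∫⁻ z, F z := by
  rw [← lintegral_map hF (measurable_standardize t h), map_standardize_volume t hh,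
    lintegral_smul_measure, smul_eq_mul]

theorem integral_standardize {d : ℕ} (t : Fin d → ℝ) {h : Fin d → ℝ} (hh : ∀ i, 0 < h i)
    {F : (Fin d → ℝ) → ℝ} (hF : Measurable F) :
    ∫ x : Fin d → ℝ, F (fun i => (x i - t i) / h i) = (∏ i, h i) * ∫ z, F z := by
  rw [← integral_map (measurable_standardize t h).aemeasurable hF.aestronglyMeasurable,
    map_standardize_volume t hh, integral_smul_measure, smul_eq_mul,
    ENNReal.toReal_ofReal (Finset.prod_pos fun i _ => hh i).le]

/-- The kernel `ψ` transported to the box with corners `a` and `b`. -/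
noncomputable def boxKernel {d : ℕ} (ψ : (Fin d → ℝ) → ℝ) (a b : Fin d → ℝ) : (Fin d → ℝ) → ℝ :=
  scaledKernel ψ (fun i => (a i + b i) / 2) (fun i => (b i - a i) / 2)

theorem scaledKernel_eq_boxKernel {d : ℕ} (ψ : (Fin d → ℝ) → ℝ) (t h : Fin d → ℝ) :
    scaledKernel ψ t h = boxKernel ψ (t - h) (t + h) := by
  unfold boxKernel
  congr 1 <;> funext i <;> simp only [Pi.sub_apply, Pi.add_apply] <;> ring

/-- A tame function that vanishes outside `[-1,1]^d`. -/
structure IsTameKernel {d : ℕ} (ψ : (Fin d → ℝ) → ℝ) (V : ℝ) : Prop extends IsTame ψ V where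
  support : ∀ x, x ∉ Icc (-1 : Fin d → ℝ) 1 → ψ x = 0

namespace IsTameKernel

variable {d : ℕ} {ψ : (Fin d → ℝ) → ℝ} {V : ℝ} {a b a' b' : Fin d → ℝ}

theorem neg (hψ : IsTameKernel ψ V) : IsTameKernel (-ψ) V where
  toIsTame := hψ.toIsTame.neg
  support x hx := by simp [hψ.support x hx]

theorem isTame_boxKernel (hψ : IsTameKernel ψ V) (hab : ∀ i, a i < b i) (hb : ∀ i, b i ≤ 1) :
    IsTame (boxKernel ψ a b) V :=
  hψ.toIsTame.scaled (fun i => by linarith [hab i]) fun i => by linarith [hb i]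

theorem boxKernel_eq_zero (hψ : IsTameKernel ψ V) (hab : ∀ i, a i < b i) {x : Fin d → ℝ}
    (hx : x ∉ Icc a b) : boxKernel ψ a b x = 0 := by
  refine hψ.support _ fun hmem => hx ?_
  refine ⟨fun i => ?_, fun i => ?_⟩
  · have h1 : -1 ≤ (x i - (a i + b i) / 2) / ((b i - a i) / 2) := hmem.1 i
    rw [le_div_iff₀ (by linarith [hab i])] at h1
    linarith
  · have h1 : (x i - (a i + b i) / 2) / ((b i - a i) / 2) ≤ 1 := hmem.2 i
    rw [div_le_iff₀ (by linarith [hab i])] at h1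
    linarith

theorem integrable_sq (hψ : IsTameKernel ψ V) : Integrable (fun x => ψ x ^ 2) := by
  have h1 : IntegrableOn (fun x => ψ x ^ 2) (Icc (-1 : Fin d → ℝ) 1) := by
    refine Measure.integrableOn_of_bounded (M := V ^ 2) isCompact_Icc.measure_lt_top.ne
      (hψ.measurable.pow_const 2).aestronglyMeasurable (Eventually.of_forall fun x => ?_)
    rw [Real.norm_eq_abs, abs_pow]
    exact pow_le_pow_left₀ (abs_nonneg _) (hψ.abs_apply_le x) 2
  exact (integrableOn_iff_integrable_of_support_subset fun x hx => by
    by_contra hcon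
    exact hx (by simp [hψ.support x hcon])).1 h1

theorem integral_boxKernel_sq_le (hψ : IsTameKernel ψ V) (hab : ∀ i, a i < b i) :
    ∫ x in Icc 0 1, boxKernel ψ a b x ^ 2 ≤ (∏ i, (b i - a i) / 2) * l2Norm ψ ^ 2 := by
  have hh : ∀ i, 0 < (b i - a i) / 2 := fun i => by linarith [hab i]
  have hnn : 0 ≤ ∫ x, ψ x ^ 2 := integral_nonneg fun _ => sq_nonneg _
  have h1 := integral_standardize (fun i => (a i + b i) / 2) hh (hψ.measurable.pow_const 2)
  rw [l2Norm, Real.sq_sqrt hnn, ← h1]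
  refine setIntegral_le_integral ?_ (Eventually.of_forall fun _ => sq_nonneg _)
  have h2 := hψ.integrable_sq
  have h3 : Integrable (fun x => ψ x ^ 2)
      (Measure.map (fun (x : Fin d → ℝ) i => (x i - (a i + b i) / 2) / ((b i - a i) / 2)) volume) := by
    rw [map_standardize_volume _ hh]
    exact h2.smul_measure ENNReal.ofReal_ne_top
  exact h3.comp_measurable (measurable_standardize _ _)

/-- Mean distance of the kernel on two nested boxes. -/
theorem lintegral_boxKernel_sub_le (hψ : IsTameKernel ψ V) (hab : ∀ i, a i < b i)
    (ha : ∀ i, a' i ≤ a i) (hb : ∀ i, b i ≤ b' i) {η : ℝ} (hη : 0 ≤ η)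
    (haη : ∀ i, a i - a' i ≤ η * (b i - a i)) (hbη : ∀ i, b' i - b i ≤ η * (b i - a i)) :
    ∫⁻ x, ‖boxKernel ψ a b x - boxKernel ψ a' b' x‖ₑ
      ≤ ENNReal.ofReal (4 * d * V * η * ∏ i, (b' i - a' i)) := by
  have hV := hψ.toIsTame.nonneg
  have hab' : ∀ i, a' i < b' i := fun i => by linarith [hab i, ha i, hb i]
  have hh : ∀ i, 0 < (b' i - a' i) / 2 := fun i => by linarith [hab' i]
  -- The standardized coordinate with respect to the inner box, as a function of the one with
  -- respect to the outer box; it differs from `z` by at most `4 * η`.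
  let σ : Fin d → ℝ → ℝ := fun i z =>
    ((a' i + b' i + z * (b' i - a' i)) / 2 - (a i + b i) / 2) / ((b i - a i) / 2)
  have hσm : ∀ i, Measurable (σ i) := fun i => by simp only [σ]; fun_prop
  have hσ : ∀ i, ∀ s ∈ Icc (-1 : ℝ) 1, |σ i s - s| ≤ 4 * η := by
    intro i s hs
    have hba : 0 < b i - a i := by linarith [hab i]
    have e1 : σ i s - s = ((1 + s) * (b' i - b i) - (1 - s) * (a i - a' i)) / (b i - a i) := by
      simp only [σ]; field_simp; ring
    have h1 := ha i
    have h2 := hb i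
    have h3 := haη i
    have h4 := hbη i
    have h5 : 0 ≤ η * (b i - a i) := by positivity
    rw [e1, abs_div, abs_of_pos hba, div_le_iff₀ hba, abs_le]
    have h6 : 0 ≤ (1 + s) * (b' i - b i) := mul_nonneg (by linarith [hs.1]) (by linarith)
    have h7 : 0 ≤ (1 - s) * (a i - a' i) := mul_nonneg (by linarith [hs.2]) (by linarith)
    have h8 : (1 + s) * (b' i - b i) ≤ 2 * (η * (b i - a i)) :=
      mul_le_mul (by linarith [hs.2]) h4 (by linarith) (by norm_num)
    have h9 : (1 - s) * (a i - a' i) ≤ 2 * (η * (b i - a i)) :=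
      mul_le_mul (by linarith [hs.1]) h3 (by linarith) (by norm_num)
    constructor <;> linarith
  set F : (Fin d → ℝ) → ℝ≥0∞ := fun z => ‖ψ (fun i => σ i (z i)) - ψ z‖ₑ with hF
  have hFm : Measurable F :=
    ((hψ.measurable.comp (measurable_pi_lambda _ fun i =>
      (hσm i).comp (measurable_pi_apply i))).sub hψ.measurable).enorm
  have h1 : ∀ x, ‖boxKernel ψ a b x - boxKernel ψ a' b' x‖ₑ
      = F (fun i => (x i - (a' i + b' i) / 2) / ((b' i - a' i) / 2)) := by
    intro x
    simp only [hF, σ, boxKernel, scaledKernel]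
    congr 4
    funext i
    have := (hh i).ne'
    have : b' i - a' i ≠ 0 := fun h => by simp [h] at this
    congr 1
    field_simp
    ring
  have h2 : ∀ z, z ∉ Icc (fun _ => -1 : Fin d → ℝ) (fun _ => 1) → F z = 0 := by
    intro z hz
    have hz1 : ψ z = 0 := hψ.support z hz
    have hz2 : ψ (fun i => σ i (z i)) = 0 := by
      refine hψ.support _ fun hmem => hz ?_
      have key : ∀ i, σ i (z i) * (b i - a i) = a' i + b' i + z i * (b' i - a' i) - (a i + b i) := by
        intro i
        have hba : b i - a i ≠ 0 := by linarith [hab i]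
        simp only [σ]; field_simp
      refine ⟨fun i => ?_, fun i => ?_⟩
      · have h3 : -1 ≤ σ i (z i) := hmem.1 i
        have h4 := key i
        have h5 : -1 * (b i - a i) ≤ σ i (z i) * (b i - a i) :=
          mul_le_mul_of_nonneg_right h3 (by linarith [hab i])
        have h6 : -1 * (b' i - a' i) ≤ z i * (b' i - a' i) := by linarith [ha i]
        exact le_of_mul_le_mul_right h6 (by linarith [hab' i])
      · have h3 : σ i (z i) ≤ 1 := hmem.2 i
        have h4 := key i
        have h5 : σ i (z i) * (b i - a i) ≤ 1 * (b i - a i) :=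
          mul_le_mul_of_nonneg_right h3 (by linarith [hab i])
        have h6 : z i * (b' i - a' i) ≤ 1 * (b' i - a' i) := by linarith [hb i]
        exact le_of_mul_le_mul_right h6 (by linarith [hab' i])
    simp [hF, hz1, hz2]
  simp_rw [h1]
  rw [lintegral_standardize (fun i => (a' i + b' i) / 2) hh hFm,
    ← setLIntegral_eq_of_support_subset (s := Icc (fun _ => -1 : Fin d → ℝ) (fun _ => 1))
      (fun z hz => by by_contra hcon; exact hz (h2 z hcon))]
  have h3 := hψ.toIsTame.lintegral_comp_sub_le (A := -1) (B := 1) (by norm_num) hσm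
    (show 0 ≤ 4 * η by positivity) hσ
  calc ENNReal.ofReal (∏ i, (b' i - a' i) / 2) *
        ∫⁻ z in Icc (fun _ => -1 : Fin d → ℝ) (fun _ => 1), F z
      ≤ ENNReal.ofReal (∏ i, (b' i - a' i) / 2) *
        ENNReal.ofReal (d * ((1 - -1) ^ d * (2 * (4 * η) * V / (1 - -1)))) := by gcongr
    _ = _ := by
        rw [← ENNReal.ofReal_mul (Finset.prod_nonneg fun i _ => (hh i).le), Finset.prod_div_distrib,
          Finset.prod_const, Finset.card_univ, Fintype.card_fin]
        congr 1
        norm_num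
        field_simp

/-- The square is at most `2 * V` times the absolute difference, which is small in mean. A kernel
may jump, so the variance is only linear in `η`. -/
theorem integral_boxKernel_sub_sq_le (hψ : IsTameKernel ψ V) (hab : ∀ i, a i < b i)
    (ha : ∀ i, a' i ≤ a i) (hb : ∀ i, b i ≤ b' i) {η : ℝ} (hη : 0 ≤ η)
    (haη : ∀ i, a i - a' i ≤ η * (b i - a i)) (hbη : ∀ i, b' i - b i ≤ η * (b i - a i)) 
    (hb' : ∀ i, b' i ≤ 1) :
    ∫ x in Icc 0 1, (boxKernel ψ a b - boxKernel ψ a' b') x ^ 2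
      ≤ 8 * d * V ^ 2 * η * ∏ i, (b' i - a' i) := by
  have hV := hψ.toIsTame.nonneg
  have hab' : ∀ i, a' i < b' i := fun i => by linarith [hab i, ha i, hb i]
  have hp : 0 ≤ ∏ i, (b' i - a' i) := Finset.prod_nonneg fun i _ => by linarith [hab' i]
  have ht := hψ.isTame_boxKernel hab fun i => (hb i).trans (hb' i)
  have ht' := hψ.isTame_boxKernel hab' hb'
  rw [integral_eq_lintegral_of_nonneg_ae (Eventually.of_forall fun _ => sq_nonneg _)
    ((ht.measurable.sub ht'.measurable).pow_const 2).aestronglyMeasurable]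
  refine ENNReal.toReal_le_of_le_ofReal (by positivity) ?_
  calc ∫⁻ x in Icc 0 1, ENNReal.ofReal ((boxKernel ψ a b - boxKernel ψ a' b') x ^ 2)
      ≤ ∫⁻ x in Icc 0 1, ENNReal.ofReal (2 * V) *
          ‖boxKernel ψ a b x - boxKernel ψ a' b' x‖ₑ := by
        refine lintegral_mono fun x => ?_
        rw [← ofReal_norm, ← ENNReal.ofReal_mul (by positivity), Pi.sub_apply, Real.norm_eq_abs,
          ← sq_abs, sq]
        refine ENNReal.ofReal_le_ofReal (mul_le_mul_of_nonneg_right ?_ (abs_nonneg _))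
        exact (abs_sub _ _).trans (by linarith [ht.abs_apply_le x, ht'.abs_apply_le x])
    _ ≤ ∫⁻ x, ENNReal.ofReal (2 * V) *
          ‖boxKernel ψ a b x - boxKernel ψ a' b' x‖ₑ := setLIntegral_le_lintegral _ _
    _ = ENNReal.ofReal (2 * V) *
          ∫⁻ x, ‖boxKernel ψ a b x - boxKernel ψ a' b' x‖ₑ :=
        lintegral_const_mul _ (ht.measurable.sub ht'.measurable).enorm
    _ ≤ ENNReal.ofReal (2 * V) * ENNReal.ofReal (4 * d * V * η * ∏ i, (b' i - a' i)) := by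
        gcongr
        exact hψ.lintegral_boxKernel_sub_le hab ha hb hη haη hbη
    _ = _ := by
        rw [← ENNReal.ofReal_mul (by positivity)]
        congr 1
        ring

end IsTameKernel


/-! ### Grids of approximating boxes. -/

/-- Number of cells per unit length of the grid of level `p` for boxes of scale `j`. -/
def gridRes {d : ℕ} (j : Fin d → ℕ) (p : ℕ) (i : Fin d) : ℕ := 2 ^ j i * 16 ^ p

/-- Indices of the boxes of level `p` that approximate boxes with side lengths at most
`2 ^ (- j i)`: the position of the lower corner and the side lengths, in grid units. -/
def scaleGrid {d : ℕ} (j : Fin d → ℕ) (p : ℕ) : Finset (Fin d → ℕ × ℕ) :=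
  Fintype.piFinset fun i => Finset.range (gridRes j p i + 1) ×ˢ Finset.range (16 ^ p + 3)

noncomputable def gridLo {d : ℕ} (j : Fin d → ℕ) (p : ℕ) (k : Fin d → ℕ × ℕ) (i : Fin d) : ℝ :=
  (k i).1 / gridRes j p i

noncomputable def gridHi {d : ℕ} (j : Fin d → ℕ) (p : ℕ) (k : Fin d → ℕ × ℕ) (i : Fin d) : ℝ :=
  ((k i).1 + (k i).2 : ℕ) / gridRes j p i

/-- The factor `2 ^ (∑ i, j i)`, the inverse volume of the boxes, is what the penalty has to cancel;
the rest depends only on the level. -/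
theorem card_scaleGrid_le {d : ℕ} (j : Fin d → ℕ) (p : ℕ) :
    (scaleGrid j p).card ≤ 2 ^ (∑ i, j i) * (8 ^ d * 256 ^ (d * p)) := by
  rw [scaleGrid, Fintype.card_piFinset]
  calc ∏ i, (Finset.range (gridRes j p i + 1) ×ˢ Finset.range (16 ^ p + 3)).card
      ≤ ∏ i, (2 ^ j i * (8 * 256 ^ p)) := by
        refine Finset.prod_le_prod' fun i _ => ?_
        rw [Finset.card_product, Finset.card_range, Finset.card_range, gridRes]
        have h1 : 1 ≤ 2 ^ j i * 16 ^ p := Nat.one_le_iff_ne_zero.2 (by positivity)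
        have h2 : 1 ≤ 16 ^ p := Nat.one_le_iff_ne_zero.2 (by positivity)
        calc (2 ^ j i * 16 ^ p + 1) * (16 ^ p + 3)
            ≤ (2 * (2 ^ j i * 16 ^ p)) * (4 * 16 ^ p) := Nat.mul_le_mul (by omega) (by omega)
          _ = 2 ^ j i * (8 * 256 ^ p) := by
            rw [show (256 : ℕ) = 16 * 16 by norm_num, mul_pow]; ring
    _ = _ := by
        rw [Finset.prod_mul_distrib, Finset.prod_pow_eq_pow_sum, Finset.prod_const,
          Finset.card_univ, Fintype.card_fin, mul_pow, ← pow_mul, mul_comm p d]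

/-- The index of the smallest box of level `p` that contains the box with corners `a` and `b`. -/
noncomputable def gridIdx {d : ℕ} (j : Fin d → ℕ) (p : ℕ) (a b : Fin d → ℝ) (i : Fin d) : ℕ × ℕ :=
  (⌊a i * gridRes j p i⌋₊, ⌈b i * gridRes j p i⌉₊ - ⌊a i * gridRes j p i⌋₊)

section gridIdx

variable {d : ℕ} {j : Fin d → ℕ} {a b : Fin d → ℝ}

theorem gridRes_pos (j : Fin d → ℕ) (p : ℕ) (i : Fin d) : (0 : ℝ) < gridRes j p i := by
  unfold gridRes; positivity

theorem one_div_gridRes (j : Fin d → ℕ) (p : ℕ) (i : Fin d) :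
    1 / (gridRes j p i : ℝ) = (1 / 2) ^ j i * (1 / 16) ^ p := by
  simp [gridRes, mul_comm]

theorem gridHi_gridIdx (p : ℕ) (hab : ∀ i, a i < b i) (i : Fin d) :
    gridHi j p (gridIdx j p a b) i = ⌈b i * gridRes j p i⌉₊ / gridRes j p i := by
  have h : ⌊a i * gridRes j p i⌋₊ ≤ ⌈b i * gridRes j p i⌉₊ :=
    (Nat.floor_mono (mul_le_mul_of_nonneg_right (hab i).le (gridRes_pos j p i).le)).trans
      (Nat.floor_le_ceil _)
  simp only [gridHi, gridIdx]
  rw [Nat.add_sub_cancel' h]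

theorem gridLo_nonneg (p : ℕ) (k : Fin d → ℕ × ℕ) (i : Fin d) : 0 ≤ gridLo j p k i := by
  unfold gridLo; positivity

theorem gridLo_le (p : ℕ) (ha : ∀ i, 0 ≤ a i) (i : Fin d) :
    gridLo j p (gridIdx j p a b) i ≤ a i := by
  have hR := gridRes_pos j p i
  rw [gridLo, div_le_iff₀ hR]
  exact Nat.floor_le (mul_nonneg (ha i) hR.le)

theorem sub_gridLo_le (p : ℕ) (i : Fin d) :
    a i - gridLo j p (gridIdx j p a b) i ≤ (1 / 2) ^ j i * (1 / 16) ^ p := by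
  have hR := gridRes_pos j p i
  have h1 := (Nat.lt_floor_add_one (a i * gridRes j p i)).le
  rw [← one_div_gridRes, sub_le_iff_le_add, gridLo, ← add_div, le_div_iff₀ hR]
  simp only [gridIdx]
  linarith

theorem le_gridHi (p : ℕ) (hab : ∀ i, a i < b i) (i : Fin d) :
    b i ≤ gridHi j p (gridIdx j p a b) i := by
  have hR := gridRes_pos j p i
  rw [gridHi_gridIdx p hab, le_div_iff₀ hR]
  exact Nat.le_ceil _

theorem gridHi_sub_le (p : ℕ) (hab : ∀ i, a i < b i) (hb : ∀ i, 0 ≤ b i) (i : Fin d) :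
    gridHi j p (gridIdx j p a b) i - b i ≤ (1 / 2) ^ j i * (1 / 16) ^ p := by
  have hR := gridRes_pos j p i
  have h1 := (Nat.ceil_lt_add_one (mul_nonneg (hb i) hR.le)).le
  rw [gridHi_gridIdx p hab, ← one_div_gridRes, sub_le_iff_le_add, div_le_iff₀ hR, add_mul,
    one_div, inv_mul_cancel₀ hR.ne']
  linarith

theorem gridHi_le_one (p : ℕ) (hab : ∀ i, a i < b i) (hb : ∀ i, b i ≤ 1) (i : Fin d) :
    gridHi j p (gridIdx j p a b) i ≤ 1 := by
  have hR := gridRes_pos j p i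
  rw [gridHi_gridIdx p hab, div_le_one hR]
  exact_mod_cast Nat.ceil_le.2 (by nlinarith [hb i])

/-- Each grid refines the preceding one, as the resolution is multiplied by the integer `16`;
enclosing boxes therefore shrink from level to level. -/
theorem gridLo_mono (p : ℕ) (ha : ∀ i, 0 ≤ a i) (i : Fin d) :
    gridLo j p (gridIdx j p a b) i ≤ gridLo j (p + 1) (gridIdx j (p + 1) a b) i := by
  have hR := gridRes_pos j p i
  have hR' := gridRes_pos j (p + 1) i
  have e : (gridRes j (p + 1) i : ℝ) = 16 * gridRes j p i := by
    simp only [gridRes]; push_cast; ring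
  have h1 : 16 * ⌊a i * gridRes j p i⌋₊ ≤ ⌊a i * gridRes j (p + 1) i⌋₊ := by
    refine Nat.le_floor ?_
    push_cast
    rw [e]
    linarith [Nat.floor_le (mul_nonneg (ha i) hR.le)]
  have h2 : (16 : ℝ) * ⌊a i * gridRes j p i⌋₊ ≤ ⌊a i * gridRes j (p + 1) i⌋₊ := by exact_mod_cast h1
  simp only [gridLo, gridIdx]
  rw [div_le_div_iff₀ hR hR', e]
  rw [e] at h2
  nlinarith

theorem gridHi_anti (p : ℕ) (hab : ∀ i, a i < b i) (i : Fin d) :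
    gridHi j (p + 1) (gridIdx j (p + 1) a b) i ≤ gridHi j p (gridIdx j p a b) i := by
  have hR := gridRes_pos j p i
  have hR' := gridRes_pos j (p + 1) i
  have e : (gridRes j (p + 1) i : ℝ) = 16 * gridRes j p i := by
    simp only [gridRes]; push_cast; ring
  have h1 : ⌈b i * gridRes j (p + 1) i⌉₊ ≤ 16 * ⌈b i * gridRes j p i⌉₊ := by
    refine Nat.ceil_le.2 ?_
    push_cast
    rw [e]
    linarith [Nat.le_ceil (b i * gridRes j p i)]
  have h2 : (⌈b i * gridRes j (p + 1) i⌉₊ : ℝ) ≤ 16 * ⌈b i * gridRes j p i⌉₊ := by exact_mod_cast h1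
  rw [gridHi_gridIdx p hab, gridHi_gridIdx (p + 1) hab, div_le_div_iff₀ hR' hR, e]
  rw [e] at h2
  nlinarith

theorem gridIdx_mem (p : ℕ) (ha : ∀ i, 0 ≤ a i) (hab : ∀ i, a i < b i) (hb : ∀ i, b i ≤ 1)
    (hj : ∀ i, b i - a i ≤ (1 / 2) ^ j i) : gridIdx j p a b ∈ scaleGrid j p := by
  rw [scaleGrid, Fintype.mem_piFinset]
  intro i
  have hR := gridRes_pos j p i
  rw [Finset.mem_product, Finset.mem_range, Finset.mem_range, gridIdx]
  constructor
  · refine Nat.lt_succ_of_le (Nat.floor_le_of_le ?_)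
    nlinarith [hab i, hb i]
  · dsimp only
    have h1 := Nat.ceil_lt_add_one (mul_nonneg ((ha i).trans (hab i).le) hR.le)
    have h2 := Nat.lt_floor_add_one (a i * gridRes j p i)
    have h3 : (b i - a i) * gridRes j p i ≤ 16 ^ p := by
      calc (b i - a i) * gridRes j p i ≤ (1 / 2) ^ j i * gridRes j p i := by gcongr; exact hj i
        _ = 16 ^ p := by
          simp only [gridRes]; push_cast
          rw [← mul_assoc, ← mul_pow]; norm_num
    -- A side has at most `16 ^ p` grid units, and rounding both ends outwards adds fewer than two;
    -- hence the range `16 ^ p + 3` in `scaleGrid`.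
    have h4 : (⌈b i * gridRes j p i⌉₊ : ℝ) < 16 ^ p + 2 + ⌊a i * gridRes j p i⌋₊ := by linarith
    have h5 : ⌈b i * gridRes j p i⌉₊ < 16 ^ p + 2 + ⌊a i * gridRes j p i⌋₊ := by exact_mod_cast h4
    have h6 : 0 < 16 ^ p := by positivity
    omega

end gridIdx

/-! ### Chaining along a fixed path. -/

/-- The coarsest level used for boxes of volume about `2 ^ (-s)`. -/
def baseLevel (s : ℕ) : ℕ := Nat.log 2 (s + 1) + 1

/-- The base level has `2 ^ p` comparable with `s + 1`. This lower bound makes the enlargement of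
the box negligible against the penalty, while the upper bound below keeps the excess number of boxes
polynomial in `s`. -/
theorem lt_two_pow_baseLevel (s : ℕ) : s + 1 < 2 ^ baseLevel s :=
  Nat.lt_pow_succ_log_self (by norm_num) _

theorem two_pow_baseLevel_le (s : ℕ) : 2 ^ baseLevel s ≤ 2 * (s + 1) := by
  rw [baseLevel, pow_succ, mul_comm]
  exact Nat.mul_le_mul_left 2 (Nat.pow_log_le_self 2 (by omega))

/-- The penalty for boxes of volume `2 ^ (-s)`. -/
noncomputable def dyadicPenalty (s : ℕ) : ℝ := √(2 * (1 + s * Real.log 2))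

theorem dyadicPenalty_le_penalty {s : ℕ} {r : ℝ} (hr : 0 < r) (hrs : r ≤ (1 / 2) ^ s) :
    dyadicPenalty s ≤ penalty r := by
  refine Real.sqrt_le_sqrt ?_
  have h1 := Real.log_le_log hr hrs
  rw [Real.log_pow, one_div, Real.log_inv] at h1
  rw [Real.log_div (Real.exp_pos 1).ne' hr.ne', Real.log_exp]
  linarith

theorem dyadicPenalty_le (s : ℕ) : dyadicPenalty s ≤ 2 * (s + 1) := by
  rw [dyadicPenalty, Real.sqrt_le_left (by positivity)]
  have := Real.log_two_lt_d9
  have hs : (0 : ℝ) ≤ s := Nat.cast_nonneg s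
  nlinarith

theorem sqrt_le_dyadicPenalty (s : ℕ) : √(s + 1 : ℝ) ≤ dyadicPenalty s := by
  refine Real.sqrt_le_sqrt ?_
  have := Real.log_two_gt_d9
  have hs : (0 : ℝ) ≤ s := Nat.cast_nonneg s
  nlinarith

/-- Relation between the indices of two consecutive approximations of a box of scale `j`. -/
def IsRefinement {d : ℕ} (j : Fin d → ℕ) (p : ℕ) (k k' : Fin d → ℕ × ℕ) : Prop :=
  ∀ i, gridLo j (p + 1) k' i < gridHi j (p + 1) k' i ∧ gridLo j p k i ≤ gridLo j (p + 1) k' i ∧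
    gridHi j (p + 1) k' i ≤ gridHi j p k i ∧ gridHi j p k i ≤ 1 ∧
    gridLo j (p + 1) k' i - gridLo j p k i
      ≤ 2 * (1 / 16) ^ p * (gridHi j (p + 1) k' i - gridLo j (p + 1) k' i) ∧
    gridHi j p k i - gridHi j (p + 1) k' i
      ≤ 2 * (1 / 16) ^ p * (gridHi j (p + 1) k' i - gridLo j (p + 1) k' i) ∧
    gridHi j p k i - gridLo j p k i ≤ 3 * (1 / 2) ^ j i

/-- A path along which all links of the chaining are controlled at level `x`. -/
structure IsControlled {d : ℕ} (ψ w : (Fin d → ℝ) → ℝ) (x : ℝ) : Prop where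
  base : ∀ j : Fin d → ℕ, ∀ k ∈ scaleGrid j (baseLevel (∑ i, j i)),
    (∀ i, gridLo j (baseLevel (∑ i, j i)) k i < gridHi j (baseLevel (∑ i, j i)) k i ∧
      gridHi j (baseLevel (∑ i, j i)) k i ≤ 1) →
    pathIntegral (boxKernel ψ (gridLo j (baseLevel (∑ i, j i)) k)
      (gridHi j (baseLevel (∑ i, j i)) k)) w <
      l2Norm ψ * √(∏ i, (gridHi j (baseLevel (∑ i, j i)) k i
        - gridLo j (baseLevel (∑ i, j i)) k i) / 2) * (dyadicPenalty (∑ i, j i) + x)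
  link : ∀ j : Fin d → ℕ, ∀ p, baseLevel (∑ i, j i) ≤ p → ∀ k ∈ scaleGrid j p,
    ∀ k' ∈ scaleGrid j (p + 1), IsRefinement j p k k' →
    pathIntegral (boxKernel ψ (gridLo j (p + 1) k') (gridHi j (p + 1) k')
      - boxKernel ψ (gridLo j p k) (gridHi j p k)) w < x * (1 / 2) ^ p * √((1 / 2) ^ (∑ i, j i))

/-- The mesh is `2 ^ (-j i) * 16 ^ (-p)` and the side exceeds `2 ^ (-j i) / 2`, hence the relative
error `2 * 16 ^ (-p)`. Adding two meshes to the side gives at most `3 * 2 ^ (-j i)`. -/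
theorem isRefinement_gridIdx {d : ℕ} {j : Fin d → ℕ} {a b : Fin d → ℝ} (p : ℕ)
    (ha : ∀ i, 0 ≤ a i) (hab : ∀ i, a i < b i) (hb : ∀ i, b i ≤ 1)
    (hj : ∀ i, b i - a i ≤ (1 / 2) ^ j i) (hj' : ∀ i, (1 / 2) ^ (j i + 1) < b i - a i) :
    IsRefinement j p (gridIdx j p a b) (gridIdx j (p + 1) a b) := by
  intro i
  have hb0 : ∀ i, 0 ≤ b i := fun i => (ha i).trans (hab i).le
  have h1 := gridLo_le (j := j) (b := b) p ha i
  have h2 := gridLo_le (j := j) (b := b) (p + 1) ha i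
  have h3 := le_gridHi (j := j) p hab i
  have h4 := le_gridHi (j := j) (p + 1) hab i
  have h5 := sub_gridLo_le (j := j) (a := a) (b := b) p i
  have h6 := gridHi_sub_le (j := j) p hab hb0 i
  have h7 := hab i
  have h8 := hj i
  have h9 := hj' i
  rw [pow_succ] at h9
  have h10 : (1 / 2 : ℝ) ^ j i * (1 / 16) ^ p ≤ (1 / 2) ^ j i :=
    mul_le_of_le_one_right (by positivity) (pow_le_one₀ (by norm_num) (by norm_num))
  have h11 : (1 / 2 : ℝ) ^ j i * (1 / 16) ^ p ≤ 2 * (1 / 16) ^ p *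
      (gridHi j (p + 1) (gridIdx j (p + 1) a b) i - gridLo j (p + 1) (gridIdx j (p + 1) a b) i) := by
    have : (0 : ℝ) ≤ (1 / 16) ^ p := by positivity
    nlinarith
  exact ⟨by linarith, gridLo_mono p ha i, gridHi_anti p hab i, gridHi_le_one p hab hb i,
    by linarith, by linarith, by linarith⟩

theorem one_add_pow_le {u : ℝ} (hu : 0 ≤ u) (hu1 : u ≤ 1) (d : ℕ) :
    (1 + u) ^ d ≤ 1 + (2 ^ d - 1) * u := by
  induction d with
  | zero => simp
  | succ d ih =>
    have h1 : (1 : ℝ) ≤ 2 ^ d := one_le_pow₀ (by norm_num)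
    calc (1 + u) ^ (d + 1) = (1 + u) ^ d * (1 + u) := pow_succ _ _
      _ ≤ (1 + (2 ^ d - 1) * u) * (1 + u) := by gcongr
      _ ≤ 1 + (2 ^ (d + 1) - 1) * u := by
        rw [pow_succ]
        nlinarith [mul_nonneg (sub_nonneg.2 h1) (mul_nonneg hu (sub_nonneg.2 hu1))]

/-- The integral over the box is the limit along its enclosing grid boxes. The base integral is
controlled directly, and the increments between levels sum as a geometric series to at most twice
`x` times the square root of `(1 / 2) ^ (∑ i, j i)`. -/
theorem IsControlled.pathIntegral_le {d : ℕ} {ψ w : (Fin d → ℝ) → ℝ} {V x : ℝ}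
    (hc : IsControlled ψ w x) (hψ : IsTameKernel ψ V) (hw : ContinuousOn w (Icc 0 1))
    (hx : 0 ≤ x) {j : Fin d → ℕ} {a b : Fin d → ℝ}
    (ha : ∀ i, 0 ≤ a i) (hab : ∀ i, a i < b i) (hb : ∀ i, b i ≤ 1)
    (hj : ∀ i, b i - a i ≤ (1 / 2) ^ j i) (hj' : ∀ i, (1 / 2) ^ (j i + 1) < b i - a i) :
    pathIntegral (boxKernel ψ a b) w ≤
      l2Norm ψ * √(∏ i, (gridHi j (baseLevel (∑ i, j i)) (gridIdx j (baseLevel (∑ i, j i)) a b) i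
        - gridLo j (baseLevel (∑ i, j i)) (gridIdx j (baseLevel (∑ i, j i)) a b) i) / 2)
        * (dyadicPenalty (∑ i, j i) + x) + 2 * x * √((1 / 2) ^ (∑ i, j i)) := by
  set s := ∑ i, j i with hs
  set p₀ := baseLevel s with hp₀
  set lo : ℕ → Fin d → ℝ := fun p => gridLo j p (gridIdx j p a b) with hlo
  set hi : ℕ → Fin d → ℝ := fun p => gridHi j p (gridIdx j p a b) with hhi
  have hb0 : ∀ i, 0 ≤ b i := fun i => (ha i).trans (hab i).le
  have hlt : ∀ p i, lo p i < hi p i := fun p i =>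
    ((gridLo_le p ha i).trans_lt (hab i)).trans_le (le_gridHi p hab i)
  have hhi1 : ∀ p i, hi p i ≤ 1 := fun p i => gridHi_le_one p hab hb i
  have htame : ∀ p, IsTame (boxKernel ψ (lo p) (hi p)) V := fun p =>
    hψ.isTame_boxKernel (hlt p) (hhi1 p)
  have htame' := hψ.isTame_boxKernel hab hb
  have hlim : Tendsto (fun p => pathIntegral (boxKernel ψ (lo p) (hi p)) w) atTop
      (nhds (pathIntegral (boxKernel ψ a b) w)) := by
    refine IsTame.tendsto_pathIntegral htame htame' hw ?_
    have h1 : ∀ p, ∫⁻ x in Icc (0 : Fin d → ℝ) 1, ‖boxKernel ψ (lo p) (hi p) x - boxKernel ψ a b x‖ₑ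
        ≤ ENNReal.ofReal (4 * d * V * (2 * (1 / 16) ^ p) * 1) := by
      intro p
      have h2 := hψ.lintegral_boxKernel_sub_le (a' := lo p) (b' := hi p) hab
        (fun i => gridLo_le p ha i) (fun i => le_gridHi p hab i)
        (η := 2 * (1 / 16) ^ p) (by positivity)
        (fun i => (sub_gridLo_le p i).trans ?_) (fun i => (gridHi_sub_le p hab hb0 i).trans ?_)
      · refine (setLIntegral_le_lintegral _ _).trans ?_
        simp_rw [← edist_eq_enorm_sub, edist_comm (boxKernel ψ (lo p) (hi p) _), edist_eq_enorm_sub]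
        refine h2.trans (ENNReal.ofReal_le_ofReal ?_)
        have hV := hψ.toIsTame.nonneg
        refine mul_le_mul_of_nonneg_left ?_ (by positivity)
        refine Finset.prod_le_one (fun i _ => by linarith [hlt p i]) fun i _ => ?_
        have : 0 ≤ lo p i := gridLo_nonneg p _ i
        linarith [hhi1 p i]
      all_goals
        have h3 := hj' i
        rw [pow_succ] at h3
        have : (0 : ℝ) ≤ (1 / 16) ^ p := by positivity
        nlinarith
    refine tendsto_of_tendsto_of_tendsto_of_le_of_le tendsto_const_nhds ?_ (fun _ => zero_le) h1
    have h3 : Tendsto (fun p : ℕ => 4 * d * V * (2 * (1 / 16 : ℝ) ^ p) * 1) atTop (nhds 0) := by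
      have := tendsto_pow_atTop_nhds_zero_of_lt_one (r := (1 / 16 : ℝ)) (by norm_num) (by norm_num)
      simpa using ((this.const_mul 2).const_mul (4 * d * V)).mul_const 1
    simpa using ENNReal.tendsto_ofReal h3
  have hbase := (hc.base j _ (gridIdx_mem p₀ ha hab hb hj) fun i => ⟨hlt p₀ i, hhi1 p₀ i⟩).le
  have hstep : ∀ n, pathIntegral (boxKernel ψ (lo (p₀ + n)) (hi (p₀ + n))) w ≤
      pathIntegral (boxKernel ψ (lo p₀) (hi p₀)) w
        + (2 - 2 * (1 / 2) ^ n) * (x * √((1 / 2) ^ s)) := by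
    intro n
    induction n with
    | zero => simp
    | succ n ih =>
      have h1 := (hc.link j (p₀ + n) (Nat.le_add_right _ _) _ (gridIdx_mem _ ha hab hb hj) _
        (gridIdx_mem _ ha hab hb hj) (isRefinement_gridIdx _ ha hab hb hj hj')).le
      rw [(htame (p₀ + n + 1)).pathIntegral_sub_left (htame (p₀ + n)) hw] at h1
      have h2 : x * (1 / 2) ^ (p₀ + n) * √((1 / 2) ^ s) ≤ (1 / 2) ^ n * (x * √((1 / 2) ^ s)) := by
        rw [mul_comm x, mul_assoc, pow_add]
        refine mul_le_mul_of_nonneg_right ?_ (by positivity)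
        exact mul_le_of_le_one_left (by positivity) (pow_le_one₀ (by norm_num) (by norm_num))
      have h3 : (2 - 2 * (1 / 2 : ℝ) ^ (n + 1)) = (2 - 2 * (1 / 2) ^ n) + (1 / 2) ^ n := by
        rw [pow_succ]; ring
      rw [h3, add_mul, ← add_assoc p₀ n 1]
      linarith
  refine le_of_tendsto hlim ?_
  filter_upwards [eventually_ge_atTop p₀] with p hp
  obtain ⟨n, rfl⟩ := Nat.exists_eq_add_of_le hp
  refine (hstep n).trans (add_le_add hbase ?_)
  rw [mul_assoc]
  refine mul_le_mul_of_nonneg_right ?_ (by positivity)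
  have : (0 : ℝ) ≤ (1 / 2) ^ n := by positivity
  linarith

/-- The constant in the chaining bound for the multiscale statistic. -/
noncomputable def chainConst {d : ℕ} (ψ : (Fin d → ℝ) → ℝ) : ℝ :=
  1 + 2 ^ d * 9 + 2 * 2 ^ d / l2Norm ψ

/-- Along a controlled path the multiscale statistic is bounded. -/
theorem IsControlled.multiscaleStat_le {d : ℕ} {ψ w : (Fin d → ℝ) → ℝ} {V x : ℝ}
    (hc : IsControlled ψ w x) (hψ : IsTameKernel ψ V) (hN : 0 < l2Norm ψ)
    (hw : ContinuousOn w (Icc 0 1)) (hx : 1 ≤ x) :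
    multiscaleStat ψ w ≤ ((chainConst ψ * x : ℝ) : EReal) := by
  refine iSup₂_le fun h hh => iSup₂_le fun t ht => EReal.coe_le_coe_iff.2 ?_
  -- The dyadic scale `j i` of the side `2 * h i` of the box with center `t`.
  have hex : ∀ i, ∃ n : ℕ, (1 / 2 : ℝ) ^ (n + 1) < 2 * h i ∧ 2 * h i ≤ (1 / 2) ^ n := fun i =>
    exists_nat_pow_near_of_lt_one (by linarith [(hh i).1]) (by linarith [(hh i).2])
      (by norm_num) (by norm_num)
  choose j hj' hj using hex
  set a : Fin d → ℝ := t - h with hadef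
  set b : Fin d → ℝ := t + h with hbdef
  have hba : ∀ i, b i - a i = 2 * h i := fun i => by simp [hadef, hbdef]; ring
  have ha : ∀ i, 0 ≤ a i := fun i => by simpa [hadef] using (ht i).1
  have hb : ∀ i, b i ≤ 1 := fun i => by
    have := (ht i).2
    simp only [hbdef, Pi.add_apply]; linarith
  have hab : ∀ i, a i < b i := fun i => by linarith [hba i, (hh i).1]
  have hb0 : ∀ i, 0 ≤ b i := fun i => (ha i).trans (hab i).le
  simp_rw [← hba] at hj hj'
  have hmain := hc.pathIntegral_le hψ hw (by linarith) ha hab hb hj hj'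
  rw [scaledKernel_eq_boxKernel, ← hadef, ← hbdef]
  set s := ∑ i, j i with hs
  set p₀ := baseLevel s with hp₀
  set γ := dyadicPenalty s with hγ
  set N := l2Norm ψ with hNdef
  set H := ∏ i, h i with hH
  set Q := ∏ i, (gridHi j p₀ (gridIdx j p₀ a b) i - gridLo j p₀ (gridIdx j p₀ a b) i) / 2 with hQ
  have hHpos : 0 < H := Finset.prod_pos fun i _ => (hh i).1
  have hγ0 : 0 ≤ γ := Real.sqrt_nonneg _
  have hpen : γ ≤ penalty (2 ^ d * H) := by
    refine dyadicPenalty_le_penalty (by positivity) ?_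
    calc 2 ^ d * H = ∏ i, (2 * h i) := by simp [Finset.prod_mul_distrib, hH]
      _ ≤ ∏ i, (1 / 2) ^ j i := Finset.prod_le_prod (fun i _ => by linarith [(hh i).1])
          fun i _ => by rw [← hba]; exact hj i
      _ = (1 / 2) ^ s := Finset.prod_pow_eq_pow_sum _ _ _
  set u : ℝ := 4 * (1 / 16) ^ p₀ with hu
  have hu0 : 0 ≤ u := by positivity
  have hp₀1 : 1 ≤ p₀ := Nat.succ_le_succ (Nat.zero_le _)
  have hu1 : u ≤ 1 := by
    have : (1 / 16 : ℝ) ^ p₀ ≤ (1 / 16) ^ 1 := pow_le_pow_of_le_one (by norm_num) (by norm_num) hp₀1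
    rw [hu]; linarith
  -- The penalty grows at most like `2 ^ p₀` by the choice of the base level, whereas the relative
  -- enlargement is `4 * 16 ^ (-p₀)`. Rounding the box outwards thus costs only a constant.
  have huγ : u * γ ≤ 8 := by
    have h1 : γ ≤ 2 * 2 ^ p₀ := by
      refine (dyadicPenalty_le s).trans ?_
      have := (lt_two_pow_baseLevel s).le
      have h2 : (s + 1 : ℝ) ≤ 2 ^ p₀ := by exact_mod_cast this
      linarith
    calc u * γ ≤ 4 * (1 / 16) ^ p₀ * (2 * 2 ^ p₀) := by gcongr
      _ = 8 * (1 / 8) ^ p₀ := by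
        rw [show (1 / 8 : ℝ) = 1 / 16 * 2 by norm_num, mul_pow]; ring
      _ ≤ 8 * 1 := by gcongr; exact pow_le_one₀ (by norm_num) (by norm_num)
      _ = 8 := by norm_num
  have hQH : Q ≤ H * (1 + u) ^ d := by
    have : H * (1 + u) ^ d = ∏ i, (h i * (1 + u)) := by simp [Finset.prod_mul_distrib, hH]
    rw [this, hQ]
    refine Finset.prod_le_prod (fun i _ => ?_) fun i _ => ?_
    · linarith [gridLo_le (j := j) (b := b) p₀ ha i, le_gridHi (j := j) p₀ hab i, hab i]
    · have h1 := sub_gridLo_le (j := j) (a := a) (b := b) p₀ i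
      have h2 := gridHi_sub_le (j := j) p₀ hab hb0 i
      have h3 := hj' i
      rw [pow_succ] at h3
      have h4 := hba i
      have h5 : (0 : ℝ) ≤ (1 / 16) ^ p₀ := by positivity
      have h6 : (1 / 2 : ℝ) ^ j i * (1 / 16) ^ p₀ ≤ 4 * h i * (1 / 16) ^ p₀ := by
        gcongr; linarith
      rw [hu]
      nlinarith
  have hQH' : √Q ≤ √H * (1 + (2 ^ d - 1) * u) := by
    have h1 : (1 : ℝ) ≤ (1 + u) ^ d := one_le_pow₀ (by linarith)
    calc √Q ≤ √(H * (1 + u) ^ d) := Real.sqrt_le_sqrt hQH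
      _ = √H * √((1 + u) ^ d) := Real.sqrt_mul hHpos.le _
      _ ≤ √H * (1 + u) ^ d := by
        gcongr
        rw [Real.sqrt_le_left (by linarith)]
        nlinarith
      _ ≤ √H * (1 + (2 ^ d - 1) * u) := by gcongr; exact one_add_pow_le hu0 hu1 d
  have hSH : √((1 / 2) ^ s) ≤ √H * 2 ^ d := by
    rw [Real.sqrt_le_left (by positivity), mul_pow, Real.sq_sqrt hHpos.le]
    calc (1 / 2 : ℝ) ^ s = ∏ i, (1 / 2) ^ j i := (Finset.prod_pow_eq_pow_sum _ _ _).symm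
      _ ≤ ∏ i, (h i * 4) := Finset.prod_le_prod (fun i _ => by positivity) fun i _ => by
          have h3 := hj' i
          rw [pow_succ] at h3
          linarith [hba i]
      _ = H * (2 ^ d) ^ 2 := by
          rw [Finset.prod_mul_distrib, Finset.prod_const, Finset.card_univ, Fintype.card_fin,
            ← pow_mul, mul_comm d 2, pow_mul]
          norm_num [hH]
  have hsH : 0 < √H := Real.sqrt_pos.2 hHpos
  have h2d : (1 : ℝ) ≤ 2 ^ d := one_le_pow₀ (by norm_num)
  have hbound : pathIntegral (boxKernel ψ a b) w / (√H * N) ≤ γ + chainConst ψ * x := by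
    rw [div_le_iff₀ (by positivity)]
    calc pathIntegral (boxKernel ψ a b) w ≤ N * √Q * (γ + x) + 2 * x * √((1 / 2) ^ s) := hmain
      _ ≤ N * (√H * (1 + (2 ^ d - 1) * u)) * (γ + x) + 2 * x * (√H * 2 ^ d) := by gcongr
      _ = (√H * N) * ((1 + (2 ^ d - 1) * u) * (γ + x) + 2 * 2 ^ d / N * x) := by
        field_simp
      _ ≤ (√H * N) * (γ + chainConst ψ * x) := by
        refine mul_le_mul_of_nonneg_left ?_ (by positivity)
        rw [chainConst, ← hNdef]
        -- Together with `1 ≤ x` these two bounds, `8` and `1 * x`, account for the factor `9` in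
        -- `chainConst`.
        have e1 : (2 ^ d - 1) * (u * γ) ≤ (2 ^ d - 1) * 8 := by
          gcongr
        have e2 : (2 ^ d - 1) * (u * x) ≤ (2 ^ d - 1) * (1 * x) := by
          gcongr
        nlinarith
      _ = (γ + chainConst ψ * x) * (√H * N) := by ring
  linarith


/-! ### The union bound for the chaining events. -/

/-- Variance constant of the links of the chaining. -/
def linkConst (d : ℕ) (V : ℝ) : ℝ := 16 * d * V ^ 2 * 3 ^ d + 1

theorem linkConst_pos (d : ℕ) (V : ℝ) : 0 < linkConst d V := by unfold linkConst; positivity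

section

variable {d : ℕ} {Ω : Type*} [MeasurableSpace Ω] {P : Measure Ω} [IsProbabilityMeasure P]
  {W : (Fin d → ℝ) → Ω → ℝ} {ψ : (Fin d → ℝ) → ℝ} {V : ℝ}

theorem IsBrownianSheet.measure_base_le (hW : IsBrownianSheet W P) (hψ : IsTameKernel ψ V)
    (hN : 0 < l2Norm ψ) {a b : Fin d → ℝ} (hab : ∀ i, a i < b i) (hb : ∀ i, b i ≤ 1) {y : ℝ}
    (hy : 0 ≤ y) :
    P {ω | l2Norm ψ * √(∏ i, (b i - a i) / 2) * y ≤ pathIntegral (boxKernel ψ a b) (fun t => W t ω)}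
      ≤ ENNReal.ofReal (Real.exp (-(y ^ 2 / 2))) := by
  have hp : 0 < ∏ i, (b i - a i) / 2 := Finset.prod_pos fun i _ => by linarith [hab i]
  refine (hW.measure_ge_le (hψ.isTame_boxKernel hab hb) (hψ.integral_boxKernel_sq_le hab)
    (by positivity)).trans (le_of_eq ?_)
  congr 2
  rw [mul_pow, mul_pow, Real.sq_sqrt hp.le]
  field_simp

/-- The link has variance at most `linkConst d V * 16 ^ (-p) * 2 ^ (-s)` with `s = ∑ i, j i`,
against the squared threshold `x ^ 2 * 4 ^ (-p) * 2 ^ (-s)`. The ratio `4 ^ p` in the exponent is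
the reason for the resolution `16 ^ p`. -/
theorem IsBrownianSheet.measure_link_le (hW : IsBrownianSheet W P) (hψ : IsTameKernel ψ V)
    {j : Fin d → ℕ} {p : ℕ} {k k' : Fin d → ℕ × ℕ} (hk : IsRefinement j p k k') {x : ℝ}
    (hx : 0 ≤ x) :
    P {ω | x * (1 / 2) ^ p * √((1 / 2) ^ (∑ i, j i)) ≤
      pathIntegral (boxKernel ψ (gridLo j (p + 1) k') (gridHi j (p + 1) k')
        - boxKernel ψ (gridLo j p k) (gridHi j p k)) (fun t => W t ω)}
      ≤ ENNReal.ofReal (Real.exp (-(x ^ 2 / (2 * linkConst d V) * 4 ^ p))) := by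
  set s := ∑ i, j i
  have hK := linkConst_pos d V
  have h1 : ∀ i, gridLo j p k i < gridHi j p k i := fun i => by
    obtain ⟨h1, h2, h3, -⟩ := hk i
    linarith
  have ht := hψ.isTame_boxKernel (fun i => (hk i).1)
    (fun i => (hk i).2.2.1.trans (hk i).2.2.2.1)
  have ht' := hψ.isTame_boxKernel h1 (fun i => (hk i).2.2.2.1)
  have hc := hψ.integral_boxKernel_sub_sq_le (fun i => (hk i).1) (fun i => (hk i).2.1)
    (fun i => (hk i).2.2.1) (η := 2 * (1 / 16) ^ p) (by positivity) (fun i => (hk i).2.2.2.2.1)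
    (fun i => (hk i).2.2.2.2.2.1) (fun i => (hk i).2.2.2.1)
  have hprod : ∏ i, (gridHi j p k i - gridLo j p k i) ≤ 3 ^ d * (1 / 2) ^ s := by
    calc ∏ i, (gridHi j p k i - gridLo j p k i) ≤ ∏ i, (3 * (1 / 2) ^ j i) :=
          Finset.prod_le_prod (fun i _ => by linarith [h1 i]) fun i _ => (hk i).2.2.2.2.2.2
      _ = _ := by
          rw [Finset.prod_mul_distrib, Finset.prod_const, Finset.card_univ, Fintype.card_fin,
            Finset.prod_pow_eq_pow_sum]
  have hc' := hc.trans (show _ ≤ linkConst d V * ((1 / 16) ^ p * (1 / 2) ^ s) from ?_)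
  · refine (hW.measure_ge_le (ht.sub ht') hc' (by positivity)).trans (le_of_eq ?_)
    congr 2
    have e1 : √((1 / 2 : ℝ) ^ s) ^ 2 = (1 / 2) ^ s := Real.sq_sqrt (by positivity)
    have e2 : ((1 / 2 : ℝ) ^ p) ^ 2 = (1 / 16) ^ p * 4 ^ p := by
      rw [← pow_mul, mul_comm p 2, pow_mul, ← mul_pow]; norm_num
    rw [mul_pow, mul_pow, e1, e2]
    have e3 : (0 : ℝ) < (1 / 2) ^ s := by positivity
    have e4 : (0 : ℝ) < (1 / 16) ^ p := by positivity
    rw [neg_div, neg_inj, div_mul_eq_mul_div, div_eq_div_iff (by positivity) (by positivity)]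
    ring
  · calc 8 * d * V ^ 2 * (2 * (1 / 16) ^ p) * ∏ i, (gridHi j p k i - gridLo j p k i)
        ≤ 8 * d * V ^ 2 * (2 * (1 / 16) ^ p) * (3 ^ d * (1 / 2) ^ s) := by gcongr
      _ = (16 * d * V ^ 2 * 3 ^ d) * ((1 / 16) ^ p * (1 / 2) ^ s) := by ring
      _ ≤ _ := by
        unfold linkConst
        gcongr
        linarith

/-- A union bound over countably many events. Index pairs that are not genuine boxes or refinements
give empty events, so counting the entire grids is permitted. -/
theorem IsBrownianSheet.measure_not_isControlled_le (hW : IsBrownianSheet W P)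
    (hψ : IsTameKernel ψ V) (hN : 0 < l2Norm ψ) {x : ℝ} (hx : 0 ≤ x) :
    P {ω | ¬ IsControlled ψ (fun t => W t ω) x} ≤
      ∑' j : Fin d → ℕ, ((scaleGrid j (baseLevel (∑ i, j i))).card *
          ENNReal.ofReal (Real.exp (-((dyadicPenalty (∑ i, j i) + x) ^ 2 / 2)))
        + ∑' p, if baseLevel (∑ i, j i) ≤ p then
          ((scaleGrid j p).card * (scaleGrid j (p + 1)).card : ℝ≥0∞) *
          ENNReal.ofReal (Real.exp (-(x ^ 2 / (2 * linkConst d V) * 4 ^ p))) else 0) := by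
  classical
  let B : (Fin d → ℕ) → (Fin d → ℕ × ℕ) → Set Ω := fun j k => {ω |
    (∀ i, gridLo j (baseLevel (∑ i, j i)) k i < gridHi j (baseLevel (∑ i, j i)) k i ∧
      gridHi j (baseLevel (∑ i, j i)) k i ≤ 1) ∧
    l2Norm ψ * √(∏ i, (gridHi j (baseLevel (∑ i, j i)) k i
        - gridLo j (baseLevel (∑ i, j i)) k i) / 2) * (dyadicPenalty (∑ i, j i) + x) ≤
    pathIntegral (boxKernel ψ (gridLo j (baseLevel (∑ i, j i)) k)
      (gridHi j (baseLevel (∑ i, j i)) k)) (fun t => W t ω)}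
  let L : (Fin d → ℕ) → ℕ → (Fin d → ℕ × ℕ) → (Fin d → ℕ × ℕ) → Set Ω := fun j p k k' => {ω |
    baseLevel (∑ i, j i) ≤ p ∧ IsRefinement j p k k' ∧
    x * (1 / 2) ^ p * √((1 / 2) ^ (∑ i, j i)) ≤
      pathIntegral (boxKernel ψ (gridLo j (p + 1) k') (gridHi j (p + 1) k')
        - boxKernel ψ (gridLo j p k) (gridHi j p k)) (fun t => W t ω)}
  have hsub : {ω | ¬ IsControlled ψ (fun t => W t ω) x} ⊆
      ⋃ j, ((⋃ k ∈ scaleGrid j (baseLevel (∑ i, j i)), B j k) ∪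
        ⋃ p, ⋃ k ∈ scaleGrid j p, ⋃ k' ∈ scaleGrid j (p + 1), L j p k k') := by
    intro ω hω
    by_contra hcon
    simp only [mem_iUnion, mem_union, not_exists, not_or] at hcon
    refine hω ⟨fun j k hk hk1 => ?_, fun j p hp k hk k' hk' href => ?_⟩
    · by_contra hlt
      exact (hcon j).1 k hk ⟨hk1, not_lt.1 hlt⟩
    · by_contra hlt
      exact (hcon j).2 p k hk k' hk' ⟨hp, href, not_lt.1 hlt⟩
  refine (measure_mono hsub).trans ((measure_iUnion_le _).trans (ENNReal.tsum_le_tsum fun j => ?_))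
  refine (measure_union_le _ _).trans (add_le_add ?_ ?_)
  · refine (measure_biUnion_finset_le _ _).trans ?_
    rw [← nsmul_eq_mul]
    refine Finset.sum_le_card_nsmul _ _ _ fun k _ => ?_
    by_cases hk : ∀ i, gridLo j (baseLevel (∑ i, j i)) k i < gridHi j (baseLevel (∑ i, j i)) k i ∧
      gridHi j (baseLevel (∑ i, j i)) k i ≤ 1
    · refine (measure_mono fun ω hω => hω.2).trans
        (hW.measure_base_le hψ hN (fun i => (hk i).1) (fun i => (hk i).2) ?_)
      exact add_nonneg (Real.sqrt_nonneg _) hx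
    · have : B j k = ∅ := eq_empty_iff_forall_notMem.2 fun ω hω => hk hω.1
      simp [this]
  · refine (measure_iUnion_le _).trans (ENNReal.tsum_le_tsum fun p => ?_)
    by_cases hp : baseLevel (∑ i, j i) ≤ p
    · rw [if_pos hp]
      refine (measure_biUnion_finset_le _ _).trans ?_
      rw [mul_assoc, ← nsmul_eq_mul]
      refine Finset.sum_le_card_nsmul _ _ _ fun k _ => ?_
      refine (measure_biUnion_finset_le _ _).trans ?_
      rw [← nsmul_eq_mul]
      refine Finset.sum_le_card_nsmul _ _ _ fun k' _ => ?_
      by_cases hr : IsRefinement j p k k'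
      · exact (measure_mono fun ω hω => hω.2.2).trans (hW.measure_link_le hψ hr hx)
      · have : L j p k k' = ∅ := eq_empty_iff_forall_notMem.2 fun ω hω => hr hω.2.1
        simp [this]
    · rw [if_neg hp]
      have : ∀ k k', L j p k k' = ∅ := fun k k' =>
        eq_empty_iff_forall_notMem.2 fun ω hω => hp hω.1
      simp [this]

end

/-! ### Summation of the tails over all scales and levels. -/

theorem ENNReal.tsum_pi_prod_le {d : ℕ} (f : ℕ → ℝ≥0∞) :
    ∑' j : Fin d → ℕ, ∏ i, f (j i) ≤ (∑' n, f n) ^ d := by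
  rw [ENNReal.tsum_eq_iSup_sum]
  refine iSup_le fun F => ?_
  obtain ⟨M, hM⟩ : ∃ M : ℕ, F ⊆ Fintype.piFinset fun _ : Fin d => Finset.range M := by
    refine ⟨F.sup (fun j => ∑ i, j i) + 1, fun j hj => ?_⟩
    rw [Fintype.mem_piFinset]
    intro i
    rw [Finset.mem_range, Nat.lt_succ_iff]
    exact (Finset.single_le_sum (f := j) (fun _ _ => Nat.zero_le _) (Finset.mem_univ i)).trans
      (Finset.le_sup (f := fun j : Fin d → ℕ => ∑ i, j i) hj)
  calc ∑ j ∈ F, ∏ i, f (j i) ≤ ∑ j ∈ Fintype.piFinset fun _ : Fin d => Finset.range M, ∏ i, f (j i) :=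
        Finset.sum_le_sum_of_subset hM
    _ = ∏ _i : Fin d, ∑ n ∈ Finset.range M, f n :=
        (Finset.prod_univ_sum (fun _ => Finset.range M) (fun _ n => f n)).symm
    _ ≤ (∑' n, f n) ^ d := by
        rw [Finset.prod_const, Finset.card_univ, Fintype.card_fin]
        gcongr
        exact ENNReal.sum_le_tsum _

/-- Summable weights over the scales. -/
noncomputable def scaleWeight {d : ℕ} (j : Fin d → ℕ) : ℝ := ∏ i, (1 / ((j i : ℝ) + 1) ^ 2)

theorem scaleWeight_pos {d : ℕ} (j : Fin d → ℕ) : 0 < scaleWeight j :=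
  Finset.prod_pos fun i _ => by positivity

theorem tsum_scaleWeight_ne_top (d : ℕ) :
    ∑' j : Fin d → ℕ, ENNReal.ofReal (scaleWeight j) ≠ ⊤ := by
  have h1 : Summable fun n : ℕ => 1 / ((n : ℝ) + 1) ^ 2 := by
    have := (summable_nat_add_iff 1).2 (Real.summable_one_div_nat_pow.2 (one_lt_two))
    simpa using this
  have h2 : ∑' n : ℕ, ENNReal.ofReal (1 / ((n : ℝ) + 1) ^ 2) ≠ ⊤ := h1.tsum_ofReal_ne_top
  have h3 : ∀ j : Fin d → ℕ, ENNReal.ofReal (scaleWeight j)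
      = ∏ i, ENNReal.ofReal (1 / ((j i : ℝ) + 1) ^ 2) := fun j =>
    ENNReal.ofReal_prod_of_nonneg fun i _ => by positivity
  simp_rw [h3]
  exact ne_top_of_le_ne_top (ENNReal.pow_ne_top h2)
    (ENNReal.tsum_pi_prod_le fun n : ℕ => ENNReal.ofReal (1 / ((n : ℝ) + 1) ^ 2))

/-- The weight decays only polynomially in `∑ i, j i`, so that the base terms can pay for it; the
exponential lower bound below is the form suited to the links. -/
theorem le_scaleWeight {d : ℕ} (j : Fin d → ℕ) :
    1 / ((∑ i, j i : ℕ) + 1 : ℝ) ^ (2 * d) ≤ scaleWeight j := by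
  have : (1 / ((∑ i, j i : ℕ) + 1 : ℝ) ^ (2 * d)) = ∏ _i : Fin d, (1 / ((∑ i, j i : ℕ) + 1 : ℝ) ^ 2) := by
    rw [Finset.prod_const, Finset.card_univ, Fintype.card_fin, one_div_pow, ← pow_mul]
  rw [this]
  refine Finset.prod_le_prod (fun i _ => by positivity) fun i _ => ?_
  have h : j i ≤ ∑ i, j i := Finset.single_le_sum (f := j) (fun _ _ => Nat.zero_le _) (Finset.mem_univ i)
  gcongr

theorem exp_neg_le_scaleWeight {d : ℕ} (j : Fin d → ℕ) :
    Real.exp (-(2 * (∑ i, j i : ℕ))) ≤ scaleWeight j := by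
  have : Real.exp (-(2 * (∑ i, j i : ℕ))) = ∏ i, Real.exp (-(2 * (j i : ℝ))) := by
    rw [← Real.exp_sum]; congr 1; push_cast; rw [Finset.mul_sum, Finset.sum_neg_distrib]
  rw [this]
  refine Finset.prod_le_prod (fun i _ => (Real.exp_pos _).le) fun i _ => ?_
  rw [Real.exp_neg, ← one_div]
  refine one_div_le_one_div_of_le (by positivity) ?_
  rw [two_mul, Real.exp_add, ← sq]
  have := Real.add_one_le_exp (j i : ℝ)
  gcongr

/-- In `(γ + x) ^ 2 / 2` the term `γ ^ 2 / 2 = 1 + s * log 2` cancels the `2 ^ s` boxes, and `γ * x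
≥ γ + x - 1` leaves the factor `exp (-γ) * exp (-x)`. With `y` the square root of `s + 1` and `y ≤
γ`, the first of these absorbs every power of `s`. -/
theorem base_term_le {d : ℕ} (j : Fin d → ℕ) {x : ℝ} (hx : 1 ≤ x) :
    ((scaleGrid j (baseLevel (∑ i, j i))).card : ℝ) *
      Real.exp (-((dyadicPenalty (∑ i, j i) + x) ^ 2 / 2))
      ≤ 8 ^ d * 2 ^ (8 * d) * (20 * d).factorial * Real.exp (-x) * scaleWeight j := by
  set s := ∑ i, j i with hs
  set γ := dyadicPenalty s with hγ
  set y := √(s + 1 : ℝ) with hy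
  have hy2 : y ^ 2 = s + 1 := Real.sq_sqrt (by positivity)
  have hy1 : 1 ≤ y := by rw [hy, Real.one_le_sqrt]; linarith [Nat.cast_nonneg (α := ℝ) s]
  have hyγ : y ≤ γ := sqrt_le_dyadicPenalty s
  have hγ2 : γ ^ 2 = 2 * (1 + s * Real.log 2) := Real.sq_sqrt (by
    have := Real.log_two_gt_d9; positivity)
  have hcard : ((scaleGrid j (baseLevel s)).card : ℝ) ≤ 2 ^ s * (8 ^ d * (2 * (s + 1)) ^ (8 * d)) := by
    have h1 := card_scaleGrid_le j (baseLevel s)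
    have h2 : 256 ^ (d * baseLevel s) ≤ (2 * (s + 1)) ^ (8 * d) := by
      rw [show 256 = 2 ^ 8 by norm_num, ← pow_mul, show 8 * (d * baseLevel s) = baseLevel s * (8 * d) by ring,
        pow_mul]
      exact Nat.pow_le_pow_left (two_pow_baseLevel_le s) _
    have h3 : (scaleGrid j (baseLevel s)).card ≤ 2 ^ s * (8 ^ d * (2 * (s + 1)) ^ (8 * d)) :=
      h1.trans (by rw [← hs]; gcongr)
    exact_mod_cast h3
  have hexp : Real.exp (-((γ + x) ^ 2 / 2)) ≤ (2 ^ s)⁻¹ * (Real.exp (-y) * Real.exp (-x)) := by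
    have : ((2 : ℝ) ^ s)⁻¹ = Real.exp (-(s * Real.log 2)) := by
      rw [Real.exp_neg, mul_comm, Real.exp_mul, Real.exp_log (by norm_num), Real.rpow_natCast]
    rw [this, ← Real.exp_add, ← Real.exp_add]
    refine Real.exp_le_exp.2 ?_
    nlinarith [mul_nonneg (sub_nonneg.2 (hy1.trans hyγ)) (sub_nonneg.2 hx), sq_nonneg x]
  -- Of the `20 * d` powers of `y`, `16 * d` come from the number of boxes and `4 * d` from the
  -- weight.
  have hpoly : y ^ (20 * d) * Real.exp (-y) ≤ (20 * d).factorial := by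
    have := Real.pow_div_factorial_le_exp y (by linarith) (20 * d)
    rw [div_le_iff₀ (by positivity)] at this
    rw [Real.exp_neg, mul_inv_le_iff₀ (Real.exp_pos _)]
    exact this.trans_eq (mul_comm _ _)
  have hypos : 0 < y := by linarith
  have hw : 1 / (y ^ (4 * d)) ≤ scaleWeight j := by
    have := le_scaleWeight j
    rw [← hs, ← hy2, ← pow_mul] at this
    rwa [show 4 * d = 2 * (2 * d) by ring]
  have hx0 := Real.exp_pos (-x)
  calc ((scaleGrid j (baseLevel s)).card : ℝ) * Real.exp (-((γ + x) ^ 2 / 2))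
      ≤ (2 ^ s * (8 ^ d * (2 * (s + 1)) ^ (8 * d))) *
          ((2 ^ s)⁻¹ * (Real.exp (-y) * Real.exp (-x))) := by gcongr
    _ = 8 ^ d * 2 ^ (8 * d) * Real.exp (-x) * (y ^ (20 * d) * Real.exp (-y)) * (1 / y ^ (4 * d)) := by
        rw [← hy2, mul_pow, ← pow_mul, show 20 * d = 2 * (8 * d) + 4 * d by ring, pow_add]
        field_simp
    _ ≤ 8 ^ d * 2 ^ (8 * d) * Real.exp (-x) * ((20 * d).factorial) * scaleWeight j := by gcongr
    _ = _ := by ring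

/-- The logarithm of the number of pairs grows linearly in `s` and `p`, and `s + 1 ≤ 2 ^ p` from the
base level on; the exponent, a multiple of `4 ^ p`, dominates once `x` is large. -/
theorem link_term_le {d : ℕ} (j : Fin d → ℕ) {V x : ℝ}
    (hx : 2 * linkConst d V + (5 + 30 * d) ≤ x) {p : ℕ} (hp : baseLevel (∑ i, j i) ≤ p) :
    ((scaleGrid j p).card : ℝ) * (scaleGrid j (p + 1)).card *
      Real.exp (-(x ^ 2 / (2 * linkConst d V) * 4 ^ p))
      ≤ Real.exp (-x) * scaleWeight j * Real.exp (-p) := by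
  set s := ∑ i, j i with hs
  have hK := linkConst_pos d V
  set K := linkConst d V
  have hcard : ((scaleGrid j p).card : ℝ) * (scaleGrid j (p + 1)).card
      ≤ Real.exp (2 * s + 14 * d + 16 * d * p) := by
    have h1 : (scaleGrid j p).card * (scaleGrid j (p + 1)).card
        ≤ 2 ^ (2 * s + 14 * d + 16 * d * p) := by
      refine (Nat.mul_le_mul (card_scaleGrid_le j p) (card_scaleGrid_le j (p + 1))).trans
        (le_of_eq ?_)
      rw [← hs, show 256 = 2 ^ 8 by norm_num, show 8 = 2 ^ 3 by norm_num]
      simp only [← pow_mul, ← pow_add]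
      congr 1
      ring
    calc ((scaleGrid j p).card : ℝ) * (scaleGrid j (p + 1)).card
        ≤ 2 ^ (2 * s + 14 * d + 16 * d * p) := by exact_mod_cast h1
      _ ≤ Real.exp 1 ^ (2 * s + 14 * d + 16 * d * p) := by
          gcongr
          linarith [Real.exp_one_gt_d9]
      _ = _ := by rw [← Real.exp_nat_mul]; push_cast; ring_nf
  have h2p : (s : ℝ) + 1 ≤ 2 ^ p := by
    have h1 := (lt_two_pow_baseLevel s).le.trans (Nat.pow_le_pow_right (by norm_num) hp)
    exact_mod_cast h1
  have h4p : (2 : ℝ) ^ p ≤ 4 ^ p := by gcongr; norm_num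
  have hp4 : (p : ℝ) ≤ 4 ^ p := by
    have : p ≤ 4 ^ p := (Nat.lt_pow_self (by norm_num)).le
    exact_mod_cast this
  have h14 : (1 : ℝ) ≤ 4 ^ p := one_le_pow₀ (by norm_num)
  have hd0 : (0 : ℝ) ≤ d := Nat.cast_nonneg d
  have hs0 : (0 : ℝ) ≤ s := Nat.cast_nonneg s
  have hx0 : 0 ≤ x := by linarith
  -- The reserve `5 + 30 * d` splits as `4 + 1` for `4 * s` and `p`, and `14 * d + 16 * d` for the
  -- count; each is at most its coefficient times `4 ^ p`.
  have hxx : x + (5 + 30 * d) ≤ x ^ 2 / (2 * K) := by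
    rw [le_div_iff₀ (by positivity)]
    nlinarith [mul_nonneg hx0 (sub_nonneg.2 hx), mul_nonneg (show (0 : ℝ) ≤ 5 + 30 * d by linarith)
      (show 0 ≤ x - 2 * K by linarith)]
  have hexp : 2 * s + 14 * d + 16 * d * p + x + 2 * s + p ≤ x ^ 2 / (2 * K) * 4 ^ p := by
    have h5 : (x + (5 + 30 * d)) * 4 ^ p ≤ x ^ 2 / (2 * K) * 4 ^ p := by gcongr
    have h6 : x ≤ x * 4 ^ p := le_mul_of_one_le_right hx0 h14
    have h7 : 16 * d * p ≤ 16 * d * (4 : ℝ) ^ p := by gcongr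
    have h8 : 14 * (d : ℝ) ≤ 14 * d * 4 ^ p := le_mul_of_one_le_right (by linarith) h14
    nlinarith
  calc ((scaleGrid j p).card : ℝ) * (scaleGrid j (p + 1)).card * Real.exp (-(x ^ 2 / (2 * K) * 4 ^ p))
      ≤ Real.exp (2 * s + 14 * d + 16 * d * p) * Real.exp (-(x ^ 2 / (2 * K) * 4 ^ p)) := by gcongr
    _ ≤ Real.exp (-x) * Real.exp (-(2 * s)) * Real.exp (-p) := by
        rw [← Real.exp_add, ← Real.exp_add, ← Real.exp_add]
        exact Real.exp_le_exp.2 (by linarith)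
    _ ≤ _ := by gcongr; exact exp_neg_le_scaleWeight j

/-- The probability that a Brownian sheet is not controlled at level `x` decays exponentially,
uniformly over all Brownian sheets. -/
theorem exists_measure_not_isControlled_le (d : ℕ) (V : ℝ) :
    ∃ A x₀ : ℝ, ∀ (Ω : Type*) [MeasurableSpace Ω] (P : Measure Ω) [IsProbabilityMeasure P]
      (W : (Fin d → ℝ) → Ω → ℝ), IsBrownianSheet W P → ∀ ψ : (Fin d → ℝ) → ℝ, IsTameKernel ψ V →
      0 < l2Norm ψ → ∀ x, x₀ ≤ x →
      P {ω | ¬ IsControlled ψ (fun t => W t ω) x} ≤ ENNReal.ofReal (A * Real.exp (-x)) := by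
  set A₁ : ℝ := 8 ^ d * 2 ^ (8 * d) * (20 * d).factorial with hA₁
  have hE : ∑' p : ℕ, ENNReal.ofReal (Real.exp (-p)) ≠ ⊤ :=
    Real.summable_exp_neg_nat.tsum_ofReal_ne_top
  set E := ∑' p : ℕ, ENNReal.ofReal (Real.exp (-p)) with hEdef
  have hS := tsum_scaleWeight_ne_top d
  set S := ∑' j : Fin d → ℕ, ENNReal.ofReal (scaleWeight j) with hSdef
  have hC : (ENNReal.ofReal A₁ + E) * S ≠ ⊤ :=
    ENNReal.mul_ne_top (ENNReal.add_ne_top.2 ⟨ENNReal.ofReal_ne_top, hE⟩) hS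
  refine ⟨((ENNReal.ofReal A₁ + E) * S).toReal, 2 * linkConst d V + (5 + 30 * d), ?_⟩
  intro Ω _ P _ W hW ψ hψ hN x hx
  have hK := linkConst_pos d V
  have hd0 : (0 : ℝ) ≤ d := Nat.cast_nonneg d
  have hx1 : 1 ≤ x := by linarith
  refine (hW.measure_not_isControlled_le hψ hN (by linarith)).trans ?_
  rw [ENNReal.ofReal_mul ENNReal.toReal_nonneg, ENNReal.ofReal_toReal hC, mul_assoc, mul_comm S,
    ← mul_assoc, hSdef, ← ENNReal.tsum_mul_left]
  refine ENNReal.tsum_le_tsum fun j => ?_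
  rw [add_mul, add_mul]
  refine add_le_add ?_ ?_
  · have h1 := ENNReal.ofReal_le_ofReal (base_term_le j hx1)
    rw [ENNReal.ofReal_mul (by positivity), ENNReal.ofReal_natCast] at h1
    refine h1.trans (le_of_eq ?_)
    rw [← ENNReal.ofReal_mul (by positivity), ← ENNReal.ofReal_mul (by positivity)]
  · rw [hEdef, ← ENNReal.tsum_mul_right, ← ENNReal.tsum_mul_right]
    refine ENNReal.tsum_le_tsum fun p => ?_
    split_ifs with hp
    · have h1 := ENNReal.ofReal_le_ofReal (link_term_le j hx hp)
      rw [ENNReal.ofReal_mul (by positivity), ENNReal.ofReal_mul (by positivity),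
        ENNReal.ofReal_natCast, ENNReal.ofReal_natCast] at h1
      refine h1.trans (le_of_eq ?_)
      have := scaleWeight_pos j
      rw [← ENNReal.ofReal_mul (by positivity), ← ENNReal.ofReal_mul (by positivity)]
      congr 1
      ring
    · exact zero_le


/-! ### Integrability and boundedness of functions in the shape classes. -/

/-- Composition with the projection onto the cube is monotone on the whole space. Its superlevel
sets are upper sets, which are Lebesgue measurable though perhaps not Borel, so measurability holds
almost everywhere only. -/
theorem aestronglyMeasurable_of_monotoneOn_unitCube {d : ℕ} {f : (Fin d → ℝ) → ℝ}
    (hf : MonotoneOn f (Icc 0 1)) :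
    AEStronglyMeasurable f ((volume : Measure (Fin d → ℝ)).restrict (Icc 0 1)) := by
  have hmono : Monotone (f ∘ cubeClamp) := fun x y hxy =>
    hf (cubeClamp_mem x) (cubeClamp_mem y) (monotone_cubeClamp hxy)
  have hnull : NullMeasurable (f ∘ cubeClamp) (volume : Measure (Fin d → ℝ)) := by
    refine @measurable_of_Ioi ℝ (NullMeasurableSpace (Fin d → ℝ) volume) _ _ _ _ _ _ _ _ fun c => ?_
    have hup : IsUpperSet ((f ∘ cubeClamp) ⁻¹' Ioi c) := fun x y hxy hx =>
      lt_of_lt_of_le hx (hmono hxy)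
    exact hup.ordConnected.nullMeasurableSet
  refine (hnull.aemeasurable.restrict (s := Icc 0 1)).aestronglyMeasurable.congr ?_
  filter_upwards [ae_restrict_mem measurableSet_Icc] with x hx
  rw [Function.comp_apply, cubeClamp_of_mem hx]

theorem exists_bound_of_monotoneOn_unitCube {d : ℕ} {f : (Fin d → ℝ) → ℝ}
    (hf : MonotoneOn f (Icc 0 1)) : ∃ C, ∀ x ∈ Icc (0 : Fin d → ℝ) 1, |f x| ≤ C := by
  have h0 : (0 : Fin d → ℝ) ∈ Icc (0 : Fin d → ℝ) 1 := ⟨le_rfl, zero_le_one⟩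
  have h1 : (1 : Fin d → ℝ) ∈ Icc (0 : Fin d → ℝ) 1 := ⟨zero_le_one, le_rfl⟩
  refine ⟨max |f 0| |f 1|, fun x hx => ?_⟩
  exact abs_le_max_abs_abs (hf h0 hx hx.1) (hf hx h1 hx.2)

/-- A convex function is continuous in the interior, and the faces are null. -/
theorem aestronglyMeasurable_of_convexOn_unitCube {d : ℕ} {f : (Fin d → ℝ) → ℝ}
    (hf : ConvexOn ℝ (Icc 0 1) f) :
    AEStronglyMeasurable f ((volume : Measure (Fin d → ℝ)).restrict (Icc 0 1)) := by
  have hopen : IsOpen (univ.pi fun i : Fin d => Ioo ((0 : Fin d → ℝ) i) ((1 : Fin d → ℝ) i)) :=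
    isOpen_set_pi finite_univ fun i _ => isOpen_Ioo
  have hsub : (univ.pi fun i : Fin d => Ioo ((0 : Fin d → ℝ) i) ((1 : Fin d → ℝ) i))
      ⊆ interior (Icc (0 : Fin d → ℝ) 1) := by
    refine interior_maximal ?_ hopen
    rw [← pi_univ_Icc]
    exact pi_mono fun i _ => Ioo_subset_Icc_self
  have hae : (univ.pi fun i : Fin d => Ioo ((0 : Fin d → ℝ) i) ((1 : Fin d → ℝ) i))
      =ᵐ[volume] Icc (0 : Fin d → ℝ) 1 := by
    rw [volume_pi]
    exact Measure.univ_pi_Ioo_ae_eq_Icc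
  rw [← Measure.restrict_congr_set hae]
  exact (hf.continuousOn_interior.mono hsub).aestronglyMeasurable hopen.measurableSet

/-- The maximum over the vertices bounds `f` from above. Convexity at the center, the midpoint of
`x` and `1 - x`, then bounds it from below by `2 * f c - M`. -/
theorem exists_bound_of_convexOn_unitCube {d : ℕ} {f : (Fin d → ℝ) → ℝ}
    (hf : ConvexOn ℝ (Icc 0 1) f) : ∃ C, ∀ x ∈ Icc (0 : Fin d → ℝ) 1, |f x| ≤ C := by
  classical
  let t : Finset (Fin d → ℝ) := Fintype.piFinset fun _ => {0, 1}
  have ht : (t : Set (Fin d → ℝ)) = univ.pi fun _ => {0, 1} := by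
    ext x; simp [t, Set.mem_pi]
  have hhull : convexHull ℝ (t : Set (Fin d → ℝ)) = Icc 0 1 := by
    rw [ht, convexHull_pi, ← pi_univ_Icc]
    congr 1
    funext i
    rw [convexHull_pair, segment_eq_Icc zero_le_one]
    rfl
  obtain ⟨M, hM⟩ : ∃ M, ∀ x ∈ Icc (0 : Fin d → ℝ) 1, f x ≤ M := by
    have hne : t.Nonempty := ⟨0, by simp [t]⟩
    refine ⟨t.sup' hne f, fun x hx => ?_⟩
    refine hf.le_sup_of_mem_convexHull (hhull ▸ subset_convexHull ℝ _) (hhull.symm ▸ hx)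
  let c : Fin d → ℝ := fun _ => 1 / 2
  refine ⟨max |M| |2 * f c - M|, fun x hx => ?_⟩
  refine abs_le_max_abs_abs ?_ (hM x hx) |>.trans_eq (max_comm _ _)
  have hx' : (1 - x) ∈ Icc (0 : Fin d → ℝ) 1 := ⟨sub_nonneg.2 hx.2, sub_le_self _ hx.1⟩
  have h1 := hf.2 hx hx' (show (0 : ℝ) ≤ 1 / 2 by norm_num) (show (0 : ℝ) ≤ 1 / 2 by norm_num)
    (by norm_num)
  have h2 : (1 / 2 : ℝ) • x + (1 / 2 : ℝ) • (1 - x) = c := by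
    funext i; simp [c]; ring
  rw [h2, smul_eq_mul, smul_eq_mul] at h1
  linarith [hM _ hx']

theorem ShapeClass.integrableOn {d j : ℕ} {f : (Fin d → ℝ) → ℝ} (hf : f ∈ ShapeClass d j) :
    IntegrableOn f (Icc 0 1) ∧ ∃ C, ∀ x ∈ Icc (0 : Fin d → ℝ) 1, |f x| ≤ C := by
  have h : AEStronglyMeasurable f ((volume : Measure (Fin d → ℝ)).restrict (Icc 0 1)) ∧
      ∃ C, ∀ x ∈ Icc (0 : Fin d → ℝ) 1, |f x| ≤ C := by
    rcases hf with ⟨-, hf⟩ | ⟨-, hf⟩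
    · exact ⟨aestronglyMeasurable_of_monotoneOn_unitCube hf, exists_bound_of_monotoneOn_unitCube hf⟩
    · exact ⟨aestronglyMeasurable_of_convexOn_unitCube hf, exists_bound_of_convexOn_unitCube hf⟩
  obtain ⟨hm, C, hC⟩ := h
  refine ⟨⟨hm, HasFiniteIntegral.of_bounded (C := C) ?_⟩, C, hC⟩
  filter_upwards [ae_restrict_mem measurableSet_Icc] with x hx
  exact hC x hx

/-! ### Decomposition of the estimator and consequences of the bias condition. -/

theorem IsKernel.exists_isTameKernel {d : ℕ} (hd : 1 ≤ d) {ψ : (Fin d → ℝ) → ℝ} (h : IsKernel ψ) :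
    ∃ V, IsTameKernel ψ V := by
  obtain ⟨V, hV⟩ := h.exists_isTame hd
  exact ⟨V, hV, h.support⟩

theorem IsKernel.l2Norm_pos {d : ℕ} {ψ : (Fin d → ℝ) → ℝ} (h : IsKernel ψ) : 0 < l2Norm ψ := by
  refine Real.sqrt_pos.2 (lt_of_le_of_ne (integral_nonneg fun _ => sq_nonneg _) fun h0 => ?_)
  have h1 := (integral_eq_zero_iff_of_nonneg (fun x => sq_nonneg (ψ x)) h.memLp.integrable_sq).1 h0.symm
  have h2 : ψ =ᵐ[volume] fun _ => 0 := by
    filter_upwards [h1] with x hx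
    simpa using hx
  have h3 := h.integral_pos
  rw [integral_congr_ae h2] at h3
  simp at h3

theorem l2Norm_neg {d : ℕ} (ψ : (Fin d → ℝ) → ℝ) : l2Norm (-ψ) = l2Norm ψ := by
  simp [l2Norm]

section Estimator

variable {d : ℕ} {ψ : (Fin d → ℝ) → ℝ} {V : ℝ} {t h : Fin d → ℝ}

theorem IsTameKernel.isTame_scaledKernel (hψ : IsTameKernel ψ V) (hh : h ∈ bandwidths d)
    (ht : t ∈ centers h) : IsTame (scaledKernel ψ t h) V :=
  hψ.toIsTame.scaled (fun i => (hh i).1) fun i => by linarith [(ht i).2]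

theorem IsTameKernel.scaledKernel_eq_zero (hψ : IsTameKernel ψ V) (hh : h ∈ bandwidths d)
    {x : Fin d → ℝ} (hx : x ∉ Icc (t - h) (t + h)) : scaledKernel ψ t h x = 0 := by
  rw [scaledKernel_eq_boxKernel]
  exact hψ.boxKernel_eq_zero (fun i => by
    have := (hh i).1
    simp only [Pi.sub_apply, Pi.add_apply]; linarith) hx

theorem Icc_subset_unitCube (ht : t ∈ centers h) : Icc (t - h) (t + h) ⊆ Icc (0 : Fin d → ℝ) 1 := by
  refine Icc_subset_Icc (fun i => ?_) fun i => ?_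
  · simpa using (ht i).1
  · have := (ht i).2
    simp only [Pi.add_apply, Pi.one_apply]; linarith

theorem IsTameKernel.integral_scaledKernel (hψ : IsTameKernel ψ V) (hh : h ∈ bandwidths d)
    (ht : t ∈ centers h) :
    ∫ x in Icc 0 1, scaledKernel ψ t h x = (∏ i, h i) * ∫ x, ψ x := by
  rw [← integral_standardize t (fun i => (hh i).1) hψ.measurable]
  refine setIntegral_eq_integral_of_forall_compl_eq_zero fun x hx => ?_
  exact hψ.scaledKernel_eq_zero hh fun hx' => hx (Icc_subset_unitCube ht hx')

variable {f w : (Fin d → ℝ) → ℝ} {n C : ℝ}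

/-- The kernel estimator splits into its mean and a centered noise term. -/
theorem IsTameKernel.kernelEstimator_eq (hψ : IsTameKernel ψ V) (hh : h ∈ bandwidths d)
    (ht : t ∈ centers h) (hn : 0 < n) (hw : ContinuousOn w (Icc 0 1)) (hf : IntegrableOn f (Icc 0 1))
    (hC : ∀ x ∈ Icc (0 : Fin d → ℝ) 1, |f x| ≤ C) :
    kernelEstimator ψ n (fun s => √n * (∫ x in Icc 0 s, f x) + w s) h t
      = (∫ x in Icc 0 1, scaledKernel ψ t h x * f x) / ((∏ i, h i) * ∫ x, ψ x)
        + pathIntegral (scaledKernel ψ t h) w / (√n * (∏ i, h i) * ∫ x, ψ x) := by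
  rw [kernelEstimator, (hψ.isTame_scaledKernel hh ht).tendsto_rsSum_signal hw hf hC]
  have : √n ≠ 0 := (Real.sqrt_pos.2 hn).ne'
  rw [mul_add, one_div_mul_eq_div, one_div_mul_eq_div, mul_assoc, mul_div_mul_left _ _ this]

/-- Since the noise is centered, the bias condition becomes a deterministic statement about kernel
averages. -/
theorem IsTameKernel.integral_kernelEstimator {Ω : Type*} [MeasurableSpace Ω] {P : Measure Ω}
    [IsProbabilityMeasure P] {W : (Fin d → ℝ) → Ω → ℝ} (hW : IsBrownianSheet W P)
    (hψ : IsTameKernel ψ V) (hh : h ∈ bandwidths d)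
    (ht : t ∈ centers h) (hn : 0 < n) (hf : IntegrableOn f (Icc 0 1))
    (hC : ∀ x ∈ Icc (0 : Fin d → ℝ) 1, |f x| ≤ C) :
    ∫ ω, kernelEstimator ψ n (observed n f W ω) h t ∂P
      = (∫ x in Icc 0 1, scaledKernel ψ t h x * f x) / ((∏ i, h i) * ∫ x, ψ x) := by
  have hT := hψ.isTame_scaledKernel hh ht
  have h1 : (fun ω => kernelEstimator ψ n (observed n f W ω) h t) =ᵐ[P] fun ω =>
      (∫ x in Icc 0 1, scaledKernel ψ t h x * f x) / ((∏ i, h i) * ∫ x, ψ x)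
        + pathIntegral (scaledKernel ψ t h) (fun s => W s ω) / (√n * (∏ i, h i) * ∫ x, ψ x) := by
    filter_upwards [hW.continuous] with ω hω
    exact hψ.kernelEstimator_eq hh ht hn hω hf hC
  rw [integral_congr_ae h1, integral_add (integrable_const _)
    ((hW.integrable_pathIntegral hT).div_const _), integral_const,
    integral_div, hW.integral_pathIntegral hT]
  simp

theorem convexOn_coordinate (a : ℝ) (i : Fin d) :
    ConvexOn ℝ (Icc (0 : Fin d → ℝ) 1) (fun x => a * x i) := by
  refine ⟨convex_Icc _ _, fun x _ y _ u v _ _ _ => le_of_eq ?_⟩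
  simp only [Pi.add_apply, Pi.smul_apply, smul_eq_mul]
  ring

/-- Kernels satisfying the two-sided bias condition for convex functions reproduce linear
functions. -/
theorem TwoSidedBias.integral_scaledKernel_coordinate {Ω : Type*} [MeasurableSpace Ω]
    {P : Measure Ω} [IsProbabilityMeasure P] {W : (Fin d → ℝ) → Ω → ℝ} (hW : IsBrownianSheet W P)
    {ψl ψu : (Fin d → ℝ) → ℝ} {Vl Vu : ℝ} (hl : IsTameKernel ψl Vl) (hu : IsTameKernel ψu Vu)
    (hlpos : 0 < ∫ x, ψl x) (hupos : 0 < ∫ x, ψu x) (hn : 0 < n)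
    (hbias : TwoSidedBias P W n (ShapeClass d 2) ψl ψu) (hh : h ∈ bandwidths d)
    (ht : t ∈ centers h) (i : Fin d) :
    ∫ x in Icc 0 1, scaledKernel ψl t h x * x i = t i * ((∏ i, h i) * ∫ x, ψl x) ∧
    ∫ x in Icc 0 1, scaledKernel ψu t h x * x i = t i * ((∏ i, h i) * ∫ x, ψu x) := by
  have hmem : ∀ a : ℝ, (fun x : Fin d → ℝ => a * x i) ∈ ShapeClass d 2 := fun a =>
    Or.inr ⟨rfl, convexOn_coordinate a i⟩
  have hH : 0 < ∏ i, h i := Finset.prod_pos fun i _ => (hh i).1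
  have key : ∀ a : ℝ,
      (a * ∫ x in Icc 0 1, scaledKernel ψl t h x * x i) / ((∏ i, h i) * ∫ x, ψl x) ≤ a * t i ∧
      a * t i ≤ (a * ∫ x in Icc 0 1, scaledKernel ψu t h x * x i) / ((∏ i, h i) * ∫ x, ψu x) := by
    intro a
    obtain ⟨hint, C, hC⟩ := ShapeClass.integrableOn (hmem a)
    have h1 := hbias _ (hmem a) h hh t ht
    rw [hl.integral_kernelEstimator hW hh ht hn hint hC,
      hu.integral_kernelEstimator hW hh ht hn hint hC] at h1
    simpa only [mul_left_comm _ a, integral_const_mul] using h1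
  have hpl : 0 < (∏ i, h i) * ∫ x, ψl x := mul_pos hH hlpos
  have hpu : 0 < (∏ i, h i) * ∫ x, ψu x := mul_pos hH hupos
  -- A linear function and its negative are both convex, so the two one-sided inequalities become
  -- equalities.
  have k1 := key 1
  have k2 := key (-1)
  rw [div_le_iff₀ hpl, le_div_iff₀ hpu] at k1 k2
  constructor <;> linarith [k1.1, k1.2, k2.1, k2.2]

end Estimator


/-! ### Taylor approximation under local Hölder smoothness. -/

section Taylor

variable {d : ℕ} {β L ε r : ℝ} {f : (Fin d → ℝ) → ℝ} {t x : Fin d → ℝ}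

theorem euclNorm_le (hr : 0 ≤ r) (hx : ∀ i, |x i| ≤ r) : euclNorm x ≤ d * r := by
  refine Real.sqrt_le_iff.2 ⟨by positivity, ?_⟩
  calc ∑ i, x i ^ 2 ≤ ∑ _i : Fin d, r ^ 2 :=
        Finset.sum_le_sum fun i _ => sq_le_sq' (abs_le.1 (hx i)).1 (abs_le.1 (hx i)).2
    _ = d * r ^ 2 := by simp
    _ ≤ (d : ℝ) ^ 2 * r ^ 2 := by
        gcongr
        exact_mod_cast Nat.le_self_pow two_ne_zero d
    _ = (d * r) ^ 2 := by ring

theorem mem_supBox_self (hε : 0 ≤ ε) : t ∈ supBox t ε := fun i => by simpa using hε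

theorem supBox_mono (hr : r ≤ ε) : supBox t r ⊆ supBox t ε := fun _ hx i => (hx i).trans hr

theorem mul_euclNorm_rpow_le (hL : 0 ≤ L) (hβ : 0 ≤ β) (hr : 0 ≤ r) (hx : x ∈ supBox t r) :
    L * euclNorm (x - t) ^ β ≤ L * (d * r) ^ β := by
  gcongr
  · exact Real.sqrt_nonneg _
  · exact euclNorm_le hr fun i => by simpa [abs_sub_comm] using hx i

/-- One-variable increments of a Hölder smooth function along a coordinate axis. -/
theorem IsHolderOn.abs_update_sub_le (hf : IsHolderOn β L (supBox t ε) f) (hβ : 1 < β)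
    (hL : 0 ≤ L) (hr : 0 ≤ r) (hrε : r ≤ ε) (hx : x ∈ supBox t r) (a : Fin d) {u : ℝ}
    (hu : |t a - u| ≤ r) :
    |f (Function.update x a u) - f (Function.update x a (t a))
      - partialWithin (supBox t ε) a f t * (u - t a)| ≤ L * (d * r) ^ (β - 1) * r := by
  rw [IsHolderOn, if_neg (not_le.2 hβ)] at hf
  obtain ⟨hdiff, -, hinc⟩ := hf
  set G := partialWithin (supBox t ε) a f t
  set s := Icc (t a - r) (t a + r)
  have hmem : ∀ v ∈ s, Function.update x a v ∈ supBox t r := by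
    intro v hv i
    by_cases hi : i = a
    · subst hi
      rw [Function.update_self, abs_le]
      constructor <;> linarith [hv.1, hv.2]
    · rw [Function.update_of_ne hi]; exact hx i
  -- After subtraction of the linear part the derivative is an increment of a partial derivative,
  -- small by the Hölder condition; the mean value inequality concludes.
  have hder : ∀ v ∈ s, HasDerivWithinAt
      (fun v => f (Function.update x a v) - f (Function.update x a (t a)) - G * (v - t a))
      (partialWithin (supBox t ε) a f (Function.update x a v) - G) s v := by
    intro v hv
    have h1 := (hdiff a _ (supBox_mono hrε (hmem v hv))).hasDerivWithinAt
    have h2 : HasDerivWithinAt (fun v => f (Function.update x a v))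
        (partialWithin (supBox t ε) a f (Function.update x a v)) s v := by
      simp only [partialWithin, axisSlice, Function.update_idem, Function.update_self] at h1 ⊢
      exact h1.mono fun v' hv' => supBox_mono hrε (hmem v' hv')
    have h3 : HasDerivWithinAt (fun v => G * (v - t a)) G s v := by
      simpa using ((hasDerivWithinAt_id v s).sub_const (t a)).const_mul G
    exact (h2.sub_const _).sub h3
  have hbound : ∀ v ∈ s, ‖partialWithin (supBox t ε) a f (Function.update x a v) - G‖
      ≤ L * (d * r) ^ (β - 1) := by
    intro v hv
    refine le_trans ?_ ((hinc _ (supBox_mono hrε (hmem v hv)) t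
      (mem_supBox_self (hr.trans hrε))).trans
      (mul_euclNorm_rpow_le hL (by linarith) hr (hmem v hv)))
    exact Finset.single_le_sum (f := fun i => |partialWithin (supBox t ε) i f
      (Function.update x a v) - partialWithin (supBox t ε) i f t|) (fun i _ => abs_nonneg _)
      (Finset.mem_univ a)
  have hta : t a ∈ s := ⟨by linarith, by linarith⟩
  have hus : u ∈ s := ⟨by linarith [(abs_le.1 hu).2], by linarith [(abs_le.1 hu).1]⟩
  have h := (convex_Icc _ _).norm_image_sub_le_of_norm_hasDerivWithin_le hder hbound hta hus
  simp only [sub_self, mul_zero, sub_zero, Real.norm_eq_abs] at h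
  refine h.trans (mul_le_mul_of_nonneg_left ?_ (by positivity))
  rwa [abs_sub_comm]

/-- Taylor approximation of order less than `β` of a Hölder smooth function. -/
theorem IsHolderOn.exists_linear_approx (hd : 1 ≤ d) (hf : IsHolderOn β L (supBox t ε) f)
    (hβ : 0 < β) (hL : 0 ≤ L) (hr : 0 < r) (hrε : r ≤ ε) :
    ∃ G : Fin d → ℝ, (β ≤ 1 → G = 0) ∧
      ∀ x ∈ supBox t r, |f x - f t - ∑ i, G i * (x i - t i)| ≤ L * (d * r) ^ β := by
  by_cases h1 : β ≤ 1
  · refine ⟨0, fun _ => rfl, fun x hx => ?_⟩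
    rw [IsHolderOn, if_pos h1] at hf
    simpa using (hf.2 x (supBox_mono hrε hx) t (mem_supBox_self (hr.le.trans hrε))).trans
      (mul_euclNorm_rpow_le hL hβ.le hr.le hx)
  refine ⟨fun i => partialWithin (supBox t ε) i f t, fun h => absurd h h1, fun x hx => ?_⟩
  set G : Fin d → ℝ := fun i => partialWithin (supBox t ε) i f t
  -- The point is moved from `t` to `x` one coordinate at a time; all intermediate points stay in
  -- the box, and only partial derivatives are needed.
  have key : ∀ s : Finset (Fin d),
      |f (fun i => if i ∈ s then x i else t i) - f t - ∑ i ∈ s, G i * (x i - t i)|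
        ≤ s.card * (L * (d * r) ^ (β - 1) * r) := by
    intro s
    induction s using Finset.induction_on with
    | empty => simp
    | insert a s ha ih =>
      set y : Fin d → ℝ := fun i => if i ∈ s then x i else t i with hy
      have hyr : y ∈ supBox t r := by
        intro i
        by_cases hi : i ∈ s
        · simpa [hy, hi] using hx i
        · simpa [hy, hi] using hr.le
      have e1 : (fun i => if i ∈ insert a s then x i else t i) = Function.update y a (x a) := by
        funext i
        by_cases hi : i = a
        · subst hi; simp
        · simp [hi, hy]
      have e2 : Function.update y a (t a) = y := by
        rw [Function.update_eq_self_iff]; simp [hy, ha]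
      have h2 := hf.abs_update_sub_le (not_le.1 h1) hL hr.le hrε hyr a (hx a)
      rw [e2] at h2
      rw [e1, Finset.sum_insert ha, Finset.card_insert_of_notMem ha]
      push_cast
      calc _ = |(f (Function.update y a (x a)) - f y - G a * (x a - t a))
            + (f y - f t - ∑ i ∈ s, G i * (x i - t i))| := by congr 1; ring
        _ ≤ _ := (abs_add_le _ _).trans (by linarith)
  have h2 := key Finset.univ
  simp only [Finset.mem_univ, if_true, Finset.card_univ, Fintype.card_fin] at h2
  refine h2.trans_eq ?_
  have hdr : (0 : ℝ) < d * r := by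
    have : (0 : ℝ) < d := by exact_mod_cast hd
    positivity
  rw [Real.rpow_sub_one hdr.ne']
  field_simp

end Taylor

/-! ### The bias of kernel averages. -/

section Bias

variable {d : ℕ} {ψ : (Fin d → ℝ) → ℝ} {V B : ℝ} {t h : Fin d → ℝ} {f : (Fin d → ℝ) → ℝ}

/-- Bias of a kernel average of a function that is close to an affine function whose linear part the
kernel reproduces. -/
theorem IsTameKernel.abs_average_sub_le (hψ : IsTameKernel ψ V) (hpos : 0 < ∫ x, ψ x)
    (hh : h ∈ bandwidths d) (ht : t ∈ centers h) (hf : IntegrableOn f (Icc 0 1))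
    (G : Fin d → ℝ) (hG : ∀ i, G i = 0 ∨
      ∫ x in Icc 0 1, scaledKernel ψ t h x * x i = t i * ((∏ i, h i) * ∫ x, ψ x))
    (hfB : ∀ x ∈ Icc (t - h) (t + h), |f x - f t - ∑ i, G i * (x i - t i)| ≤ B) :
    |(∫ x in Icc 0 1, scaledKernel ψ t h x * f x) / ((∏ i, h i) * ∫ x, ψ x) - f t|
      ≤ V * 2 ^ d * B / ∫ x, ψ x := by
  have hH : 0 < ∏ i, h i := Finset.prod_pos fun i _ => (hh i).1
  have hT := hψ.isTame_scaledKernel hh ht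
  have hVnn : 0 ≤ V := hT.nonneg
  set c := ∫ x, ψ x
  have hxi : ∀ i, IntegrableOn (fun x : Fin d → ℝ => x i) (Icc 0 1) := fun i =>
    (continuous_apply i).continuousOn.integrableOn_compact isCompact_Icc
  have hone : IntegrableOn (fun _ : Fin d → ℝ => (1 : ℝ)) (Icc 0 1) :=
    continuousOn_const.integrableOn_compact isCompact_Icc
  have i1 := hT.integrableOn_mul hf
  have i2 : IntegrableOn (scaledKernel ψ t h) (Icc 0 1) := by
    simpa using hT.integrableOn_mul hone
  have i3 : ∀ i, IntegrableOn (fun x => scaledKernel ψ t h x * x i) (Icc 0 1) := fun i =>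
    hT.integrableOn_mul (hxi i)
  -- Constants are averaged exactly, and each coordinate either is reproduced or has coefficient
  -- zero; only the Taylor remainder contributes to the bias.
  have hint : ∫ x in Icc 0 1, scaledKernel ψ t h x * (f x - f t - ∑ i, G i * (x i - t i))
      = (∫ x in Icc 0 1, scaledKernel ψ t h x * f x) - f t * ((∏ i, h i) * c) := by
    have e : ∀ x, scaledKernel ψ t h x * (f x - f t - ∑ i, G i * (x i - t i))
        = scaledKernel ψ t h x * f x - f t * scaledKernel ψ t h x
          - ∑ i, G i * (scaledKernel ψ t h x * x i - t i * scaledKernel ψ t h x) := by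
      intro x
      rw [mul_sub, mul_sub, Finset.mul_sum, mul_comm (f t)]
      congr 1
      exact Finset.sum_congr rfl fun i _ => by ring
    simp_rw [e]
    have i4 : ∀ i, IntegrableOn (fun x => G i * (scaledKernel ψ t h x * x i
        - t i * scaledKernel ψ t h x)) (Icc 0 1) := fun i =>
      ((i3 i).sub (i2.const_mul (t i))).const_mul (G i)
    have i5 : IntegrableOn (fun x => scaledKernel ψ t h x * f x - f t * scaledKernel ψ t h x)
        (Icc 0 1) := i1.sub (i2.const_mul _)
    rw [integral_sub i5 (integrable_finsetSum _ fun i _ => i4 i),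
      integral_sub i1 (i2.const_mul _), integral_const_mul, hψ.integral_scaledKernel hh ht,
      integral_finsetSum _ fun i _ => i4 i, Finset.sum_eq_zero, sub_zero]
    intro i _
    rw [integral_const_mul]
    rcases hG i with h0 | h0
    · rw [h0, zero_mul]
    · rw [integral_sub (i3 i) (i2.const_mul _), h0, integral_const_mul,
        hψ.integral_scaledKernel hh ht, sub_self, mul_zero]
  have hle : t - h ≤ t + h := fun i => by
    have := (hh i).1
    simp only [Pi.sub_apply, Pi.add_apply]; linarith
  have hbd : |(∫ x in Icc 0 1, scaledKernel ψ t h x * f x) - f t * ((∏ i, h i) * c)|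
      ≤ V * B * (2 ^ d * ∏ i, h i) := by
    rw [← hint, setIntegral_eq_of_subset_of_forall_sdiff_eq_zero measurableSet_Icc
      (Icc_subset_unitCube ht) fun x hx => by rw [hψ.scaledKernel_eq_zero hh hx.2, zero_mul],
      ← Real.norm_eq_abs]
    refine (norm_setIntegral_le_of_norm_le_const isCompact_Icc.measure_lt_top (C := V * B)
      fun x hx => ?_).trans_eq ?_
    · rw [norm_mul]
      exact mul_le_mul (hT.abs_apply_le x) (hfB x hx) (norm_nonneg _) hVnn
    · rw [measureReal_def, Real.volume_Icc_pi_toReal hle]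
      congr 1
      have e : ∀ i, (t + h) i - (t - h) i = 2 * h i := fun i => by
        simp only [Pi.sub_apply, Pi.add_apply]; ring
      simp_rw [e, Finset.prod_mul_distrib]
      simp
  have hHc : 0 < (∏ i, h i) * c := mul_pos hH hpos
  rw [div_sub' hHc.ne', abs_div, abs_of_pos hHc, div_le_div_iff₀ hHc hpos,
    mul_comm ((∏ i, h i) * c) (f t)]
  calc _ ≤ V * B * (2 ^ d * ∏ i, h i) * c := by gcongr
    _ = _ := by ring

end Bias


/-! ### Confidence limits at one bandwidth. -/

section Band

variable {d : ℕ} {ψ w f : (Fin d → ℝ) → ℝ} {t h : Fin d → ℝ} {V T n κ C : ℝ}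

theorem pathIntegral_le_of_multiscaleStat_le (hN : 0 < l2Norm ψ) (hh : h ∈ bandwidths d)
    (ht : t ∈ centers h) (hT : multiscaleStat ψ w ≤ (T : EReal)) :
    pathIntegral (scaledKernel ψ t h) w
      ≤ (T + penalty (2 ^ d * ∏ i, h i)) * (√(∏ i, h i) * l2Norm ψ) := by
  have hH : 0 < ∏ i, h i := Finset.prod_pos fun i _ => (hh i).1
  have h1 := (le_iSup₂_of_le h hh (le_iSup₂_of_le t ht le_rfl)).trans hT
  rw [EReal.coe_le_coe_iff, sub_le_iff_le_add] at h1
  exact (div_le_iff₀ (mul_pos (Real.sqrt_pos.2 hH) hN)).1 h1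

theorem noise_div_le {H c N x y : ℝ} (hH : 0 < H) (hc : 0 < c) (hn : 0 < n)
    (hx : x ≤ y * (√H * N)) : x / (√n * H * c) ≤ N / c * y / √(n * H) := by
  have h1 : 0 < √n := Real.sqrt_pos.2 hn
  have h2 : 0 < √H := Real.sqrt_pos.2 hH
  rw [Real.sqrt_mul hn.le, div_le_div_iff₀ (by positivity) (by positivity)]
  calc x * (√n * √H) ≤ y * (√H * N) * (√n * √H) := by gcongr
    _ = y * N * √n * (√H * √H) := by ring
    _ = N / c * y * (√n * H * c) := by
      rw [Real.mul_self_sqrt hH.le]; field_simp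

theorem margin_eq : margin ψ n κ h
    = l2Norm ψ / (∫ x, ψ x) * (κ + penalty (2 ^ d * ∏ i, h i)) / √(n * ∏ i, h i) := by
  rw [margin, ← div_div, mul_div_right_comm]

/-- The noise and the margin carry one penalty each, hence the factor `2`. -/
theorem IsTameKernel.upperBand_le (hψ : IsTameKernel ψ V) (hN : 0 < l2Norm ψ)
    (hc : 0 < ∫ x, ψ x) (hh : h ∈ bandwidths d) (ht : t ∈ centers h) (hn : 0 < n)
    (hw : ContinuousOn w (Icc 0 1)) (hf : IntegrableOn f (Icc 0 1))
    (hC : ∀ x ∈ Icc (0 : Fin d → ℝ) 1, |f x| ≤ C) (hT : multiscaleStat ψ w ≤ (T : EReal)) :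
    upperBand ψ n κ (fun s => √n * (∫ x in Icc 0 s, f x) + w s) t
      ≤ (((∫ x in Icc 0 1, scaledKernel ψ t h x * f x) / ((∏ i, h i) * ∫ x, ψ x)
        + l2Norm ψ / (∫ x, ψ x) * (T + κ + 2 * penalty (2 ^ d * ∏ i, h i)) / √(n * ∏ i, h i) : ℝ)
          : EReal) := by
  have hH : 0 < ∏ i, h i := Finset.prod_pos fun i _ => (hh i).1
  refine iInf₂_le_of_le h ⟨hh, ht⟩ (EReal.coe_le_coe_iff.2 ?_)
  rw [hψ.kernelEstimator_eq hh ht hn hw hf hC, margin_eq, add_assoc]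
  refine add_le_add_right ?_ _
  refine (add_le_add_left (noise_div_le hH hc hn
    (pathIntegral_le_of_multiscaleStat_le hN hh ht hT)) _).trans_eq ?_
  ring

/-- A lower bound on the noise is needed here, so the relevant statistic is that of `-ψ`. -/
theorem IsTameKernel.le_lowerBand (hψ : IsTameKernel ψ V) (hN : 0 < l2Norm ψ)
    (hc : 0 < ∫ x, ψ x) (hh : h ∈ bandwidths d) (ht : t ∈ centers h) (hn : 0 < n)
    (hw : ContinuousOn w (Icc 0 1)) (hf : IntegrableOn f (Icc 0 1))
    (hC : ∀ x ∈ Icc (0 : Fin d → ℝ) 1, |f x| ≤ C) (hT : multiscaleStat (-ψ) w ≤ (T : EReal)) :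
    (((∫ x in Icc 0 1, scaledKernel ψ t h x * f x) / ((∏ i, h i) * ∫ x, ψ x)
        - l2Norm ψ / (∫ x, ψ x) * (T + κ + 2 * penalty (2 ^ d * ∏ i, h i)) / √(n * ∏ i, h i) : ℝ)
          : EReal)
      ≤ lowerBand ψ n κ (fun s => √n * (∫ x in Icc 0 s, f x) + w s) t := by
  have hH : 0 < ∏ i, h i := Finset.prod_pos fun i _ => (hh i).1
  refine le_iSup₂_of_le h ⟨hh, ht⟩ (EReal.coe_le_coe_iff.2 ?_)
  have h1 := noise_div_le hH hc hn
    (l2Norm_neg ψ ▸ pathIntegral_le_of_multiscaleStat_le (by rwa [l2Norm_neg]) hh ht hT)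
  have h2 : scaledKernel (-ψ) t h = -scaledKernel ψ t h := rfl
  rw [h2, (hψ.isTame_scaledKernel hh ht).pathIntegral_neg_left hw, neg_div] at h1
  rw [hψ.kernelEstimator_eq hh ht hn hw hf hC, margin_eq, add_sub_assoc, sub_eq_add_neg]
  refine add_le_add_right ?_ _
  have h3 : l2Norm ψ / (∫ x, ψ x) * (T + κ + 2 * penalty (2 ^ d * ∏ i, h i)) / √(n * ∏ i, h i)
      = l2Norm ψ / (∫ x, ψ x) * (T + penalty (2 ^ d * ∏ i, h i)) / √(n * ∏ i, h i)
      + l2Norm ψ / (∫ x, ψ x) * (κ + penalty (2 ^ d * ∏ i, h i)) / √(n * ∏ i, h i) := by ring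
  rw [h3]
  linarith

end Band

/-! ### The balancing bandwidth. -/

section Rate

variable {d : ℕ} {β n : ℝ}

theorem one_le_log_exp_mul (hn : 1 ≤ n) : 1 ≤ Real.log (Real.exp 1 * n) := by
  rw [Real.log_mul (Real.exp_pos 1).ne' (by linarith), Real.log_exp]
  linarith [Real.log_nonneg hn]

theorem log_exp_mul_le (hn : 1 ≤ n) : Real.log (Real.exp 1 * n) ≤ n := by
  rw [Real.log_mul (Real.exp_pos 1).ne' (by linarith), Real.log_exp]
  linarith [Real.log_le_sub_one_of_pos (show 0 < n by linarith)]

theorem rate_pos (hn : 1 ≤ n) : 0 < rate d β n :=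
  Real.rpow_pos_of_pos (div_pos (by linarith [one_le_log_exp_mul hn]) (by linarith)) _

theorem penalty_nonneg (r : ℝ) : 0 ≤ penalty r := Real.sqrt_nonneg _

theorem rpow_bandwidth_eq_rate (hn : 1 ≤ n) :
    ((Real.log (Real.exp 1 * n) / n) ^ (1 / (2 * β + d))) ^ β = rate d β n := by
  rw [rate, ← Real.rpow_mul (div_nonneg (by linarith [one_le_log_exp_mul hn]) (by linarith)),
    one_div_mul_eq_div]

/-- With `r` the bandwidth and `l = log (e n)`, the balance `r ^ (2 * β + d) = l / n` says that `n *
r ^ d` is `l` divided by the square of `r ^ β`. A noise term of the order of the square root of `l`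
then becomes a multiple of the rate. -/
theorem sqrt_bandwidth (hβ : 0 < β) (hn : 1 ≤ n) :
    √(n * ((Real.log (Real.exp 1 * n) / n) ^ (1 / (2 * β + d))) ^ d)
      = √(Real.log (Real.exp 1 * n)) / rate d β n := by
  have hl := one_le_log_exp_mul hn
  set l := Real.log (Real.exp 1 * n)
  have hq : 0 < l / n := div_pos (by linarith) (by linarith)
  set r := (l / n) ^ (1 / (2 * β + d)) with hr
  have hr0 : 0 < r := Real.rpow_pos_of_pos hq _
  have h1 : r ^ (2 * β) * r ^ d = l / n := by
    rw [← Real.rpow_natCast r d, ← Real.rpow_add hr0, hr, ← Real.rpow_mul hq.le,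
      one_div_mul_cancel (by positivity), Real.rpow_one]
  have h2 : r ^ (2 * β) = (r ^ β) ^ 2 := by
    rw [mul_comm, Real.rpow_mul hr0.le, Real.rpow_two]
  have h3 : rate d β n = r ^ β := (rpow_bandwidth_eq_rate hn).symm
  have h4 : 0 < r ^ β := Real.rpow_pos_of_pos hr0 _
  rw [h3, Real.sqrt_eq_iff_mul_self_eq_of_pos (div_pos (Real.sqrt_pos.2 (by linarith)) h4),
    div_mul_div_comm, Real.mul_self_sqrt (by linarith), ← pow_two, ← h2, div_eq_iff (by positivity),
    mul_assoc, mul_comm (r ^ d), h1, mul_div_cancel₀ _ (by linarith)]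

/-- As `d / (2 * β + d) ≤ 1`, the logarithm in the penalty is at most `log (e n)`; the constant `3`
is a rational bound for twice the square root of `2`. -/
theorem penalty_bandwidth_le (hβ : 0 < β) (hn : 1 ≤ n) :
    2 * penalty (2 ^ d * ((Real.log (Real.exp 1 * n) / n) ^ (1 / (2 * β + d))) ^ d)
      ≤ 3 * √(Real.log (Real.exp 1 * n)) := by
  have hl := one_le_log_exp_mul hn
  have hl' : Real.log (Real.exp 1 * n) = 1 + Real.log n := by
    rw [Real.log_mul (Real.exp_pos 1).ne' (by linarith), Real.log_exp]
  set l := Real.log (Real.exp 1 * n)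
  have hq : 0 < l / n := div_pos (by linarith) (by linarith)
  set r := (l / n) ^ (1 / (2 * β + d)) with hr
  have hr0 : 0 < r := Real.rpow_pos_of_pos hq _
  have h1 : Real.log (Real.exp 1 / (2 ^ d * r ^ d)) ≤ l := by
    rw [Real.log_div (Real.exp_pos 1).ne' (by positivity), Real.log_exp,
      Real.log_mul (by positivity) (by positivity), Real.log_pow, Real.log_pow, hr,
      Real.log_rpow hq, Real.log_div (by linarith) (by linarith)]
    have a1 : 0 ≤ (d : ℝ) * Real.log 2 := by positivity
    have a2 : 0 ≤ Real.log l := Real.log_nonneg hl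
    have a3 : 0 ≤ Real.log n := Real.log_nonneg hn
    have a4 : (d : ℝ) * (1 / (2 * β + d) * (Real.log n - Real.log l)) ≤ Real.log n := by
      have a5 : (0 : ℝ) ≤ d / (2 * β + d) := by positivity
      have a6 : (d : ℝ) / (2 * β + d) ≤ 1 := div_le_one_of_le₀ (by linarith) (by positivity)
      calc _ = (d : ℝ) / (2 * β + d) * (Real.log n - Real.log l) := by ring
        _ ≤ (d : ℝ) / (2 * β + d) * Real.log n := by gcongr; linarith
        _ ≤ 1 * Real.log n := by gcongr
        _ = _ := one_mul _
    have a7 : (d : ℝ) * (1 / (2 * β + d) * (Real.log l - Real.log n))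
      = -((d : ℝ) * (1 / (2 * β + d) * (Real.log n - Real.log l))) := by ring
    rw [a7]
    linarith
  have h2 : penalty (2 ^ d * r ^ d) ≤ √((3 / 2) ^ 2 * l) :=
    Real.sqrt_le_sqrt (by linarith)
  rw [Real.sqrt_mul (by positivity), Real.sqrt_sq (by norm_num)] at h2
  linarith

end Rate


/-! ### The deterministic bound for the width. -/

section Width

variable {d : ℕ} {β L ε r n κ C Tl Tu Vl Vu : ℝ} {ψl ψu w f : (Fin d → ℝ) → ℝ} {t : Fin d → ℝ}

theorem const_mem_bandwidths (hr : 0 < r) (hrε : r ≤ ε) (hε : ε < 1 / 2) :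
    (fun _ => r) ∈ bandwidths d := fun _ => ⟨hr, by linarith⟩

theorem mem_centers_const (hr : r ≤ ε) (hε : 0 ≤ ε) (ht : supBox t ε ⊆ Icc 0 1) :
    t ∈ centers (fun _ => r) := by
  have h1 : (fun i => t i - ε) ∈ supBox t ε := fun i => by simp [abs_of_nonneg hε]
  have h2 : (fun i => t i + ε) ∈ supBox t ε := fun i => by simp [abs_of_nonneg hε]
  intro i
  have h3 := (ht h1).1 i
  have h4 := (ht h2).2 i
  simp only [Pi.zero_apply, Pi.one_apply] at h3 h4
  constructor <;> linarith

/-- Width of the band in terms of the bias and the noise at a fixed cubic bandwidth. -/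
theorem upperBand_sub_lowerBand_le (hd : 1 ≤ d) (hβ : 0 < β) (hL : 0 < L)
    (hl : IsTameKernel ψl Vl) (hu : IsTameKernel ψu Vu) (hψl : IsKernel ψl) (hψu : IsKernel ψu)
    (hn : 0 < n) (hr : 0 < r) (hrε : r ≤ ε) (hε : ε < 1 / 2) (ht : supBox t ε ⊆ Icc 0 1)
    (hf : IntegrableOn f (Icc 0 1)) (hC : ∀ x ∈ Icc (0 : Fin d → ℝ) 1, |f x| ≤ C)
    (hfH : IsHolderOn β L (supBox t ε) f) (hw : ContinuousOn w (Icc 0 1))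
    (hlin : 1 < β → ∀ h ∈ bandwidths d, t ∈ centers h → ∀ i,
      ∫ x in Icc 0 1, scaledKernel ψl t h x * x i = t i * ((∏ i, h i) * ∫ x, ψl x) ∧
      ∫ x in Icc 0 1, scaledKernel ψu t h x * x i = t i * ((∏ i, h i) * ∫ x, ψu x))
    (hTu : multiscaleStat ψu w ≤ (Tu : EReal)) (hTl : multiscaleStat (-ψl) w ≤ (Tl : EReal)) :
    upperBand ψu n κ (fun s => √n * (∫ x in Icc 0 s, f x) + w s) t
        - lowerBand ψl n κ (fun s => √n * (∫ x in Icc 0 s, f x) + w s) t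
      ≤ (((Vu / (∫ x, ψu x) + Vl / ∫ x, ψl x) * (2 ^ d * (L * d ^ β)) * r ^ β
        + (l2Norm ψu / (∫ x, ψu x) + l2Norm ψl / ∫ x, ψl x)
          * (|κ| + |Tl| + |Tu| + 2 * penalty (2 ^ d * r ^ d)) / √(n * r ^ d) : ℝ) : EReal) := by
  have hh : (fun _ => r) ∈ bandwidths d := const_mem_bandwidths hr hrε hε
  have htc : t ∈ centers (fun _ => r) := mem_centers_const hrε (hr.le.trans hrε) ht
  obtain ⟨G, hG0, hG⟩ := hfH.exists_linear_approx hd hβ hL.le hr hrε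
  have hsub : ∀ x ∈ Icc (t - fun _ => r) (t + fun _ => r),
      |f x - f t - ∑ i, G i * (x i - t i)| ≤ L * (d * r) ^ β := by
    refine fun x hx => hG x fun i => ?_
    have h1 := hx.1 i
    have h2 := hx.2 i
    simp only [Pi.sub_apply, Pi.add_apply] at h1 h2
    rw [abs_le]; constructor <;> linarith
  have hGl : ∀ i, G i = 0 ∨ ∫ x in Icc 0 1, scaledKernel ψl t (fun _ => r) x * x i
      = t i * ((∏ _i : Fin d, r) * ∫ x, ψl x) := fun i => by
    by_cases h1 : β ≤ 1
    · exact Or.inl (congrFun (hG0 h1) i)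
    · exact Or.inr (hlin (not_le.1 h1) _ hh htc i).1
  have hGu : ∀ i, G i = 0 ∨ ∫ x in Icc 0 1, scaledKernel ψu t (fun _ => r) x * x i
      = t i * ((∏ _i : Fin d, r) * ∫ x, ψu x) := fun i => by
    by_cases h1 : β ≤ 1
    · exact Or.inl (congrFun (hG0 h1) i)
    · exact Or.inr (hlin (not_le.1 h1) _ hh htc i).2
  have bl := hl.abs_average_sub_le hψl.integral_pos hh htc hf G hGl hsub
  have bu := hu.abs_average_sub_le hψu.integral_pos hh htc hf G hGu hsub
  have eu := hu.upperBand_le (κ := κ) hψu.l2Norm_pos hψu.integral_pos hh htc hn hw hf hC hTu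
  have el := hl.le_lowerBand (κ := κ) hψl.l2Norm_pos hψl.integral_pos hh htc hn hw hf hC hTl
  refine (EReal.sub_le_sub eu el).trans ?_
  rw [← EReal.coe_sub, EReal.coe_le_coe_iff]
  rw [Real.mul_rpow (by positivity) hr.le] at bl bu
  simp only [Finset.prod_const, Finset.card_univ, Fintype.card_fin] at bl bu ⊢
  set Γ := penalty (2 ^ d * r ^ d)
  have hs : 0 < √(n * r ^ d) := Real.sqrt_pos.2 (by positivity)
  have hDu : 0 < l2Norm ψu / ∫ x, ψu x := div_pos hψu.l2Norm_pos hψu.integral_pos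
  have hDl : 0 < l2Norm ψl / ∫ x, ψl x := div_pos hψl.l2Norm_pos hψl.integral_pos
  have nu : l2Norm ψu / (∫ x, ψu x) * (Tu + κ + 2 * Γ) / √(n * r ^ d)
      ≤ l2Norm ψu / (∫ x, ψu x) * (|κ| + |Tl| + |Tu| + 2 * Γ) / √(n * r ^ d) := by
    refine div_le_div_of_nonneg_right (mul_le_mul_of_nonneg_left ?_ hDu.le) hs.le
    linarith [le_abs_self κ, le_abs_self Tu, abs_nonneg Tl]
  have nl : l2Norm ψl / (∫ x, ψl x) * (Tl + κ + 2 * Γ) / √(n * r ^ d)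
      ≤ l2Norm ψl / (∫ x, ψl x) * (|κ| + |Tl| + |Tu| + 2 * Γ) / √(n * r ^ d) := by
    refine div_le_div_of_nonneg_right (mul_le_mul_of_nonneg_left ?_ hDl.le) hs.le
    linarith [le_abs_self κ, le_abs_self Tl, abs_nonneg Tu]
  have b1 := (abs_le.1 bl).1
  have b2 := (abs_le.1 bu).2
  have e1 : (Vu / (∫ x, ψu x) + Vl / ∫ x, ψl x) * (2 ^ d * (L * d ^ β)) * r ^ β
      = Vu * 2 ^ d * (L * (d ^ β * r ^ β)) / (∫ x, ψu x)
        + Vl * 2 ^ d * (L * (d ^ β * r ^ β)) / (∫ x, ψl x) := by ring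
  rw [e1, add_mul, add_div]
  linarith

/-- The balancing bandwidth is used whenever it is at most `ε`, with a constant free of `ε`;
otherwise the bandwidth is `ε` itself. -/
theorem exists_upperBand_sub_lowerBand_le (hd : 1 ≤ d) (hβ : 0 < β) (hL : 0 < L)
    (hψl : IsKernel ψl) (hψu : IsKernel ψu) :
    ∃ (K₀ : ℝ) (K : ℝ → ℝ), 0 < K₀ ∧ (∀ ε, 0 < K ε) ∧
      ∀ (n κ C Tl Tu ε : ℝ) (t : Fin d → ℝ) (f w : (Fin d → ℝ) → ℝ), 1 ≤ n → 0 < ε → ε < 1 / 2 →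
      supBox t ε ⊆ Icc 0 1 → IntegrableOn f (Icc 0 1) →
      (∀ x ∈ Icc (0 : Fin d → ℝ) 1, |f x| ≤ C) → IsHolderOn β L (supBox t ε) f →
      ContinuousOn w (Icc 0 1) →
      (1 < β → ∀ h ∈ bandwidths d, t ∈ centers h → ∀ i,
        ∫ x in Icc 0 1, scaledKernel ψl t h x * x i = t i * ((∏ i, h i) * ∫ x, ψl x) ∧
        ∫ x in Icc 0 1, scaledKernel ψu t h x * x i = t i * ((∏ i, h i) * ∫ x, ψu x)) →
      multiscaleStat ψu w ≤ (Tu : EReal) → multiscaleStat (-ψl) w ≤ (Tl : EReal) →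
      upperBand ψu n κ (fun s => √n * (∫ x in Icc 0 s, f x) + w s) t
          - lowerBand ψl n κ (fun s => √n * (∫ x in Icc 0 s, f x) + w s) t
        ≤ ((K ε * rate d β n
          * (1 + (|κ| + |Tl| + |Tu|) / √(Real.log (Real.exp 1 * n))) : ℝ) : EReal) ∧
      ((Real.log (Real.exp 1 * n) / n) ^ (1 / (2 * β + d)) ≤ ε →
        upperBand ψu n κ (fun s => √n * (∫ x in Icc 0 s, f x) + w s) t
            - lowerBand ψl n κ (fun s => √n * (∫ x in Icc 0 s, f x) + w s) t
          ≤ ((K₀ * rate d β n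
            * (1 + (|κ| + |Tl| + |Tu|) / √(Real.log (Real.exp 1 * n))) : ℝ) : EReal)) := by
  obtain ⟨Vl, hl⟩ := hψl.exists_isTameKernel hd
  obtain ⟨Vu, hu⟩ := hψu.exists_isTameKernel hd
  set B := (Vu / (∫ x, ψu x) + Vl / ∫ x, ψl x) * (2 ^ d * (L * d ^ β)) with hB
  set D := l2Norm ψu / (∫ x, ψu x) + l2Norm ψl / ∫ x, ψl x with hD
  have hD0 : 0 < D := add_pos (div_pos hψu.l2Norm_pos hψu.integral_pos)
    (div_pos hψl.l2Norm_pos hψl.integral_pos)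
  have hB0 : 0 ≤ B := mul_nonneg (add_nonneg (div_nonneg hu.toIsTame.nonneg hψu.integral_pos.le)
    (div_nonneg hl.toIsTame.nonneg hψl.integral_pos.le)) (by positivity)
  -- `E` and `G` convert the noise term at bandwidth `ε` into a multiple of the rate. The absolute
  -- value in `K` only ensures positivity for every real `ε`.
  let E : ℝ → ℝ := fun ε => 1 / (√(ε ^ d) * ε ^ β)
  let G : ℝ → ℝ := fun ε => penalty (2 ^ d * ε ^ d)
  let K : ℝ → ℝ := fun ε => (B + 3 * D) + |D * E ε * (1 + 2 * G ε)|
  have hK₀ : 0 < B + 3 * D := by linarith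
  have hK : ∀ ε, B + 3 * D ≤ K ε := fun ε => le_add_of_nonneg_right (abs_nonneg _)
  refine ⟨B + 3 * D, K, hK₀, fun ε => hK₀.trans_le (hK ε), ?_⟩
  intro n κ C Tl Tu ε t f w hn hε0 hε ht hf hC hfH hw hlin hTu hTl
  have hwidth := fun (r : ℝ) (hr : 0 < r) (hrε : r ≤ ε) =>
    upperBand_sub_lowerBand_le (n := n) (κ := κ) hd hβ hL hl hu hψl hψu (by linarith) hr hrε hε ht hf hC hfH
      hw hlin hTu hTl
  rw [← hB, ← hD] at hwidth
  have hlog := one_le_log_exp_mul hn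
  have hlogn := log_exp_mul_le hn
  have hρ : 0 < rate d β n := rate_pos hn
  have hrate : ((Real.log (Real.exp 1 * n) / n) ^ (1 / (2 * β + d))) ^ β = rate d β n :=
    rpow_bandwidth_eq_rate hn
  have hsq := sqrt_bandwidth (d := d) hβ hn
  have hpen := penalty_bandwidth_le (d := d) hβ hn
  have hrpos : 0 < (Real.log (Real.exp 1 * n) / n) ^ (1 / (2 * β + d)) :=
    Real.rpow_pos_of_pos (div_pos (by linarith) (by linarith)) _
  set l := Real.log (Real.exp 1 * n)
  set R := (l / n) ^ (1 / (2 * β + d))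
  set ρ := rate d β n
  have hX : 0 ≤ |κ| + |Tl| + |Tu| := by positivity
  set X := |κ| + |Tl| + |Tu|
  have hl1 : 1 ≤ √l := Real.one_le_sqrt.2 hlog
  have small : R ≤ ε → upperBand ψu n κ (fun s => √n * (∫ x in Icc 0 s, f x) + w s) t
            - lowerBand ψl n κ (fun s => √n * (∫ x in Icc 0 s, f x) + w s) t
          ≤ (((B + 3 * D) * ρ * (1 + X / √l) : ℝ) : EReal) := by
    intro hR
    refine (hwidth R hrpos hR).trans (EReal.coe_le_coe_iff.2 ?_)
    rw [hrate, hsq]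
    calc B * ρ + D * (X + 2 * penalty (2 ^ d * R ^ d)) / (√l / ρ)
        ≤ B * ρ + D * (X + 3 * √l) / (√l / ρ) := by gcongr
      _ = B * ρ + 3 * D * ρ + D * ρ * (X / √l) := by
          field_simp
          ring
      _ ≤ B * ρ + 3 * D * ρ + (B + 3 * D) * ρ * (X / √l) := by
          gcongr
          linarith
      _ = _ := by ring
  refine ⟨?_, small⟩
  by_cases hR : R ≤ ε
  · refine (small hR).trans (EReal.coe_le_coe_iff.2 ?_)
    gcongr
    exact hK ε
  refine (hwidth ε hε0 le_rfl).trans (EReal.coe_le_coe_iff.2 ?_)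
  have h1 : ε ^ β ≤ ρ := by
    rw [← hrate]
    exact Real.rpow_le_rpow hε0.le (not_le.1 hR).le hβ.le
  have hεβ : 0 < ε ^ β := Real.rpow_pos_of_pos hε0 _
  have hεd : 0 < √(ε ^ d) := Real.sqrt_pos.2 (by positivity)
  -- Here `ε` is below the balancing bandwidth, so `ε ^ β ≤ ρ`, and `l ≤ n`; these two facts replace
  -- the balance equation.
  have h2 : 1 / √(n * ε ^ d) ≤ E ε * ρ / √l := by
    have hnl : √l ≤ √n := Real.sqrt_le_sqrt hlogn
    rw [Real.sqrt_mul (by linarith), show E ε * ρ / √l = ρ / (√(ε ^ d) * ε ^ β * √l) by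
      simp only [E]; field_simp, div_le_div_iff₀ (by positivity) (by positivity)]
    calc 1 * (√(ε ^ d) * ε ^ β * √l) = ε ^ β * (√l * √(ε ^ d)) := by ring
      _ ≤ ρ * (√n * √(ε ^ d)) := by gcongr
  have hE : 0 ≤ E ε := by positivity
  have hG : 0 ≤ G ε := penalty_nonneg _
  have habs : |D * E ε * (1 + 2 * G ε)| = D * E ε * (1 + 2 * G ε) := abs_of_nonneg (by positivity)
  calc B * ε ^ β + D * (X + 2 * penalty (2 ^ d * ε ^ d)) / √(n * ε ^ d)
      = B * ε ^ β + D * (X + 2 * G ε) * (1 / √(n * ε ^ d)) := by ring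
    _ ≤ B * ρ + D * (X + 2 * G ε * √l) * (E ε * ρ / √l) := by
        have h3 : X + 2 * G ε ≤ X + 2 * G ε * √l :=
          add_le_add_right (le_mul_of_one_le_right (by positivity) hl1) _
        exact add_le_add (mul_le_mul_of_nonneg_left h1 hB0)
          (mul_le_mul (mul_le_mul_of_nonneg_left h3 hD0.le) h2 (by positivity) (by positivity))
    _ = B * ρ + D * E ε * ρ * (X / √l) + D * E ε * (2 * G ε) * ρ := by
        field_simp
        ring
    _ ≤ B * ρ + 3 * D * ρ + (B + 3 * D) * ρ * (X / √l)
        + (D * E ε * ρ * (X / √l) + D * E ε * (2 * G ε) * ρ)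
        + (D * E ε * ρ + D * E ε * (2 * G ε) * ρ * (X / √l)) := by
        have p1 : 0 ≤ 3 * D * ρ := by positivity
        have p2 : 0 ≤ (B + 3 * D) * ρ * (X / √l) := by positivity
        have p3 : 0 ≤ D * E ε * ρ + D * E ε * (2 * G ε) * ρ * (X / √l) := by positivity
        linarith
    _ = K ε * ρ * (1 + X / √l) := by
        simp only [K]
        rw [habs]
        ring

end Width


/-! ### Uniform tails of the statistics and bounds for the critical value. -/

/-- Subadditivity of the outer measure suffices, so `A` need not be measurable; this matters for
events defined by uncountable suprema. -/
theorem ofReal_one_sub_le_measure {Ω : Type*} [MeasurableSpace Ω] {P : Measure Ω}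
    [IsProbabilityMeasure P] {A : Set Ω} {δ : ℝ} (hδ : 0 ≤ δ) (h : P Aᶜ ≤ ENNReal.ofReal δ) :
    ENNReal.ofReal (1 - δ) ≤ P A := by
  rw [ENNReal.ofReal_sub _ hδ, ENNReal.ofReal_one, tsub_le_iff_right]
  calc (1 : ℝ≥0∞) = P (A ∪ Aᶜ) := by rw [union_compl_self, measure_univ]
    _ ≤ P A + P Aᶜ := measure_union_le _ _
    _ ≤ _ := by gcongr

theorem multiscaleStat_ne_bot {d : ℕ} (ψ w : (Fin d → ℝ) → ℝ) : multiscaleStat ψ w ≠ ⊥ := by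
  refine ne_bot_of_le_ne_bot (EReal.coe_ne_bot _)
    (le_iSup₂_of_le (fun _ => 1 / 2) (fun _ => ⟨by norm_num, le_rfl⟩)
      (le_iSup₂_of_le (fun _ => 1 / 2) (fun _ => ⟨le_rfl, by norm_num⟩) le_rfl))

section Tails

variable {d : ℕ} {ψ ψl ψu : (Fin d → ℝ) → ℝ} {V Vl Vu η α : ℝ}

/-- The upper tail of the multiscale statistic is bounded uniformly over all Brownian sheets. -/
theorem IsTameKernel.exists_measure_multiscaleStat_gt_le (hψ : IsTameKernel ψ V)
    (hN : 0 < l2Norm ψ) (hη : 0 < η) :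
    ∃ X : ℝ, 0 ≤ X ∧ ∀ (Ω : Type*) [MeasurableSpace Ω] (P : Measure Ω) [IsProbabilityMeasure P]
      (W : (Fin d → ℝ) → Ω → ℝ), IsBrownianSheet W P →
      P {ω | ¬ multiscaleStat ψ (fun t => W t ω) ≤ (X : EReal)} ≤ ENNReal.ofReal η := by
  obtain ⟨A, x₀, hA⟩ := exists_measure_not_isControlled_le d V
  have hlim : Tendsto (fun x => A * Real.exp (-x)) atTop (nhds 0) := by
    simpa using Real.tendsto_exp_neg_atTop_nhds_zero.const_mul A
  obtain ⟨x, ⟨hx1, hx2⟩, hx3⟩ := (((hlim.eventually (gt_mem_nhds hη)).and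
    (eventually_ge_atTop x₀)).and (eventually_ge_atTop 1)).exists
  refine ⟨|chainConst ψ * x|, abs_nonneg _, fun Ω _ P _ W hW => ?_⟩
  refine le_trans (measure_mono_ae ?_)
    ((hA Ω P W hW ψ hψ hN x hx2).trans (ENNReal.ofReal_le_ofReal hx1.le))
  filter_upwards [hW.continuous] with ω hω hgt hc
  exact hgt ((hc.multiscaleStat_le hψ hN hω hx3).trans (EReal.coe_le_coe_iff.2 (le_abs_self _)))

/-- The lower tail of the multiscale statistic is bounded uniformly over all Brownian sheets. -/
theorem IsTameKernel.exists_measure_multiscaleStat_le_lt (hψ : IsTameKernel ψ V)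
    (hN : 0 < l2Norm ψ) (hη : 0 < η) :
    ∃ X : ℝ, 0 ≤ X ∧ ∀ (Ω : Type*) [MeasurableSpace Ω] (P : Measure Ω) [IsProbabilityMeasure P]
      (W : (Fin d → ℝ) → Ω → ℝ), IsBrownianSheet W P →
      P {ω | multiscaleStat ψ (fun t => W t ω) ≤ ((-X : ℝ) : EReal)} < ENNReal.ofReal η := by
  -- One term of the supremum, at bandwidth and center `1 / 2`, already bounds the statistic from
  -- below. The condition `2 ≤ u` gives `u ≤ u ^ 2 / 2`, so the Gaussian tail is at most `exp (-u)`.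
  obtain ⟨u, hu1, hu2⟩ := ((Real.tendsto_exp_neg_atTop_nhds_zero.eventually
    (gt_mem_nhds hη)).and (eventually_ge_atTop 2)).exists
  set h : Fin d → ℝ := fun _ => 1 / 2
  have hh : h ∈ bandwidths d := fun _ => ⟨by norm_num [h], le_rfl⟩
  have ht : h ∈ centers h := fun _ => ⟨le_rfl, by norm_num [h]⟩
  set Γ := penalty (2 ^ d * ∏ i, h i)
  have hΓ : 0 ≤ Γ := penalty_nonneg _
  have hH : 0 < ∏ i, h i := Finset.prod_pos fun i _ => (hh i).1
  have hT := hψ.isTame_scaledKernel hh ht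
  have hs : 0 < √(∏ i, h i) * l2Norm ψ := mul_pos (Real.sqrt_pos.2 hH) hN
  have hvar : ∫ x in Icc (0 : Fin d → ℝ) 1, (-scaledKernel ψ h h) x ^ 2
      ≤ (∏ i, h i) * l2Norm ψ ^ 2 := by
    have := hψ.integral_boxKernel_sq_le (a := h - h) (b := h + h) fun i => by norm_num [h]
    rw [← scaledKernel_eq_boxKernel] at this
    simpa using this
  refine ⟨u + Γ, by linarith, fun Ω _ P _ W hW => ?_⟩
  refine lt_of_le_of_lt (measure_mono_ae ?_)
    ((hW.measure_ge_le hT.neg hvar (mul_nonneg (by linarith : (0 : ℝ) ≤ u) hs.le)).trans_lt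
      ((ENNReal.ofReal_lt_ofReal_iff hη).2 (lt_of_le_of_lt (Real.exp_le_exp.2 ?_) hu1)))
  · filter_upwards [hW.continuous] with ω hω hle
    change u * _ ≤ _
    rw [hT.pathIntegral_neg_left hω]
    have h1 := pathIntegral_le_of_multiscaleStat_le hN hh ht hle
    rw [show -(u + Γ) + Γ = -u by ring] at h1
    linarith
  · rw [mul_pow, mul_pow, Real.sq_sqrt hH.le, neg_div, neg_le_neg_iff]
    have : 0 < (∏ i, h i) * l2Norm ψ ^ 2 := by positivity
    rw [le_div_iff₀ (by positivity)]
    have h2 : 2 * u ≤ u ^ 2 := by nlinarith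
    calc u * (2 * ((∏ i, h i) * l2Norm ψ ^ 2)) = 2 * u * ((∏ i, h i) * l2Norm ψ ^ 2) := by ring
      _ ≤ u ^ 2 * ((∏ i, h i) * l2Norm ψ ^ 2) := by gcongr

/-- The critical value is bounded uniformly over all Brownian sheets. -/
theorem exists_abs_critValue_le (hl : IsTameKernel ψl Vl) (hu : IsTameKernel ψu Vu)
    (hNl : 0 < l2Norm ψl) (hNu : 0 < l2Norm ψu) (hα : 0 < α) (hα1 : α < 1) :
    ∃ B : ℝ, 0 ≤ B ∧ ∀ (Ω : Type*) [MeasurableSpace Ω] (P : Measure Ω) [IsProbabilityMeasure P]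
      (W : (Fin d → ℝ) → Ω → ℝ), IsBrownianSheet W P → |critValue P W ψl ψu α| ≤ B := by
  obtain ⟨X₁, hX₁, h₁⟩ := hl.exists_measure_multiscaleStat_gt_le hNl (half_pos hα)
  obtain ⟨X₂, hX₂, h₂⟩ := hu.neg.exists_measure_multiscaleStat_gt_le
    (by rwa [l2Norm_neg]) (half_pos hα)
  obtain ⟨X₃, hX₃, h₃⟩ := hl.exists_measure_multiscaleStat_le_lt hNl (sub_pos.2 hα1)
  refine ⟨X₁ + X₂ + X₃, by positivity, fun Ω _ P _ W hW => ?_⟩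
  set S := {x : ℝ | ENNReal.ofReal (1 - α) ≤
    P {ω | max (multiscaleStat ψl (fun t => W t ω)) (multiscaleStat (-ψu) (fun t => W t ω))
      ≤ (x : EReal)}} with hS
  have hmem : X₁ + X₂ ∈ S := by
    refine ofReal_one_sub_le_measure hα.le ?_
    have hsub : {ω | max (multiscaleStat ψl (fun t => W t ω))
        (multiscaleStat (-ψu) (fun t => W t ω)) ≤ ((X₁ + X₂ : ℝ) : EReal)}ᶜ ⊆
        {ω | ¬ multiscaleStat ψl (fun t => W t ω) ≤ (X₁ : EReal)} ∪
        {ω | ¬ multiscaleStat (-ψu) (fun t => W t ω) ≤ (X₂ : EReal)} := by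
      intro ω hω
      by_contra hcon
      simp only [mem_union, mem_ofPred_eq, not_or, not_not] at hcon
      exact hω (max_le (hcon.1.trans (EReal.coe_le_coe_iff.2 (by linarith)))
        (hcon.2.trans (EReal.coe_le_coe_iff.2 (by linarith))))
    refine (measure_mono hsub).trans ((measure_union_le _ _).trans
      ((add_le_add (h₁ Ω P W hW) (h₂ Ω P W hW)).trans_eq ?_))
    rw [← ENNReal.ofReal_add (half_pos hα).le (half_pos hα).le, add_halves]
  -- A candidate below `-X₃` would give the lower tail of the first statistic a probability of at
  -- least `1 - α`, which is excluded.
  have hlow : ∀ x ∈ S, -X₃ ≤ x := by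
    intro x hx
    by_contra! hlt
    refine absurd (h₃ Ω P W hW) (not_lt.2 (le_trans hx (measure_mono fun ω hω => ?_)))
    exact ((le_max_left _ _).trans hω).trans (EReal.coe_le_coe_iff.2 hlt.le)
  have hcrit : critValue P W ψl ψu α = sInf S := rfl
  rw [hcrit, abs_le]
  constructor
  · linarith [le_csInf ⟨_, hmem⟩ hlow]
  · linarith [csInf_le ⟨_, hlow⟩ hmem]

end Tails


/-! ### The noise factor and the main theorem. -/

section NoiseFactor

variable {d : ℕ} {Ω : Type*} [MeasurableSpace Ω] {P : Measure Ω} {W : (Fin d → ℝ) → Ω → ℝ}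
  {ψl ψu : (Fin d → ℝ) → ℝ} {α n : ℝ} {ω : Ω}

theorem noiseFactor_eq_coe {Tl Tu : ℝ} (hl : multiscaleStat (-ψl) (fun t => W t ω) = (Tl : EReal))
    (hu : multiscaleStat ψu (fun t => W t ω) = (Tu : EReal)) :
    noiseFactor P W ψl ψu α n ω = ((1 + (|critValue P W ψl ψu α| + |Tl| + |Tu|)
      / √(Real.log (Real.exp 1 * n)) : ℝ) : EReal) := by
  rw [noiseFactor, hl, hu, EReal.coe_abs, EReal.coe_abs, EReal.coe_add, EReal.coe_div,
    EReal.coe_add, EReal.coe_add, EReal.coe_one]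

theorem noiseFactor_eq_top (hn : 1 ≤ n) (h : multiscaleStat (-ψl) (fun t => W t ω) = ⊤ ∨
    multiscaleStat ψu (fun t => W t ω) = ⊤) : noiseFactor P W ψl ψu α n ω = ⊤ := by
  have hsum : ((|critValue P W ψl ψu α| : ℝ) : EReal)
      + ((multiscaleStat (-ψl) (fun t => W t ω)).abs : EReal)
      + ((multiscaleStat ψu (fun t => W t ω)).abs : EReal) = ⊤ := by
    rcases h with h | h
    · rw [h, EReal.abs_top, EReal.coe_ennreal_top, EReal.add_top_of_ne_bot (EReal.coe_ne_bot _),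
        EReal.top_add_of_ne_bot (EReal.coe_ennreal_ne_bot _)]
    · rw [h, EReal.abs_top, EReal.coe_ennreal_top, EReal.add_top_of_ne_bot]
      exact EReal.add_ne_bot_iff.2 ⟨EReal.coe_ne_bot _, EReal.coe_ennreal_ne_bot _⟩
  have hl : 0 < √(Real.log (Real.exp 1 * n)) :=
    Real.sqrt_pos.2 (by linarith [one_le_log_exp_mul hn])
  rw [noiseFactor, hsum, EReal.top_div_of_pos_ne_top (by exact_mod_cast hl) (EReal.coe_ne_top _),
    EReal.add_top_of_ne_bot (by exact_mod_cast EReal.coe_ne_bot 1)]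

end NoiseFactor

theorem theorem5 {d : ℕ} (hd : 1 ≤ d) {j : ℕ} (hj : j = 1 ∨ j = 2)
    {β L : ℝ} (hβ_lower : (j : ℝ) - 1 < β) (hβ_upper : β ≤ j) (hL : 0 < L)
    {ψl ψu : (Fin d → ℝ) → ℝ} (hψl : IsKernel ψl) (hψu : IsKernel ψu) :
    ∃ (K₀ : ℝ) (K : ℝ → ℝ) (Δ₀ : ℝ → ℝ → ℝ) (Δ : ℝ → ℝ → ℝ → ℝ),
      0 < K₀ ∧ (∀ ε, 0 < K ε) ∧ (∀ α δ, 0 < Δ₀ α δ) ∧ (∀ α δ ε, 0 < Δ α δ ε) ∧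
      ∀ (Ω : Type*) [MeasurableSpace Ω] (P : Measure Ω) [IsProbabilityMeasure P]
        (W : (Fin d → ℝ) → Ω → ℝ), IsBrownianSheet W P →
      ∀ n : ℝ, 1 ≤ n → TwoSidedBias P W n (ShapeClass d j) ψl ψu →
      ∀ α : ℝ, 0 < α → α < 1 →
      ∀ t₀ : Fin d → ℝ, (∀ i, t₀ i ∈ Ioo 0 1) →
      ∀ ε : ℝ, 0 < ε → ε < 1 / 2 → supBox t₀ ε ⊆ Icc 0 1 →
      ∀ f ∈ ShapeClass d j, IsHolderOn β L (supBox t₀ ε) f →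
        -- bounds valid for every `n`, with constants that may depend on `ε`
        (∀ᵐ ω ∂P, bandWidth P W ψl ψu α n f t₀ ω ≤
          ((K ε * rate d β n : ℝ) : EReal) * noiseFactor P W ψl ψu α n ω) ∧
        (∀ δ : ℝ, 0 < δ → δ < 1 → ENNReal.ofReal (1 - δ) ≤
          P {ω | bandWidth P W ψl ψu α n f t₀ ω ≤ ((Δ α δ ε * rate d β n : ℝ) : EReal)}) ∧
        -- once `n` is so large that `(log (e n) / n) ^ (1 / (2 β + d)) ≤ ε`, the constants do not
        -- depend on `ε`
        ((Real.log (Real.exp 1 * n) / n) ^ (1 / (2 * β + d)) ≤ ε →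
          (∀ᵐ ω ∂P, bandWidth P W ψl ψu α n f t₀ ω ≤
            ((K₀ * rate d β n : ℝ) : EReal) * noiseFactor P W ψl ψu α n ω) ∧
          (∀ δ : ℝ, 0 < δ → δ < 1 → ENNReal.ofReal (1 - δ) ≤
            P {ω | bandWidth P W ψl ψu α n f t₀ ω ≤ ((Δ₀ α δ * rate d β n : ℝ) : EReal)}))
  := by
  obtain ⟨Vl, hl⟩ := hψl.exists_isTameKernel hd
  obtain ⟨Vu, hu⟩ := hψu.exists_isTameKernel hd
  have hβ : 0 < β := by rcases hj with rfl | rfl <;> norm_num at hβ_lower <;> linarith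
  obtain ⟨K₀, K, hK₀, hK, hwidth⟩ := exists_upperBand_sub_lowerBand_le hd hβ hL hψl hψu
  -- The constants must be fixed before the probability space, hence the bounds uniform over all
  -- Brownian sheets. Outside the admissible range of `α` the value `0` makes `B` a total function.
  have hcrit : ∀ α : ℝ, ∃ B : ℝ, 0 ≤ B ∧ (0 < α → α < 1 → ∀ (Ω : Type _) [MeasurableSpace Ω]
      (P : Measure Ω) [IsProbabilityMeasure P] (W : (Fin d → ℝ) → Ω → ℝ), IsBrownianSheet W P →
      |critValue P W ψl ψu α| ≤ B) := fun α => by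
    by_cases hα : 0 < α ∧ α < 1
    · obtain ⟨B, hB, h⟩ := exists_abs_critValue_le hl hu hψl.l2Norm_pos hψu.l2Norm_pos hα.1 hα.2
      exact ⟨B, hB, fun _ _ => h⟩
    · exact ⟨0, le_rfl, fun h1 h2 => absurd ⟨h1, h2⟩ hα⟩
  choose B hB0 hB using hcrit
  have htail : ∀ δ : ℝ, ∃ X : ℝ, 0 ≤ X ∧ (0 < δ → ∀ (Ω : Type _) [MeasurableSpace Ω]
      (P : Measure Ω) [IsProbabilityMeasure P] (W : (Fin d → ℝ) → Ω → ℝ), IsBrownianSheet W P →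
      P {ω | multiscaleStat ψu (fun t => W t ω) ≤ (X : EReal) ∧
        multiscaleStat (-ψl) (fun t => W t ω) ≤ (X : EReal)}ᶜ ≤ ENNReal.ofReal δ) := fun δ => by
    by_cases hδ : 0 < δ
    · obtain ⟨X₁, hX₁, h₁⟩ := hu.exists_measure_multiscaleStat_gt_le hψu.l2Norm_pos (half_pos hδ)
      obtain ⟨X₂, hX₂, h₂⟩ := hl.neg.exists_measure_multiscaleStat_gt_le
        (by rw [l2Norm_neg]; exact hψl.l2Norm_pos) (half_pos hδ)
      refine ⟨X₁ + X₂, by positivity, fun _ Ω _ P _ W hW => ?_⟩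
      have hsub : {ω | multiscaleStat ψu (fun t => W t ω) ≤ ((X₁ + X₂ : ℝ) : EReal) ∧
          multiscaleStat (-ψl) (fun t => W t ω) ≤ ((X₁ + X₂ : ℝ) : EReal)}ᶜ ⊆
          {ω | ¬ multiscaleStat ψu (fun t => W t ω) ≤ (X₁ : EReal)} ∪
          {ω | ¬ multiscaleStat (-ψl) (fun t => W t ω) ≤ (X₂ : EReal)} := by
        intro ω hω
        by_contra hcon
        simp only [mem_union, mem_ofPred_eq, not_or, not_not] at hcon
        exact hω ⟨hcon.1.trans (EReal.coe_le_coe_iff.2 (by linarith)),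
          hcon.2.trans (EReal.coe_le_coe_iff.2 (by linarith))⟩
      refine (measure_mono hsub).trans ((measure_union_le _ _).trans
        ((add_le_add (h₁ Ω P W hW) (h₂ Ω P W hW)).trans_eq ?_))
      rw [← ENNReal.ofReal_add (half_pos hδ).le (half_pos hδ).le, add_halves]
    · exact ⟨0, le_rfl, fun h => absurd h hδ⟩
  choose X hX0 hX using htail
  have hpos : ∀ α δ, 0 < 1 + (B α + X δ + X δ) := fun α δ => by
    linarith [hB0 α, hX0 δ]
  refine ⟨K₀, K, fun α δ => K₀ * (1 + (B α + X δ + X δ)),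
    fun α δ ε => K ε * (1 + (B α + X δ + X δ)), hK₀, hK, fun α δ => mul_pos hK₀ (hpos α δ),
    fun α δ ε => mul_pos (hK ε) (hpos α δ), ?_⟩
  intro Ω _ P _ W hW n hn hbias α hα hα1 t₀ _ ε hε0 hε ht f hfS hfH
  obtain ⟨hf, C, hC⟩ := ShapeClass.integrableOn hfS
  have hn0 : 0 < n := by linarith
  have hlin : 1 < β → ∀ h ∈ bandwidths d, t₀ ∈ centers h → ∀ i,
      ∫ x in Icc 0 1, scaledKernel ψl t₀ h x * x i = t₀ i * ((∏ i, h i) * ∫ x, ψl x) ∧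
      ∫ x in Icc 0 1, scaledKernel ψu t₀ h x * x i = t₀ i * ((∏ i, h i) * ∫ x, ψu x) := by
    intro hβ1 h hh hth i
    rcases hj with rfl | rfl
    · norm_num at hβ_upper; linarith
    · exact hbias.integral_scaledKernel_coordinate hW hl hu hψl.integral_pos hψu.integral_pos hn0
        hh hth i
  have hρ : 0 < rate d β n := rate_pos hn
  have hl1 : 1 ≤ √(Real.log (Real.exp 1 * n)) := Real.one_le_sqrt.2 (one_le_log_exp_mul hn)
  have hfin : ∀ ω Tl Tu, ContinuousOn (fun t => W t ω) (Icc 0 1) →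
      multiscaleStat ψu (fun t => W t ω) ≤ ((Tu : ℝ) : EReal) →
      multiscaleStat (-ψl) (fun t => W t ω) ≤ ((Tl : ℝ) : EReal) → _ := fun ω Tl Tu hω hTu hTl =>
    hwidth n (critValue P W ψl ψu α) C Tl Tu ε t₀ f (fun t => W t ω) hn hε0 hε ht hf hC hfH hω hlin
      hTu hTl
  -- both kinds of bounds follow from the deterministic one, for either choice of the constant
  have key : ∀ k : ℝ, 0 < k → (∀ ω Tl Tu, ContinuousOn (fun t => W t ω) (Icc 0 1) →
      multiscaleStat ψu (fun t => W t ω) ≤ ((Tu : ℝ) : EReal) →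
      multiscaleStat (-ψl) (fun t => W t ω) ≤ ((Tl : ℝ) : EReal) →
      bandWidth P W ψl ψu α n f t₀ ω ≤ ((k * rate d β n
        * (1 + (|critValue P W ψl ψu α| + |Tl| + |Tu|) / √(Real.log (Real.exp 1 * n))) : ℝ)
          : EReal)) →
      (∀ᵐ ω ∂P, bandWidth P W ψl ψu α n f t₀ ω ≤
        ((k * rate d β n : ℝ) : EReal) * noiseFactor P W ψl ψu α n ω) ∧
      ∀ δ : ℝ, 0 < δ → δ < 1 → ENNReal.ofReal (1 - δ) ≤ P {ω | bandWidth P W ψl ψu α n f t₀ ω ≤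
        ((k * (1 + (B α + X δ + X δ)) * rate d β n : ℝ) : EReal)} := by
    intro k hk hkey
    constructor
    · filter_upwards [hW.continuous] with ω hω
      -- If a statistic is infinite, so is the right-hand side and nothing has to be shown;
      -- otherwise both are real, being never `⊥`.
      by_cases htop : multiscaleStat (-ψl) (fun t => W t ω) = ⊤ ∨
          multiscaleStat ψu (fun t => W t ω) = ⊤
      · rw [noiseFactor_eq_top hn htop, EReal.coe_mul_top_of_pos (mul_pos hk hρ)]
        exact le_top
      · rw [not_or] at htop
        have e1 := (EReal.coe_toReal htop.1 (multiscaleStat_ne_bot _ _)).symm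
        have e2 := (EReal.coe_toReal htop.2 (multiscaleStat_ne_bot _ _)).symm
        rw [noiseFactor_eq_coe e1 e2, ← EReal.coe_mul]
        exact hkey ω _ _ hω e2.le e1.le
    · intro δ hδ _
      refine ofReal_one_sub_le_measure hδ.le (le_trans (measure_mono_ae ?_) (hX δ hδ Ω P W hW))
      filter_upwards [hW.continuous] with ω hω hnot hgood
      refine hnot ((hkey ω _ _ hω hgood.1 hgood.2).trans (EReal.coe_le_coe_iff.2 ?_))
      -- On the good event both statistics are replaced by the bound `X δ`, and the division by the
      -- root of `log (e n)`, which is at least `1`, is dropped.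
      rw [mul_right_comm, abs_of_nonneg (hX0 δ)]
      refine mul_le_mul_of_nonneg_right (mul_le_mul_of_nonneg_left ?_ hk.le) hρ.le
      have hX' := hX0 δ
      refine add_le_add_right ((div_le_self (by positivity) hl1).trans ?_) _
      linarith [hB α hα hα1 Ω P W hW]
  obtain ⟨a1, b1⟩ := key (K ε) (hK ε) fun ω Tl Tu hω hTu hTl => (hfin ω Tl Tu hω hTu hTl).1
  exact ⟨a1, b1, fun hR => key K₀ hK₀ fun ω Tl Tu hω hTu hTl => (hfin ω Tl Tu hω hTu hTl).2 hR⟩
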